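/- **Setting.** Let $1\le d\le 3$ and let $\mathcal T=\{K\}$ be a finite conforming triangulation by non-overlapping closed $d$-simplices (the intersection of two distinct cells is the convex hull of their common vertices, possibly empty) of a polygonal domain $\Omega\subset\mathbb R^d$, i.e. $\Omega$ is connected and nonempty and $\Omega=\operatorname{int}\bigcup_{K}K$. Let $h_K\in(0,1]$ be a measure of the size of the cell $K$, let $\Gamma=\partial\Omega$, let $\Gamma^0$ be the union of all facets of the mesh, and let $n$ be the outward unit normal (to $\Omega$ on $\Gamma$, to $K$ on $\partial K$). Let $\mu,\kappa,\alpha\ge0$ be constants and let $a:\overline\Omega\to\mathbb R^d$ be Lipschitz continuous and divergence-free in $\Omega$ with $\|a\|_{L^\infty(\Omega)}\le1$. Let $\zeta=1$ where $a\cdot n<0$ and $\zeta=0$ where $a\cdot n\ge0$ (on $\Gamma$ and on each $\partial K$); $\Gamma_-$ and $\Gamma_+$ are the parts of $\Gamma$ where $a\cdot n<0$ and $a\cdot n\ge0$, respectively. If $\kappa>0$, let $\Gamma_N,\Gamma_D$ be disjoint measurable subsets of $\Gamma$ that cover $\Gamma$ up to a set of surface measure zero; if $\kappa=0$, let $\Gamma_D=\emptyset$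 and $\Gamma_N=\Gamma_-$ (up to surface measure zero). **Boundary value problem.** $$\mu u+a\cdot\nabla u-\kappa\nabla^2u=f\ \text{ in }\Omega,$$ with, if $\kappa>0$, $(-\zeta ua+\kappa\nabla u)\cdot n=g$ on $\Gamma_N$ and $u=0$ on $\Gamma_D$, and, if $\kappa=0$, $-u\,a\cdot n=g$ on $\Gamma_-$. The equation holds almost everywhere with weak derivatives, and the boundary conditions hold almost everywhere in the sense of traces. **Method.** Let $k\in\mathbb N$ and $0\le l\le1$, and put $$W_h=\{w\in L^2(\Omega): w|_K\in P_k(K)\ \forall K\},$$ $$\bar W_h=\{\bar w\in H^l(\Gamma^0): \bar w|_F\in P_k(F)\ \text{for every facet }F,\ \bar w=0\text{ on }\Gamma_D\},$$ where $P_k$ denotes the polynomials of degree at most $k$ and $W_h^\star=W_h\times\bar W_h$. Here $H^0(\Gamma^0)=L^2(\Gamma^0)$; for $0<l<1$, $H^l(\Gamma^0)$ is the Sobolev–Slobodeckij space; and $H^1(\Gamma^0)$ is the closure of the restrictions of smooth functions with respect to the $L^2(\Gamma^0)$ norm of the function and of its facet-wise tangential gradient. For $\mathbf w=(w,\bar w)$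 and $\mathbf v=(v,\bar v)$ let, with gradients and traces of $w$, $v$ on $\partial K$ taken cell by cell, $$\begin{aligned}B(\mathbf w,\mathbf v)={}&\int_\Omega\mu wv\,dx+\sum_K\int_K(-aw+\kappa\nabla w)\cdot\nabla v\,dx\\ &+\sum_K\int_{\partial K}\Big(-aw+\kappa\nabla w-\big(\zeta a-\tfrac{\alpha\kappa}{h_K}n\big)(\bar w-w)\Big)\cdot n\,(\bar v-v)\,ds\\ &+\sum_K\int_{\partial K}\kappa(\bar w-w)\nabla v\cdot n\,ds+\int_{\Gamma_+}a\cdot n\,\bar v\,\bar w\,ds,\end{aligned}$$ $$L(\mathbf v)=\int_\Omega fv\,dx+\int_{\Gamma_N}g\bar v\,ds.$$ **Lemma (consistency).** Let $u\in H^m(\Omega)$, with $m=2$ if $\kappa>0$ and $m=1$ if $\kappa=0$, be a solution of the boundary value problem, and let $\mathbf u=(u,\gamma u)$, where $\gamma u$ is the trace of $u$ on $\Gamma^0$. Let $\mathbf u_h\in W_h^\star$ satisfy $B(\mathbf u_h,\mathbf v_h)=L(\mathbf v_h)$ for all $\mathbf v_h\in W_h^\star$. Then $$B(\mathbf u-\mathbf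 u_h,\mathbf v_h)=0\qquad\text{for all }\mathbf v_h\in W_h^\star .$$ -/

import Mathlib

open MeasureTheory Filter Topology
open scoped ContDiff

noncomputable section

namespace InterfaceFEM

/-- Euclidean space `ℝ^d`. -/
abbrev E (d : ℕ) : Type := EuclideanSpace ℝ (Fin d)

/-! ### Weak derivatives, Sobolev spaces -/

/-- The `j`-th classical partial derivative. -/
def partialDeriv {d : ℕ} (j : Fin d) (φ : E d → ℝ) (x : E d) : ℝ :=
  fderiv ℝ φ x (EuclideanSpace.single j 1)

/-- `φ` is a test function on the open set `U`, i.e. `φ ∈ C_c^∞(U)`. -/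
def IsTestFunction {d : ℕ} (U : Set (E d)) (φ : E d → ℝ) : Prop :=
  ContDiff ℝ ∞ φ ∧ HasCompactSupport φ ∧ tsupport φ ⊆ U

/-- `p` is the `j`-th weak partial derivative of `w` on the open set `U`. -/
def IsWeakPartial {d : ℕ} (U : Set (E d)) (j : Fin d) (w p : E d → ℝ) : Prop :=
  LocallyIntegrableOn w U ∧ LocallyIntegrableOn p U ∧
    ∀ φ : E d → ℝ, IsTestFunction U φ →
      ∫ x in U, w x * partialDeriv j φ x = -∫ x in U, p x * φ x

open Classical in
/-- A representative of the `j`-th weak partial derivative of `w` on `U`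
(the zero function if there is no weak derivative). -/
def weakPartial {d : ℕ} (U : Set (E d)) (j : Fin d) (w : E d → ℝ) : E d → ℝ :=
  if h : ∃ p, IsWeakPartial U j w p then h.choose else 0

/-- The weak gradient of `w` on `U`. -/
def weakGrad {d : ℕ} (U : Set (E d)) (w : E d → ℝ) (x : E d) : E d :=
  WithLp.toLp 2 fun j => weakPartial U j w x

/-- The weak Laplacian of `w` on `U`. -/
def weakLaplacian {d : ℕ} (U : Set (E d)) (w : E d → ℝ) (x : E d) : ℝ :=
  ∑ j, weakPartial U j (weakPartial U j w) x

/-- `w ∈ H^m(U)`: `w ∈ L²(U)` and all weak derivatives of order at most `m` are in `L²(U)`. -/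
def MemSobolev {d : ℕ} : ℕ → Set (E d) → (E d → ℝ) → Prop
  | 0, U, w => MemLp w 2 (volume.restrict U)
  | m + 1, U, w => MemLp w 2 (volume.restrict U) ∧
      ∀ j, ∃ p, IsWeakPartial U j w p ∧ MemSobolev m U p

/-- The vector field `a` is divergence-free in `U` (in the sense of distributions). -/
def IsDivFree {d : ℕ} (U : Set (E d)) (a : E d → E d) : Prop :=
  ∀ φ : E d → ℝ, IsTestFunction U φ → ∫ x in U, fderiv ℝ φ x (a x) = 0

/-! ### Simplices -/

section Simplex

variable {d : ℕ}

/-- The closed cell spanned by the vertices of a simplex. -/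
def hull (K : Affine.Simplex ℝ (E d) d) : Set (E d) :=
  convexHull ℝ (Set.range K.points)

/-- The facet of a simplex opposite to its vertex `i`. -/
def facet (K : Affine.Simplex ℝ (E d) d) (i : Fin (d + 1)) : Set (E d) :=
  convexHull ℝ (K.points '' {i}ᶜ)

/-- The `(d-1)`-dimensional surface measure on a facet (counting measure if `d = 1`). -/
def facetMeasure (K : Affine.Simplex ℝ (E d) d) (i : Fin (d + 1)) : Measure (E d) :=
  (Measure.euclideanHausdorffMeasure (d - 1)).restrict (facet K i)

/-- The surface measure on the boundary `∂K`, the union of the facets of `K`. -/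
def bdryMeasure (K : Affine.Simplex ℝ (E d) d) : Measure (E d) :=
  (Measure.euclideanHausdorffMeasure (d - 1)).restrict (⋃ i, facet K i)

/-- The outward unit normal of `K` on the facet opposite to the vertex `i`: the normalised vector
from this vertex to the foot of its altitude. -/
def normal [NeZero d] (K : Affine.Simplex ℝ (E d) d) (i : Fin (d + 1)) : E d :=
  ‖K.altitudeFoot i - K.points i‖⁻¹ • (K.altitudeFoot i - K.points i)

/-- `t` is the trace on `∂K` of `w ∈ H¹(K)`: it is the limit in `L²(∂K)` of the restrictions to
`∂K` of some smooth functions that converge to `w` in `H¹(K)`. -/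
def IsTrace (K : Affine.Simplex ℝ (E d) d) (w t : E d → ℝ) : Prop :=
  MemSobolev 1 (interior (hull K)) w ∧ MemLp t 2 (bdryMeasure K) ∧
    ∃ φ : ℕ → E d → ℝ, (∀ n, ContDiff ℝ ∞ (φ n)) ∧
      Tendsto (fun n => eLpNorm (φ n - w) 2 (volume.restrict (interior (hull K)))) atTop (𝓝 0) ∧
      (∀ j, Tendsto (fun n => eLpNorm (partialDeriv j (φ n) - weakPartial (interior (hull K)) j w)
        2 (volume.restrict (interior (hull K)))) atTop (𝓝 0)) ∧
      Tendsto (fun n => eLpNorm (φ n - t) 2 (bdryMeasure K)) atTop (𝓝 0)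

open Classical in
/-- (A representative of) the trace on `∂K` of `w ∈ H¹(K)`. -/
def trace (K : Affine.Simplex ℝ (E d) d) (w : E d → ℝ) : E d → ℝ :=
  if h : ∃ t, IsTrace K w t then h.choose else 0

/-- The trace on `∂K` of the gradient of `w ∈ H²(K)`. -/
def traceGrad (K : Affine.Simplex ℝ (E d) d) (w : E d → ℝ) (x : E d) : E d :=
  WithLp.toLp 2 fun j => trace K (weakPartial (interior (hull K)) j w) x

end Simplex

/-! ### Triangulations -/

/-- A conforming triangulation of `Ω` by finitely many non-overlapping closed `d`-simplices, with
cell sizes `h_K ∈ (0, 1]`.  A set `Ω` that has such a triangulation is a bounded open polygonal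
(polyhedral) set that does not lie on both sides of a facet in its boundary. -/
structure Triangulation {d : ℕ} (Ω : Set (E d)) (ι : Type*) where
  cell : ι → Affine.Simplex ℝ (E d) d
  domain_eq : Ω = interior (⋃ K, hull (cell K))
  nonoverlapping : ∀ K K', K ≠ K' →
    Disjoint (interior (hull (cell K))) (interior (hull (cell K')))
  conforming : ∀ K K', K ≠ K' → hull (cell K) ∩ hull (cell K') =
    convexHull ℝ (Set.range (cell K).points ∩ Set.range (cell K').points)
  size : ι → ℝ
  size_pos : ∀ K, 0 < size K
  size_le_one : ∀ K, size K ≤ 1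

section Method

variable {d : ℕ} {Ω : Set (E d)} {ι : Type*}

/-- The interior of the cell `K`. -/
def Triangulation.cellInt (T : Triangulation Ω ι) (K : ι) : Set (E d) :=
  interior (hull (T.cell K))

/-- The facet of `K` opposite to its vertex `i` lies in the boundary `Γ = ∂Ω`. -/
def Triangulation.IsBdryFacet (T : Triangulation Ω ι) (K : ι) (i : Fin (d + 1)) : Prop :=
  facet (T.cell K) i ⊆ frontier Ω

/-- The union `Γ⁰` of all facets of the mesh. -/
def Triangulation.skeleton (T : Triangulation Ω ι) : Set (E d) :=
  ⋃ K, ⋃ i, facet (T.cell K) i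

/-- The surface measure on `Γ⁰`. -/
def Triangulation.skeletonMeasure (T : Triangulation Ω ι) : Measure (E d) :=
  (Measure.euclideanHausdorffMeasure (d - 1)).restrict T.skeleton

open Classical in
/-- (A representative of) the trace on `Γ⁰` of a function `u ∈ H¹(Ω)`: the single-valued function
on `Γ⁰` that coincides on `∂K` with the trace of `u|_K`, for all cells `K`. -/
def Triangulation.skeletonTrace (T : Triangulation Ω ι) (u : E d → ℝ) : E d → ℝ :=
  if h : ∃ t : E d → ℝ, ∀ K, t =ᵐ[bdryMeasure (T.cell K)] trace (T.cell K) u then h.choose else 0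

/-- The inflow indicator `ζ`: it is `1` where `a · n < 0` and `0` where `a · n ≥ 0`. -/
def zeta (a : E d → E d) (n x : E d) : ℝ :=
  if inner ℝ (a x) n < 0 then 1 else 0

/-! ### Finite element spaces -/

/-- `v` agrees `ν`-almost everywhere with a polynomial of degree at most `k`. -/
def IsPolyAE (k : ℕ) (ν : Measure (E d)) (v : E d → ℝ) : Prop :=
  ∃ p : MvPolynomial (Fin d) ℝ, p.totalDegree ≤ k ∧
    v =ᵐ[ν] fun x => MvPolynomial.eval (fun j => x j) p

/-- The cell space `W_h`. -/
def Wh (T : Triangulation Ω ι) (k : ℕ) : Set (E d → ℝ) :=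
  {v | MemLp v 2 (volume.restrict Ω) ∧ ∀ K, IsPolyAE k (volume.restrict (T.cellInt K)) v}

/-- `v ∈ H^l(Γ⁰)` for `0 ≤ l ≤ 1`: the space `L²(Γ⁰)` for `l = 0`, the Sobolev-Slobodeckij space
for `0 < l < 1`, and for `l = 1` the closure of the restrictions of smooth functions with respect
to the `L²(Γ⁰)` norm of the function and of its facet-wise tangential gradient. -/
def MemSkeletonSobolev [NeZero d] (T : Triangulation Ω ι) (l : ℝ) (v : E d → ℝ) : Prop :=
  MemLp v 2 T.skeletonMeasure ∧
  (0 < l → l < 1 →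
    ∫⁻ x, ∫⁻ y, ‖v x - v y‖ₑ ^ 2 / edist x y ^ ((d : ℝ) - 1 + 2 * l)
      ∂T.skeletonMeasure ∂T.skeletonMeasure < ⊤) ∧
  (l = 1 → ∃ (φ : ℕ → E d → ℝ) (G : ι → Fin (d + 1) → E d → E d),
    (∀ n, ContDiff ℝ ∞ (φ n)) ∧
    Tendsto (fun n => eLpNorm (φ n - v) 2 T.skeletonMeasure) atTop (𝓝 0) ∧
    ∀ K i, MemLp (G K i) 2 (facetMeasure (T.cell K) i) ∧
      Tendsto (fun n => eLpNorm (fun x => gradient (φ n) x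
          - inner ℝ (gradient (φ n) x) (normal (T.cell K) i) • normal (T.cell K) i - G K i x)
        2 (facetMeasure (T.cell K) i)) atTop (𝓝 0))

/-- The interface space `\bar W_h`.  Its elements are single-valued functions on `Γ⁰`. -/
def Whbar [NeZero d] (T : Triangulation Ω ι) (k : ℕ) (l : ℝ) (ΓD : Set (E d)) :
    Set (E d → ℝ) :=
  {v | MemSkeletonSobolev T l v ∧ (∀ K i, IsPolyAE k (facetMeasure (T.cell K) i) v) ∧
    ∀ᵐ x ∂((Measure.euclideanHausdorffMeasure (d - 1)).restrict ΓD), v x = 0}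

/-! ### The boundary value problem

Surface integrals over `Γ`, and statements almost everywhere on `Γ`, are written facet by facet;
the outward normal of `Ω` on a facet in `Γ` is the one of the cell to which the facet belongs. -/

/-- The Neumann and Dirichlet parts of `Γ`.  For `κ > 0` they form a partition of `Γ`, up to a set
of surface measure zero; for `κ = 0`, `Γ_D` is empty and `Γ_N` is the inflow boundary `Γ₋`. -/
structure IsBdryPartition [NeZero d] (T : Triangulation Ω ι) (κ : ℝ) (a : E d → E d)
    (ΓN ΓD : Set (E d)) : Prop where
  measurable_N : MeasurableSet ΓN
  measurable_D : MeasurableSet ΓD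
  subset_N : ΓN ⊆ frontier Ω
  subset_D : ΓD ⊆ frontier Ω
  disjoint : Disjoint ΓN ΓD
  cover : 0 < κ → Measure.euclideanHausdorffMeasure (d - 1) (frontier Ω \ (ΓN ∪ ΓD)) = 0
  dirichlet_empty : κ = 0 → ΓD = ∅
  neumann_inflow : κ = 0 → ∀ K i, T.IsBdryFacet K i →
    ∀ᵐ x ∂(facetMeasure (T.cell K) i), x ∈ ΓN ↔ inner ℝ (a x) (normal (T.cell K) i) < 0

/-- `u` satisfies `μ u + a · ∇u - κ Δu = f` almost everywhere in `Ω`. -/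
def SolvesPDE (Ω : Set (E d)) (μ κ : ℝ) (a : E d → E d) (f u : E d → ℝ) : Prop :=
  ∀ᵐ x ∂(volume.restrict Ω),
    μ * u x + inner ℝ (a x) (weakGrad Ω u x) - κ * weakLaplacian Ω u x = f x

/-- The boundary conditions, in the sense of traces: `(-ζ u a + κ ∇u) · n = g` on `Γ_N` and `u = 0`
on `Γ_D` if `κ > 0`, and `-u a · n = g` on `Γ_N = Γ₋` if `κ = 0`. -/
def SatisfiesBC [NeZero d] (T : Triangulation Ω ι) (κ : ℝ) (a : E d → E d)
    (ΓN ΓD : Set (E d)) (g u : E d → ℝ) : Prop :=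
  ∀ K i, T.IsBdryFacet K i → ∀ᵐ x ∂(facetMeasure (T.cell K) i),
    (0 < κ →
      (x ∈ ΓN → inner ℝ (-(zeta a (normal (T.cell K) i) x * trace (T.cell K) u x) • a x
        + κ • traceGrad (T.cell K) u x) (normal (T.cell K) i) = g x) ∧
      (x ∈ ΓD → trace (T.cell K) u x = 0)) ∧
    (κ = 0 → x ∈ ΓN → -(trace (T.cell K) u x * inner ℝ (a x) (normal (T.cell K) i)) = g x)

/-! ### The method -/

/-- The numerical flux
`-a w + κ ∇w - (ζ a - (α κ / h_K) n) (\bar w - w)` of the cell `K` on its facet `i`. -/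
def numFlux [NeZero d] (T : Triangulation Ω ι) (κ α : ℝ) (a : E d → E d) (w wbar : E d → ℝ)
    (K : ι) (i : Fin (d + 1)) (x : E d) : E d :=
  -(trace (T.cell K) w x • a x) + κ • traceGrad (T.cell K) w x
    - (wbar x - trace (T.cell K) w x) •
      (zeta a (normal (T.cell K) i) x • a x - (α * κ / T.size K) • normal (T.cell K) i)

open Classical in
/-- The bilinear form `B((w, \bar w), (v, \bar v))`, for cell-wise Sobolev functions `w`, `v` and
functions `\bar w`, `\bar v` on `Γ⁰`.  Gradients are taken cell by cell. -/
def B [NeZero d] [Fintype ι] (T : Triangulation Ω ι) (μ κ α : ℝ) (a : E d → E d)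
    (w wbar v vbar : E d → ℝ) : ℝ :=
  (∫ x in Ω, μ * w x * v x)
  + (∑ K, ∫ x in T.cellInt K,
      inner ℝ (-(w x • a x) + κ • weakGrad (T.cellInt K) w x) (weakGrad (T.cellInt K) v x))
  + (∑ K, ∑ i, ∫ x, inner ℝ (numFlux T κ α a w wbar K i x) (normal (T.cell K) i)
      * (vbar x - trace (T.cell K) v x) ∂(facetMeasure (T.cell K) i))
  + (∑ K, ∑ i, ∫ x, κ * (wbar x - trace (T.cell K) w x)
      * inner ℝ (traceGrad (T.cell K) v x) (normal (T.cell K) i) ∂(facetMeasure (T.cell K) i))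
  + ∑ K, ∑ i, if T.IsBdryFacet K i then
      ∫ x in {x | 0 ≤ inner ℝ (a x) (normal (T.cell K) i)},
        inner ℝ (a x) (normal (T.cell K) i) * vbar x * wbar x ∂(facetMeasure (T.cell K) i)
    else 0

open Classical in
/-- The linear form `L((v, \bar v)) = ∫_Ω f v + ∫_{Γ_N} g \bar v`. -/
def L [Fintype ι] (T : Triangulation Ω ι) (ΓN : Set (E d)) (f g v vbar : E d → ℝ) : ℝ :=
  (∫ x in Ω, f x * v x)
  + ∑ K, ∑ i, if T.IsBdryFacet K i then
      ∫ x in ΓN, g x * vbar x ∂(facetMeasure (T.cell K) i)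
    else 0

/-- `(u_h, \bar u_h) ∈ W_h × \bar W_h` solves the finite element problem. -/
def SolvesFE [NeZero d] [Fintype ι] (T : Triangulation Ω ι) (k : ℕ) (l μ κ α : ℝ)
    (a : E d → E d) (ΓN ΓD : Set (E d)) (f g uh uhbar : E d → ℝ) : Prop :=
  uh ∈ Wh T k ∧ uhbar ∈ Whbar T k l ΓD ∧
    ∀ v ∈ Wh T k, ∀ vbar ∈ Whbar T k l ΓD,
      B T μ κ α a uh uhbar v vbar = L T ΓN f g v vbar

end Method

end InterfaceFEM

end

open InterfaceFEM

open MeasureTheory Filter Topology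
open scoped ContDiff

noncomputable section

namespace InterfaceFEM

/-! ### Barycentric coordinates -/

section Barycentric

variable {d : ℕ}

/-! The form `B` is linear in its first argument and the discrete solution satisfies `B = L`, so the
claim reduces to `B_skeletonTrace_eq_L`: the exact solution, paired with its trace, satisfies the
discrete equations.

Put the trace of u for the interface variable. All terms containing the difference between the
interface value and the cell trace vanish, and the numerical flux becomes the physical flux -a u +
κ∇u. On each cell v is a polynomial. Integration by parts (`integral_flux`, where the advective part
uses div a = 0) and the differential equation turn the volume terms into ∫ f v plus a boundary
integral of the normal flux times v (`SolvesPDE.integral_cell`). The v-part of the interface term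
cancels that boundary integral. What remains is the normal flux times the interface test function,
summed over all facets of all cells.

On a facet inside Ω the two contributions cancel: the interface function is single-valued, the
traces of u and ∇u from both sides agree, and the normals are opposite (`sum_integral_normal_flux`).
On a facet in Γ the outflow term is added; since min(a·n, 0) + max(a·n, 0) = a·n, the sum is (κ∇u -
ζ u a)·n times the test function. This is g times the test function on Γ_N. Off Γ_N it vanishes: for
κ > 0 the test function is zero on Γ_D, and for κ = 0 one has a·n ≥ 0 there
(`SatisfiesBC.integral_facet`).

Two foundations support this argument. The analytic one is the divergence theorem on a simplex
(`integral_fderiv_hull`), density of smooth functions in H¹(K) (`exists_smooth_approx`) and the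
trace inequality (`eLpNorm_bdry_sq_le`), which give traces and Green's formulas by passage to the
limit. The geometric one is that a facet not contained in Γ belongs to exactly one other cell, on
its other side (`Triangulation.exists_adj`, `Triangulation.Adj.unique`), and that traces from the
two sides agree (`Triangulation.Adj.trace_ae_eq`).

For κ = 0 only H¹ regularity is available. Second derivatives and gradient traces of u then occur
only with the factor κ, which removes them. -/

/-- The vertices of a `d`-simplex in `ℝ^d` as an affine basis. -/
def vertexBasis (K : Affine.Simplex ℝ (E d) d) : AffineBasis (Fin (d + 1)) ℝ (E d) :=
  ⟨K.points, K.independent,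
    K.independent.affineSpan_eq_top_iff_card_eq_finrank_add_one.2 (by simp)⟩

/-- The barycentric coordinates of a `d`-simplex in `ℝ^d`. -/
def bary (K : Affine.Simplex ℝ (E d) d) (i : Fin (d + 1)) : E d →ᵃ[ℝ] ℝ :=
  (vertexBasis K).coord i

lemma coe_vertexBasis (K : Affine.Simplex ℝ (E d) d) : ⇑(vertexBasis K) = K.points := rfl

lemma bary_vertex (K : Affine.Simplex ℝ (E d) d) (i j : Fin (d + 1)) :
    bary K i (K.points j) = if i = j then 1 else 0 :=
  (vertexBasis K).coord_apply i j

lemma bary_self (K : Affine.Simplex ℝ (E d) d) (i : Fin (d + 1)) :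
    bary K i (K.points i) = 1 := by
  simp [bary_vertex]

lemma bary_ne (K : Affine.Simplex ℝ (E d) d) {i j : Fin (d + 1)} (h : i ≠ j) :
    bary K i (K.points j) = 0 := by
  simp [bary_vertex, h]

lemma sum_bary (K : Affine.Simplex ℝ (E d) d) (x : E d) : ∑ i, bary K i x = 1 :=
  (vertexBasis K).sum_coord_apply_eq_one x

lemma sum_bary_smul (K : Affine.Simplex ℝ (E d) d) (x : E d) :
    ∑ i, bary K i x • K.points i = x :=
  (vertexBasis K).linear_combination_coord_eq_self x

lemma continuous_bary (K : Affine.Simplex ℝ (E d) d) (i : Fin (d + 1)) :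
    Continuous (bary K i) :=
  (bary K i).continuous_of_finiteDimensional

lemma affineMap_add_smul (f : E d →ᵃ[ℝ] ℝ) (x v : E d) (s : ℝ) :
    f (x + s • v) = f x + s * f.linear v := by
  have := f.map_vadd x (s • v)
  simp only [vadd_eq_add, map_smul, smul_eq_mul] at this
  rw [add_comm x, this, add_comm]

lemma affineMap_linear_sub (f : E d →ᵃ[ℝ] ℝ) (x y : E d) :
    f.linear (x - y) = f x - f y := by
  simpa using f.linearMap_vsub x y

/-- An affine function is determined by its values at the vertices. -/
lemma affineMap_eq_sum_bary (K : Affine.Simplex ℝ (E d) d) (f : E d →ᵃ[ℝ] ℝ) (x : E d) :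
    f x = ∑ i, bary K i x * f (K.points i) := by
  have h : f x = f 0 + f.linear x := by
    simpa using affineMap_add_smul f 0 x 1
  have h2 : ∀ i, f (K.points i) = f 0 + f.linear (K.points i) := fun i => by
    simpa using affineMap_add_smul f 0 (K.points i) 1
  simp_rw [h2, mul_add, Finset.sum_add_distrib, ← Finset.sum_mul, sum_bary, h]
  conv_lhs => rw [← sum_bary_smul K x]
  simp

lemma hull_eq (K : Affine.Simplex ℝ (E d) d) : hull K = {x | ∀ i, 0 ≤ bary K i x} :=
  (vertexBasis K).convexHull_eq_nonneg_coord

lemma interior_hull_eq (K : Affine.Simplex ℝ (E d) d) :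
    interior (hull K) = {x | ∀ i, 0 < bary K i x} :=
  (vertexBasis K).interior_convexHull

lemma mem_hull {K : Affine.Simplex ℝ (E d) d} {x : E d} : x ∈ hull K ↔ ∀ i, 0 ≤ bary K i x := by
  rw [hull_eq]; rfl

lemma mem_interior_hull {K : Affine.Simplex ℝ (E d) d} {x : E d} :
    x ∈ interior (hull K) ↔ ∀ i, 0 < bary K i x := by
  rw [interior_hull_eq]; rfl

/-- The faces of a simplex in terms of barycentric coordinates. -/
lemma mem_convexHull_image {K : Affine.Simplex ℝ (E d) d} {S : Set (Fin (d + 1))} {x : E d} :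
    x ∈ convexHull ℝ (K.points '' S) ↔ x ∈ hull K ∧ ∀ i ∉ S, bary K i x = 0 := by
  classical
  constructor
  · intro hx
    refine ⟨convexHull_mono (Set.image_subset_range _ _) hx, fun i hi => ?_⟩
    have : convexHull ℝ (K.points '' S) ⊆ (bary K i) ⁻¹' {0} := by
      refine convexHull_min ?_ ((convex_singleton (0 : ℝ)).affine_preimage (bary K i))
      rintro _ ⟨j, hj, rfl⟩
      exact bary_ne K (by rintro rfl; exact hi hj)
    exact this hx
  · rintro ⟨hx, h0⟩
    rw [← sum_bary_smul K x]
    have hsub : ∑ i, bary K i x • K.points i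
        = ∑ i ∈ Finset.univ.filter (· ∈ S), bary K i x • K.points i := by
      rw [Finset.sum_filter]
      refine Finset.sum_congr rfl fun i _ => ?_
      split_ifs with h
      · rfl
      · rw [h0 i h, zero_smul]
    rw [hsub]
    refine (convex_convexHull ℝ _).sum_mem (fun i _ => mem_hull.1 hx i) ?_ fun i hi => ?_
    · rw [← sum_bary K x, Finset.sum_filter]
      refine Finset.sum_congr rfl fun i _ => ?_
      split_ifs with h
      · rfl
      · rw [h0 i h]
    · exact subset_convexHull ℝ _ ⟨i, by simpa using hi, rfl⟩

lemma mem_facet {K : Affine.Simplex ℝ (E d) d} {i : Fin (d + 1)} {x : E d} :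
    x ∈ facet K i ↔ x ∈ hull K ∧ bary K i x = 0 := by
  rw [facet, mem_convexHull_image]
  simp

lemma isCompact_hull (K : Affine.Simplex ℝ (E d) d) : IsCompact (hull K) :=
  (Set.finite_range _).isCompact_convexHull ℝ

lemma isCompact_facet (K : Affine.Simplex ℝ (E d) d) (i : Fin (d + 1)) : IsCompact (facet K i) :=
  (Set.toFinite _).isCompact_convexHull ℝ

lemma convex_hull (K : Affine.Simplex ℝ (E d) d) : Convex ℝ (hull K) := convex_convexHull ℝ _

lemma facet_subset_hull (K : Affine.Simplex ℝ (E d) d) (i : Fin (d + 1)) :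
    facet K i ⊆ hull K := fun _ hx => (mem_facet.1 hx).1

lemma interior_hull_nonempty (K : Affine.Simplex ℝ (E d) d) : (interior (hull K)).Nonempty :=
  ⟨_, (vertexBasis K).centroid_mem_interior_convexHull⟩

lemma closure_interior_hull (K : Affine.Simplex ℝ (E d) d) :
    closure (interior (hull K)) = hull K := by
  rw [(convex_hull K).closure_interior_eq_closure_of_nonempty_interior (interior_hull_nonempty K),
    (isCompact_hull K).isClosed.closure_eq]

end Barycentric

/-! ### Normals -/

section Normal

variable {d : ℕ} [NeZero d]

lemma normal_norm (K : Affine.Simplex ℝ (E d) d) (i : Fin (d + 1)) : ‖normal K i‖ = 1 := by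
  have h : ‖K.altitudeFoot i - K.points i‖ ≠ 0 := by
    rw [norm_ne_zero_iff, sub_ne_zero]
    exact (K.ne_altitudeFoot i).symm
  rw [normal, norm_smul, norm_inv, norm_norm, inv_mul_cancel₀ h]

/-- The foot of the altitude is the orthogonal projection of the vertex onto the span of the
opposite face, so the altitude is orthogonal to all directions of that face. -/
lemma inner_altitude (K : Affine.Simplex ℝ (E d) d) {i j : Fin (d + 1)} (h : j ≠ i) :
    inner ℝ (K.altitudeFoot i - K.points i) (K.points j - K.altitudeFoot i) = 0 := by
  have h1 : K.points j ∈ affineSpan ℝ (Set.range (K.faceOpposite i).points) := by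
    rw [K.range_faceOpposite_points]
    exact mem_affineSpan ℝ ⟨j, by simpa using h, rfl⟩
  have h2 := (K.faceOpposite i).orthogonalProjectionSpan (K.points i) |>.2
  have h3 : K.points j - K.altitudeFoot i ∈
      (affineSpan ℝ (Set.range (K.faceOpposite i).points)).direction :=
    AffineSubspace.vsub_mem_direction h1 h2
  have h4 := EuclideanGeometry.orthogonalProjection_vsub_mem_direction_orthogonal
    (affineSpan ℝ (Set.range (K.faceOpposite i).points)) (K.points i)
  exact Submodule.inner_left_of_mem_orthogonal h3 h4

/-- The gradient of a barycentric coordinate is a negative multiple of the outward normal of the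
facet on which the coordinate vanishes. -/
lemma linear_bary_eq_inner (K : Affine.Simplex ℝ (E d) d) (i : Fin (d + 1)) (v : E d) :
    (bary K i).linear v = -(‖K.altitudeFoot i - K.points i‖⁻¹ * inner ℝ (normal K i) v) := by
  set w := K.altitudeFoot i - K.points i with hw
  have hw0 : ‖w‖ ≠ 0 := by
    rw [norm_ne_zero_iff, sub_ne_zero]
    exact (K.ne_altitudeFoot i).symm
  -- It is enough to compare the two linear maps on the edges issuing from vertex `i`. Along such an
  -- edge the coordinate drops from 1 to 0, and the edge is `w` plus a vector orthogonal to `w`.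
  have key : (bary K i).linear = -((‖w‖⁻¹ * ‖w‖⁻¹) • (innerₛₗ ℝ w)) := by
    refine ((vertexBasis K).basisOf i).ext fun j => ?_
    have h1 : (vertexBasis K).basisOf i j = K.points j - K.points i := by
      simp [coe_vertexBasis]
    have h2 : K.points j - K.points i = (K.points j - K.altitudeFoot i) + w := by
      rw [hw]; abel
    rw [h1, affineMap_linear_sub, bary_self, bary_ne K j.2.symm, h2]
    simp only [LinearMap.neg_apply, LinearMap.smul_apply, innerₛₗ_apply_apply, inner_add_right,
      smul_eq_mul]
    rw [inner_altitude K j.2, real_inner_self_eq_norm_sq]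
    field_simp
    ring
  rw [key]
  simp only [LinearMap.neg_apply, LinearMap.smul_apply, innerₛₗ_apply_apply, smul_eq_mul, normal,
    real_inner_smul_left, ← hw]
  ring

/-- The factor is the inverse length of the altitude; later arguments need only its positivity. -/
lemma exists_linear_bary (K : Affine.Simplex ℝ (E d) d) (i : Fin (d + 1)) :
    ∃ c : ℝ, 0 < c ∧ ∀ v, (bary K i).linear v = -(c * inner ℝ (normal K i) v) := by
  refine ⟨_, ?_, linear_bary_eq_inner K i⟩
  rw [inv_pos, norm_pos_iff, sub_ne_zero]
  exact (K.ne_altitudeFoot i).symm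

end Normal

/-! ### Surface measure and slicing -/

section Slicing

variable {d : ℕ}

/-- The hyperplane through `p` with normal `n`. -/
def hyperplane (p n : E d) : Set (E d) := {x | inner ℝ n (x - p) = 0}

lemma isClosed_hyperplane (p n : E d) : IsClosed (hyperplane p n) :=
  isClosed_eq (by fun_prop) continuous_const

lemma finrank_orthogonal {n : E d} (hn : ‖n‖ = 1) :
    Module.finrank ℝ (ℝ ∙ n)ᗮ = d - 1 := by
  have h := (ℝ ∙ n).finrank_add_finrank_orthogonal
  rw [finrank_span_singleton (by rintro rfl; simp at hn), finrank_euclideanSpace_fin] at h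
  omega

lemma range_add_orthogonal (p n : E d) :
    Set.range (fun v : (ℝ ∙ n)ᗮ => p + (v : E d)) = hyperplane p n := by
  ext x
  constructor
  · rintro ⟨v, rfl⟩
    have := Submodule.mem_orthogonal_singleton_iff_inner_right.1 v.2
    simpa [hyperplane] using this
  · intro hx
    exact ⟨⟨x - p, Submodule.mem_orthogonal_singleton_iff_inner_right.2 hx⟩, by simp⟩

/-- An isometry transports Hausdorff measure, and on the orthogonal complement, which has dimension
`d - 1`, the Euclidean Hausdorff measure is Lebesgue measure. This fixes the normalisation of the
surface measure and hence the constants in the divergence theorem. -/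
lemma map_volume_orthogonal {n : E d} (hn : ‖n‖ = 1) (p : E d) :
    Measure.map (fun v : (ℝ ∙ n)ᗮ => p + (v : E d)) volume =
      (Measure.euclideanHausdorffMeasure (d - 1)).restrict (hyperplane p n) := by
  have hiso : Isometry (fun v : (ℝ ∙ n)ᗮ => p + (v : E d)) :=
    (IsometryEquiv.addLeft p).isometry.comp isometry_subtype_coe
  have h := hiso.map_euclideanHausdorffMeasure (d := d - 1)
  rw [range_add_orthogonal] at h
  rw [← h, ← finrank_orthogonal hn, InnerProductSpace.euclideanHausdorffMeasure_eq_volume]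

lemma measurableEmbedding_add_orthogonal (p n : E d) :
    MeasurableEmbedding (fun v : (ℝ ∙ n)ᗮ => p + (v : E d)) :=
  (Homeomorph.addLeft p).measurableEmbedding.comp
    (MeasurableEmbedding.subtype_coe (Submodule.closed_of_finiteDimensional _).measurableSet)

/-- Lebesgue measure, sliced by a hyperplane and a direction transversal to it. -/
lemma lintegral_eq_slices {n : E d} (hn : ‖n‖ = 1) (p e : E d) {c : ℝ} (hc : inner ℝ n e = c)
    (hc0 : c ≠ 0) {F : E d → ENNReal} (hF : Measurable F) :
    ∫⁻ x, F x = ENNReal.ofReal |c| *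
      ∫⁻ y in hyperplane p n, (∫⁻ s : ℝ, F (y + s • e))
        ∂(Measure.euclideanHausdorffMeasure (d - 1)) := by
  have hmp := ((ℝ ∙ n).measurePreserving_measurableEquivProd p).symm
  rw [InnerProductSpace.euclideanHausdorffMeasure_eq_volume] at hmp
  have hline := (LinearIsometryEquiv.toSpanUnitSingleton (𝕜 := ℝ) n hn).measurePreserving
  rw [← map_volume_orthogonal hn, (measurableEmbedding_add_orthogonal p n).lintegral_map,
    ← hmp.lintegral_comp hF, Measure.volume_eq_prod, lintegral_prod _ (by fun_prop)]
  simp only [Submodule.measurableEquivProd_symm_apply, vadd_eq_add]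
  rw [← hline.lintegral_comp (by fun_prop)]
  simp only [LinearIsometryEquiv.toSpanUnitSingleton_apply]
  -- The height over the hyperplane changes by `c` per unit step along `e`.
  have hscale : ∀ G : ℝ → ENNReal, Measurable G →
      ∫⁻ s, G s = ENNReal.ofReal |c| * ∫⁻ s, G (c * s) := by
    intro G hG
    have h := Real.smul_map_volume_mul_left hc0
    conv_lhs => rw [← h]
    rw [lintegral_smul_measure, lintegral_map hG (by fun_prop), smul_eq_mul]
  rw [hscale _ (by fun_prop)]
  congr 1
  -- The direction `e` is `c • n` plus a tangential part. For fixed `s` the tangential shift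
  -- disappears by translation invariance of Lebesgue measure on the orthogonal complement.
  have hV : e - c • n ∈ (ℝ ∙ n)ᗮ := by
    rw [Submodule.mem_orthogonal_singleton_iff_inner_right, inner_sub_right, inner_smul_right,
      real_inner_self_eq_norm_sq, hn, hc]
    ring
  conv_rhs => rw [lintegral_lintegral_swap (by fun_prop)]
  refine lintegral_congr fun s => ?_
  rw [← lintegral_add_right_eq_self _ (s • (⟨e - c • n, hV⟩ : (ℝ ∙ n)ᗮ))]
  refine lintegral_congr fun v => ?_
  congr 1
  simp only [Submodule.coe_add, Submodule.coe_smul]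
  module

lemma sigmaFinite_hyperplane {n : E d} (hn : ‖n‖ = 1) (p : E d) : SigmaFinite
    ((Measure.euclideanHausdorffMeasure (d - 1)).restrict (hyperplane p n)) := by
  rw [← map_volume_orthogonal hn]
  exact (measurableEmbedding_add_orthogonal p n).sigmaFinite_map

/-- As an identity of measures, the slicing formula passes from nonnegative functions to integrable
ones by Fubini's theorem. -/
lemma volume_eq_map_slices {n : E d} (hn : ‖n‖ = 1) (p e : E d) {c : ℝ} (hc : inner ℝ n e = c)
    (hc0 : c ≠ 0) :
    (volume : Measure (E d)) = ENNReal.ofReal |c| • Measure.map (fun q : E d × ℝ => q.1 + q.2 • e)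
      (((Measure.euclideanHausdorffMeasure (d - 1)).restrict (hyperplane p n)).prod volume) := by
  refine Measure.ext_of_lintegral _ fun F hF => ?_
  rw [lintegral_eq_slices hn p e hc hc0 hF, lintegral_smul_measure, lintegral_map hF (by fun_prop),
    lintegral_prod _ (by fun_prop), smul_eq_mul]

lemma integral_eq_slices {n : E d} (hn : ‖n‖ = 1) (p e : E d) {c : ℝ} (hc : inner ℝ n e = c)
    (hc0 : c ≠ 0) {F : E d → ℝ} (hF : Integrable F) :
    ∫ x, F x = |c| * ∫ y in hyperplane p n, (∫ s : ℝ, F (y + s • e))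
        ∂(Measure.euclideanHausdorffMeasure (d - 1)) := by
  have := sigmaFinite_hyperplane hn p
  have hv := volume_eq_map_slices hn p e hc hc0
  have hc1 : ENNReal.ofReal |c| ≠ 0 := by simpa using hc0
  have hF' := hF
  rw [hv, integrable_smul_measure hc1 ENNReal.ofReal_ne_top] at hF'
  rw [hv, integral_smul_measure, integral_map (by fun_prop) hF'.1, integral_prod,
    ENNReal.toReal_ofReal (abs_nonneg c), smul_eq_mul]
  exact hF'.comp_measurable (by fun_prop)

end Slicing

/-! ### Surface measure of facets -/

section FacetMeasure

variable {d : ℕ} [NeZero d]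

lemma zeroSet_bary_eq_hyperplane (K : Affine.Simplex ℝ (E d) d) {i : Fin (d + 1)} {p : E d}
    (hp : bary K i p = 0) : {x | bary K i x = 0} = hyperplane p (normal K i) := by
  obtain ⟨c, hc, h⟩ := exists_linear_bary K i
  ext x
  have h1 : bary K i x = -(c * inner ℝ (normal K i) (x - p)) := by
    rw [← h, affineMap_linear_sub, hp, sub_zero]
  simp [hyperplane, h1, hc.ne']

lemma facet_subset_hyperplane (K : Affine.Simplex ℝ (E d) d) {i j : Fin (d + 1)} (hij : i ≠ j) :
    facet K i ⊆ hyperplane (K.points j) (normal K i) := by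
  rw [← zeroSet_bary_eq_hyperplane K (bary_ne K hij)]
  exact fun x hx => (mem_facet.1 hx).2

lemma exists_ne_index (i : Fin (d + 1)) : ∃ j, i ≠ j := by
  have : Nontrivial (Fin (d + 1)) := Fin.nontrivial_iff_two_le.2 (by have := NeZero.pos d; omega)
  obtain ⟨j, hj⟩ := exists_ne i
  exact ⟨j, hj.symm⟩

/-- A facet is a compact subset of a hyperplane, on which the surface measure is a copy of Lebesgue
measure. -/
instance isFiniteMeasure_facetMeasure (K : Affine.Simplex ℝ (E d) d) (i : Fin (d + 1)) :
    IsFiniteMeasure (facetMeasure K i) := by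
  obtain ⟨j, hij⟩ := exists_ne_index i
  refine ⟨?_⟩
  have hsub := facet_subset_hyperplane K hij
  have hemb := measurableEmbedding_add_orthogonal (K.points j) (normal K i)
  rw [facetMeasure, Measure.restrict_apply_univ,
    ← Measure.restrict_eq_self _ hsub, ← map_volume_orthogonal (normal_norm K i),
    hemb.map_apply]
  refine IsCompact.measure_lt_top ?_
  have : Topology.IsClosedEmbedding
      (fun v : (ℝ ∙ normal K i)ᗮ => K.points j + (v : E d)) :=
    (Homeomorph.addLeft (K.points j)).isClosedEmbedding.comp
      (Submodule.closed_of_finiteDimensional _).isClosedEmbedding_subtypeVal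
  exact this.isCompact_preimage (isCompact_facet K i)

/-- The faces of codimension at least two have no surface measure. -/
lemma facetMeasure_bary_eq_zero (K : Affine.Simplex ℝ (E d) d) {i j : Fin (d + 1)} (hij : i ≠ j) :
    facetMeasure K i {x | bary K j x = 0} = 0 := by
  have hemb := measurableEmbedding_add_orthogonal (K.points j) (normal K i)
  have hle : facetMeasure K i ≤ (Measure.euclideanHausdorffMeasure (d - 1)).restrict
      (hyperplane (K.points j) (normal K i)) :=
    Measure.restrict_mono (facet_subset_hyperplane K hij) le_rfl
  refine le_antisymm ((hle _).trans ?_) (zero_le)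
  rw [← map_volume_orthogonal (normal_norm K i), hemb.map_apply]
  -- In the coordinates of the hyperplane the zero set is an affine subspace. It is proper, hence
  -- null: the base point is the vertex `j`, where the coordinate has the value 1.
  let S : AffineSubspace ℝ (ℝ ∙ normal K i)ᗮ :=
    { carrier := (fun v : (ℝ ∙ normal K i)ᗮ => K.points j + (v : E d)) ⁻¹' {x | bary K j x = 0}
      smul_vsub_vadd_mem' := by
        intro c p₁ p₂ p₃ h₁ h₂ h₃
        have hlin : ∀ v : E d, bary K j (K.points j + v) = 1 + (bary K j).linear v := fun v => by
          simpa [bary_self] using affineMap_add_smul (bary K j) (K.points j) v 1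
        simp only [Set.mem_preimage, Set.mem_ofPred_eq, hlin] at h₁ h₂ h₃ ⊢
        simp only [vsub_eq_sub, vadd_eq_add, Submodule.coe_add, Submodule.coe_smul,
          Submodule.coe_sub, map_add, map_smul, map_sub, smul_eq_mul]
        linear_combination c * h₁ - c * h₂ + h₃ }
  refine (Measure.addHaar_affineSubspace volume S ?_).le
  intro hS
  have h0 : (0 : (ℝ ∙ normal K i)ᗮ) ∈ S := by rw [hS]; trivial
  have : bary K j (K.points j + 0) = 0 := h0
  rw [add_zero, bary_self] at this
  exact one_ne_zero this

omit [NeZero d] in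
lemma facetMeasure_le_bdryMeasure (K : Affine.Simplex ℝ (E d) d) (i : Fin (d + 1)) :
    facetMeasure K i ≤ bdryMeasure K :=
  Measure.restrict_mono (Set.subset_iUnion _ i) le_rfl

omit [NeZero d] in
lemma bdryMeasure_le_sum (K : Affine.Simplex ℝ (E d) d) :
    bdryMeasure K ≤ ∑ i, facetMeasure K i := by
  rw [← Measure.sum_fintype]
  exact Measure.restrict_iUnion_le

omit [NeZero d] in
lemma ae_bdryMeasure_iff (K : Affine.Simplex ℝ (E d) d) {p : E d → Prop} :
    (∀ᵐ x ∂bdryMeasure K, p x) ↔ ∀ i, ∀ᵐ x ∂facetMeasure K i, p x :=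
  ae_restrict_iUnion_iff _ _

instance isFiniteMeasure_bdryMeasure (K : Affine.Simplex ℝ (E d) d) :
    IsFiniteMeasure (bdryMeasure K) :=
  isFiniteMeasure_of_le _ (bdryMeasure_le_sum K)

omit [NeZero d] in
lemma measurableSet_facet (K : Affine.Simplex ℝ (E d) d) (i : Fin (d + 1)) :
    MeasurableSet (facet K i) := (isCompact_facet K i).isClosed.measurableSet

omit [NeZero d] in
lemma ae_mem_facet (K : Affine.Simplex ℝ (E d) d) (i : Fin (d + 1)) :
    ∀ᵐ x ∂facetMeasure K i, x ∈ facet K i :=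
  ae_restrict_mem (measurableSet_facet K i)

end FacetMeasure

/-! ### The divergence theorem on a simplex -/

section Divergence

variable {d : ℕ} [NeZero d]

omit [NeZero d] in
lemma hull_ae_eq_interior (K : Affine.Simplex ℝ (E d) d) :
    (interior (hull K) : Set (E d)) =ᵐ[volume] hull K :=
  interior_ae_eq_of_null_frontier ((convex_hull K).addHaar_frontier volume)

omit [NeZero d] in
lemma restrict_interior_hull (K : Affine.Simplex ℝ (E d) d) :
    (volume : Measure (E d)).restrict (interior (hull K)) = volume.restrict (hull K) :=
  Measure.restrict_congr_set (hull_ae_eq_interior K)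

omit [NeZero d] in
lemma memLp_restrict_of_continuousOn {ν : Measure (E d)} {S : Set (E d)} (hS : IsCompact S)
    [IsFiniteMeasure (ν.restrict S)] {F : Type*} [NormedAddCommGroup F] {f : E d → F}
    (hf : ContinuousOn f S) {p : ENNReal} : MemLp f p (ν.restrict S) := by
  obtain ⟨C, hC⟩ := hS.exists_bound_of_continuousOn hf
  exact MemLp.of_bound (hf.aestronglyMeasurable_of_isCompact hS hS.measurableSet) C
    ((ae_restrict_mem hS.measurableSet).mono hC)

lemma memLp_facet (K : Affine.Simplex ℝ (E d) d) (i : Fin (d + 1)) {F : Type*}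
    [NormedAddCommGroup F] {f : E d → F} (hf : ContinuousOn f (facet K i)) {p : ENNReal} :
    MemLp f p (facetMeasure K i) := by
  have : IsFiniteMeasure ((Measure.euclideanHausdorffMeasure (d - 1)).restrict (facet K i)) :=
    isFiniteMeasure_facetMeasure K i
  exact memLp_restrict_of_continuousOn (isCompact_facet K i) hf

omit [NeZero d] in
lemma memLp_hull (K : Affine.Simplex ℝ (E d) d) {F : Type*}
    [NormedAddCommGroup F] {f : E d → F} (hf : ContinuousOn f (hull K)) {p : ENNReal} :
    MemLp f p (volume.restrict (interior (hull K))) := by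
  rw [restrict_interior_hull]
  have : IsFiniteMeasure ((volume : Measure (E d)).restrict (hull K)) :=
    ⟨by simpa using (isCompact_hull K).measure_lt_top⟩
  exact memLp_restrict_of_continuousOn (isCompact_hull K) hf

omit [NeZero d] in
lemma bary_add_smul_edge (K : Affine.Simplex ℝ (E d) d) {i k : Fin (d + 1)}
    (x : E d) (s : ℝ) (j : Fin (d + 1)) :
    bary K j (x + s • (K.points i - K.points k)) =
      bary K j x + (if j = i then s else 0) - (if j = k then s else 0) := by
  rw [affineMap_add_smul, affineMap_linear_sub, bary_vertex, bary_vertex]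
  split_ifs <;> simp_all [sub_eq_add_neg]

/-- Only the coordinates `i` and `k` change along the edge from `k` to `i`, so it is parallel to all
other facets, enters the simplex through the facet `i` and leaves it through the facet `k`. In this
direction the divergence theorem involves only two facets. -/
lemma inner_normal_edge (K : Affine.Simplex ℝ (E d) d) {i k : Fin (d + 1)} (hik : i ≠ k) :
    inner ℝ (normal K i) (K.points i - K.points k) < 0 ∧
    0 < inner ℝ (normal K k) (K.points i - K.points k) ∧
    ∀ j, j ≠ i → j ≠ k → inner ℝ (normal K j) (K.points i - K.points k) = 0 := by
  have key : ∀ j, ∃ c : ℝ, 0 < c ∧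
      bary K j (K.points i) - bary K j (K.points k)
        = -(c * inner ℝ (normal K j) (K.points i - K.points k)) := fun j => by
    obtain ⟨c, hc, h⟩ := exists_linear_bary K j
    exact ⟨c, hc, by rw [← h, affineMap_linear_sub]⟩
  refine ⟨?_, ?_, fun j hji hjk => ?_⟩
  · obtain ⟨c, hc, h⟩ := key i
    rw [bary_self, bary_ne K hik] at h
    by_contra! hneg
    nlinarith [mul_nonneg hc.le hneg]
  · obtain ⟨c, hc, h⟩ := key k
    rw [bary_self, bary_ne K hik.symm] at h
    by_contra! hneg
    nlinarith [mul_nonneg hc.le (neg_nonneg.2 hneg)]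
  · obtain ⟨c, hc, h⟩ := key j
    rw [bary_ne K hji, bary_ne K hjk] at h
    simpa [hc.ne'] using h

omit [NeZero d] in
/-- The segment from a point of the facet `i` in the direction of the edge from `k` to `i` ends in
the facet `k`. -/
lemma add_smul_edge_mem_hull_iff (K : Affine.Simplex ℝ (E d) d) {i k : Fin (d + 1)} (hik : i ≠ k)
    {y : E d} (hy : bary K i y = 0) (s : ℝ) :
    y + s • (K.points i - K.points k) ∈ hull K ↔
      y ∈ facet K i ∧ s ∈ Set.Icc 0 (bary K k y) := by
  simp only [mem_facet, mem_hull, bary_add_smul_edge K, Set.mem_Icc, hy, and_true]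
  constructor
  · intro h
    have h1 := h i
    have h2 := h k
    simp only [hy, if_true, hik, hik.symm, if_false] at h1 h2
    refine ⟨fun j => ?_, by linarith, by linarith⟩
    have h3 := h j
    split_ifs at h3 with h4 h5 h5 <;> subst_vars <;> linarith
  · rintro ⟨h, h1, h2⟩ j
    have h3 := h j
    split_ifs with h4 h5 h5 <;> subst_vars <;> linarith

omit [NeZero d] in
lemma add_bary_smul_edge_mem_facet_iff (K : Affine.Simplex ℝ (E d) d) {i k : Fin (d + 1)}
    (hik : i ≠ k) {y : E d} (hy : bary K i y = 0) :
    y + bary K k y • (K.points i - K.points k) ∈ facet K k ↔ y ∈ facet K i := by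
  rw [mem_facet, add_smul_edge_mem_hull_iff K hik hy, bary_add_smul_edge K, Set.mem_Icc]
  simp only [hik.symm, if_false, if_true]
  constructor
  · exact fun h => h.1.1
  · exact fun h => ⟨⟨h, mem_hull.1 (mem_facet.1 h).1 k, le_rfl⟩, by ring⟩

lemma integral_facet_eq_setIntegral (K : Affine.Simplex ℝ (E d) d) {i j : Fin (d + 1)}
    (hij : i ≠ j) (φ : E d → ℝ) :
    ∫ y, φ y ∂facetMeasure K i = ∫ y in hyperplane (K.points j) (normal K i),
      (facet K i).indicator φ y ∂(Measure.euclideanHausdorffMeasure (d - 1)) := by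
  rw [integral_indicator (measurableSet_facet K i), Measure.restrict_restrict
    (measurableSet_facet K i), Set.inter_eq_left.2 (facet_subset_hyperplane K hij), facetMeasure]

/-- `Q` projects along the edge onto the hyperplane of the facet `k`, and `A` is a prism over that
facet. Every line parallel to the edge that meets `A` does so in a segment of parameter length one.
Slicing the integral of `φ ∘ Q` over `A` from the hyperplanes of the facets `i` and `k` therefore
yields the two sides. -/
lemma integral_facet_transfer (K : Affine.Simplex ℝ (E d) d) {i k : Fin (d + 1)} (hik : i ≠ k)
    {φ : E d → ℝ} (hφ : Continuous φ) :
    |inner ℝ (normal K i) (K.points i - K.points k)| *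
      ∫ y, φ (y + bary K k y • (K.points i - K.points k)) ∂facetMeasure K i =
    |inner ℝ (normal K k) (K.points i - K.points k)| * ∫ y, φ y ∂facetMeasure K k := by
  set e := K.points i - K.points k with he
  obtain ⟨hi, hk, -⟩ := inner_normal_edge K hik
  let Q : E d → E d := fun x => x + bary K k x • e
  have hQ : Continuous Q := by
    have := continuous_bary K k
    fun_prop
  have hQs : ∀ x (s : ℝ), Q (x + s • e) = Q x := fun x s => by
    simp only [Q, he, bary_add_smul_edge K, hik.symm, if_true, if_false]
    module
  have hks : ∀ x (s : ℝ), bary K k (x + s • e) = bary K k x - s := fun x s => by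
    simp [he, bary_add_smul_edge K, hik.symm]
  let A : Set (E d) := {x | Q x ∈ facet K k ∧ bary K k x ∈ Set.Icc (0 : ℝ) 1}
  have hAc : IsClosed A :=
    ((isCompact_facet K k).isClosed.preimage hQ).inter
      (isClosed_Icc.preimage (continuous_bary K k))
  have hAcomp : IsCompact A := by
    refine (((isCompact_facet K k).prod (isCompact_Icc (a := (0 : ℝ)) (b := 1))).image
      (f := fun q : E d × ℝ => q.1 - q.2 • e) (by fun_prop)).of_isClosed_subset hAc ?_
    exact fun x hx => ⟨(Q x, bary K k x), hx, by simp [Q]⟩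
  have hint : Integrable (A.indicator fun x => φ (Q x)) :=
    (integrable_indicator_iff hAc.measurableSet).2
      ((hφ.comp hQ).continuousOn.integrableOn_compact hAcomp)
  have hslice : ∀ y, ∫ s : ℝ, A.indicator (fun x => φ (Q x)) (y + s • e) =
      (Q ⁻¹' facet K k).indicator (fun x => φ (Q x)) y := by
    intro y
    by_cases hy : Q y ∈ facet K k
    · rw [Set.indicator_of_mem (by exact hy)]
      have : (fun s : ℝ => A.indicator (fun x => φ (Q x)) (y + s • e)) =
          (Set.Icc (bary K k y - 1) (bary K k y)).indicator fun _ => φ (Q y) := by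
        ext s
        simp only [Set.indicator, A, Set.mem_ofPred_eq, hQs, hks, hy, true_and, Set.mem_Icc]
        congr 1
        exact propext ⟨fun h => ⟨by linarith [h.2], by linarith [h.1]⟩,
          fun h => ⟨by linarith [h.2], by linarith [h.1]⟩⟩
      rw [this, integral_indicator measurableSet_Icc]
      simp
    · rw [Set.indicator_of_notMem (by exact hy)]
      simp [Set.indicator, A, hQs, hy]
  have h1 := integral_eq_slices (normal_norm K i) (K.points k) e rfl hi.ne hint
  have h2 := integral_eq_slices (normal_norm K k) (K.points i) e rfl hk.ne' hint
  simp_rw [hslice] at h1 h2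
  rw [integral_facet_eq_setIntegral K hik, integral_facet_eq_setIntegral K hik.symm]
  refine Eq.trans ?_ (h1.symm.trans (h2.trans ?_)) <;> congr 1 <;>
    refine setIntegral_congr_fun (isClosed_hyperplane _ _).measurableSet fun y hy => ?_
  · rw [← zeroSet_bary_eq_hyperplane K (bary_ne K hik)] at hy
    have : y ∈ Q ⁻¹' facet K k ↔ y ∈ facet K i := add_bary_smul_edge_mem_facet_iff K hik hy
    by_cases hF : y ∈ facet K i
    · exact (Set.indicator_of_mem hF _).trans
        (Set.indicator_of_mem (this.2 hF) fun x => φ (Q x)).symm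
    · simp only [Set.indicator_of_notMem hF, Set.indicator_of_notMem (mt this.1 hF)]
  · rw [← zeroSet_bary_eq_hyperplane K (bary_ne K hik.symm)] at hy
    have hy' : bary K k y = 0 := hy
    have hQy : Q y = y := by simp only [Q, hy', zero_smul, add_zero]
    have : y ∈ Q ⁻¹' facet K k ↔ y ∈ facet K k := by rw [Set.mem_preimage, hQy]
    by_cases hF : y ∈ facet K k
    · simp only [Set.indicator_of_mem hF, Set.indicator_of_mem (this.2 hF), hQy]
    · simp only [Set.indicator_of_notMem hF, Set.indicator_of_notMem (mt this.1 hF)]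

/-- Fubini along lines parallel to the edge, and the fundamental theorem of calculus on each line:
the line through a point `y` of the facet `i` stays in the simplex for parameters from 0 to `bary K
k y`, where it reaches the facet `k`. -/
lemma integral_fderiv_edge (K : Affine.Simplex ℝ (E d) d) {i k : Fin (d + 1)} (hik : i ≠ k)
    {φ : E d → ℝ} (hφ : ContDiff ℝ 1 φ) :
    ∫ x in hull K, fderiv ℝ φ x (K.points i - K.points k) =
      |inner ℝ (normal K i) (K.points i - K.points k)| *
        ∫ y, (φ (y + bary K k y • (K.points i - K.points k)) - φ y) ∂facetMeasure K i := by
  set e := K.points i - K.points k with he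
  obtain ⟨hi, -, -⟩ := inner_normal_edge K hik
  have hc : Continuous fun x => fderiv ℝ φ x e := by
    have := hφ.continuous_fderiv (by norm_num)
    fun_prop
  have hm := (isCompact_hull K).isClosed.measurableSet
  have hint : Integrable ((hull K).indicator fun x => fderiv ℝ φ x e) :=
    (integrable_indicator_iff hm).2 (hc.continuousOn.integrableOn_compact (isCompact_hull K))
  rw [← integral_indicator hm, integral_eq_slices (normal_norm K i) (K.points k) e rfl hi.ne hint,
    integral_facet_eq_setIntegral K hik]
  congr 1
  refine setIntegral_congr_fun (isClosed_hyperplane _ _).measurableSet fun y hy => ?_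
  rw [← zeroSet_bary_eq_hyperplane K (bary_ne K hik)] at hy
  have hmem := add_smul_edge_mem_hull_iff K hik hy
  by_cases hyF : y ∈ facet K i
  · have h0 : 0 ≤ bary K k y := mem_hull.1 (mem_facet.1 hyF).1 k
    have : (fun s : ℝ => (hull K).indicator (fun x => fderiv ℝ φ x e) (y + s • e)) =
        (Set.Icc 0 (bary K k y)).indicator fun s => fderiv ℝ φ (y + s • e) e := by
      ext s
      simp only [Set.indicator, he, hmem, hyF, true_and]
    simp only [this, Set.indicator_of_mem hyF]
    rw [integral_indicator measurableSet_Icc, integral_Icc_eq_integral_Ioc,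
      ← intervalIntegral.integral_of_le h0]
    have hd : ∀ s : ℝ, HasDerivAt (fun s : ℝ => φ (y + s • e)) (fderiv ℝ φ (y + s • e) e) s := by
      intro s
      have h1 : HasDerivAt (fun s : ℝ => y + s • e) e s := by
        simpa using ((hasDerivAt_id s).smul_const e).const_add y
      exact ((hφ.differentiable (by norm_num)) _).hasFDerivAt.comp_hasDerivAt s h1
    rw [intervalIntegral.integral_eq_sub_of_hasDerivAt (fun s _ => hd s)]
    · simp
    · exact (hc.comp (by fun_prop)).intervalIntegrable _ _
  · simp only [Set.indicator_of_notMem hyF]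
    simp [Set.indicator, he, hmem, hyF]

/-- The divergence theorem on a simplex. -/
theorem integral_fderiv_hull (K : Affine.Simplex ℝ (E d) d) {φ : E d → ℝ} (hφ : ContDiff ℝ 1 φ)
    (e : E d) :
    ∫ x in hull K, fderiv ℝ φ x e =
      ∑ j, inner ℝ (normal K j) e * ∫ y, φ y ∂facetMeasure K j := by
  have hc := hφ.continuous_fderiv (by norm_num)
  have hint : IntegrableOn (fderiv ℝ φ) (hull K) :=
    hc.continuousOn.integrableOn_compact (isCompact_hull K)
  let r : E d →ₗ[ℝ] ℝ := ∑ j, (∫ y, φ y ∂facetMeasure K j) • innerₛₗ ℝ (normal K j)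
  have hr : ∀ e, r e = ∑ j, inner ℝ (normal K j) e * ∫ y, φ y ∂facetMeasure K j := fun e => by
    simp [r, LinearMap.sum_apply, mul_comm]
  have hl : ∀ e, ∫ x in hull K, fderiv ℝ φ x e = (∫ x in hull K, fderiv ℝ φ x) e := fun e =>
    (ContinuousLinearMap.integral_apply hint e).symm
  rw [hl, ← hr, ← ContinuousLinearMap.coe_coe]
  congr 1
  -- Both sides are linear in the direction, and the edges at vertex 0 form a basis. For an edge,
  -- `integral_facet_transfer` moves the integral over the end points to the facet 0.
  refine ((vertexBasis K).basisOf 0).ext fun ⟨i, hi⟩ => ?_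
  rw [AffineBasis.basisOf_apply, coe_vertexBasis, vsub_eq_sub, ContinuousLinearMap.coe_coe, ← hl,
    hr, integral_fderiv_edge K hi hφ]
  have hφc := hφ.continuous
  obtain ⟨h1, h2, h3⟩ := inner_normal_edge K hi
  have hfin : ∀ ψ : E d → ℝ, Continuous ψ → Integrable ψ (facetMeasure K i) := fun ψ hψ =>
    memLp_one_iff_integrable.1 (memLp_facet K i hψ.continuousOn)
  have hb := continuous_bary K 0
  rw [integral_sub (hfin _ (by fun_prop)) (hfin _ hφc), mul_sub, integral_facet_transfer K hi hφc,
    abs_of_pos h2, abs_of_neg h1, Fintype.sum_eq_add i 0 hi]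
  · ring
  · rintro j ⟨hj1, hj2⟩
    rw [h3 j hj1 hj2, zero_mul]

theorem integral_partialDeriv (K : Affine.Simplex ℝ (E d) d) {φ : E d → ℝ} (hφ : ContDiff ℝ 1 φ)
    (j : Fin d) :
    ∫ x in interior (hull K), partialDeriv j φ x =
      ∑ i, ∫ y, φ y * normal K i j ∂facetMeasure K i := by
  rw [restrict_interior_hull]
  simp_rw [partialDeriv, integral_fderiv_hull K hφ, integral_mul_const]
  simp [EuclideanSpace.inner_single_right, mul_comm]

end Divergence

/-! ### Weak derivatives -/

section WeakDerivatives

variable {d : ℕ} {U V : Set (E d)} {j : Fin d} {w w' p p' : E d → ℝ} {φ : E d → ℝ}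

lemma partialDeriv_eq_zero_of_notMem (hx : ∀ x ∉ U, x ∉ tsupport φ) {x : E d} (h : x ∉ U) :
    partialDeriv j φ x = 0 := by
  have : fderiv ℝ φ x = 0 := by
    by_contra h'
    exact hx x h (support_fderiv_subset ℝ h')
  simp [partialDeriv, this]

lemma contDiff_partialDeriv (hφ : ContDiff ℝ ∞ φ) (j : Fin d) :
    ContDiff ℝ ∞ (partialDeriv j φ) :=
  (hφ.fderiv_right (m := ∞) (by simp)).clm_apply contDiff_const

lemma IsTestFunction.mono (h : IsTestFunction V φ) (hVU : V ⊆ U) : IsTestFunction U φ :=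
  ⟨h.1, h.2.1, h.2.2.trans hVU⟩

lemma IsTestFunction.eq_zero (h : IsTestFunction U φ) {x : E d} (hx : x ∉ U) : φ x = 0 :=
  image_eq_zero_of_notMem_tsupport fun h' => hx (h.2.2 h')

lemma IsTestFunction.partialDeriv (h : IsTestFunction U φ) (j : Fin d) :
    IsTestFunction U (partialDeriv j φ) := by
  have hs : tsupport (InterfaceFEM.partialDeriv j φ) ⊆ tsupport φ := by
    refine closure_minimal (fun x hx => ?_) (isClosed_tsupport φ)
    by_contra h'
    exact hx (partialDeriv_eq_zero_of_notMem (U := tsupport φ) (fun _ h => h) h')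
  exact ⟨contDiff_partialDeriv h.1 j, h.2.1.of_isClosed_subset (isClosed_tsupport _) hs,
    hs.trans h.2.2⟩

lemma setIntegral_test_eq (hVU : V ⊆ U) (h : IsTestFunction V φ) (w : E d → ℝ)
    (hU : MeasurableSet U) :
    ∫ x in U, w x * φ x = ∫ x in V, w x * φ x :=
  setIntegral_eq_of_subset_of_forall_sdiff_eq_zero hU hVU fun x hx => by
      rw [h.eq_zero hx.2, mul_zero]

lemma integrableOn_mul_test (hw : LocallyIntegrableOn w U)
    (h : IsTestFunction U φ) : IntegrableOn (fun x => w x * φ x) U := by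
  have h1 : IntegrableOn w (tsupport φ) := hw.integrableOn_compact_subset h.2.2 h.2.1
  have h2 : IntegrableOn (fun x => w x * φ x) (tsupport φ) :=
    h1.mul_continuousOn h.1.continuous.continuousOn h.2.1
  have h3 : Integrable (fun x => w x * φ x) := by
    rw [← integrableOn_iff_integrable_of_support_subset (s := tsupport φ)]
    · exact h2
    · intro x hx
      exact subset_tsupport φ fun h0 => hx (by simp [h0])
  exact h3.integrableOn

lemma locallyIntegrableOn_congr {f g : E d → ℝ} (hU : IsOpen U)
    (hf : LocallyIntegrableOn f U) (h : f =ᵐ[volume.restrict U] g) :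
    LocallyIntegrableOn g U := by
  rw [locallyIntegrableOn_iff hU.isLocallyClosed] at hf ⊢
  intro k hk hkc
  exact (hf k hk hkc).congr (ae_mono (Measure.restrict_mono hk le_rfl) h)

lemma IsWeakPartial.mono (h : IsWeakPartial U j w p) (hVU : V ⊆ U) (hU : MeasurableSet U) :
    IsWeakPartial V j w p :=
  ⟨h.1.mono_set hVU, h.2.1.mono_set hVU, fun φ hφ => by
    rw [← setIntegral_test_eq hVU hφ _ hU, ← setIntegral_test_eq hVU (hφ.partialDeriv j) _ hU]
    exact h.2.2 φ (hφ.mono hVU)⟩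

lemma IsWeakPartial.congr (hU : IsOpen U) (h : IsWeakPartial U j w p)
    (hw : w =ᵐ[volume.restrict U] w') (hp : p =ᵐ[volume.restrict U] p') :
    IsWeakPartial U j w' p' := by
  refine ⟨locallyIntegrableOn_congr hU h.1 hw, locallyIntegrableOn_congr hU h.2.1 hp, fun φ hφ => ?_⟩
  have h1 : ∫ x in U, w' x * InterfaceFEM.partialDeriv j φ x = ∫ x in U, w x * partialDeriv j φ x :=
    integral_congr_ae (hw.mono fun x hx => by simp only [hx])
  have h2 : ∫ x in U, p' x * φ x = ∫ x in U, p x * φ x :=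
    integral_congr_ae (hp.mono fun x hx => by simp only [hx])
  rw [h1, h2, h.2.2 φ hφ]

lemma IsWeakPartial.sub (hU : IsOpen U) (h : IsWeakPartial U j w p)
    (h' : IsWeakPartial U j w' p') : IsWeakPartial U j (w - w') (p - p') := by
  refine ⟨h.1.sub h'.1, h.2.1.sub h'.2.1, fun φ hφ => ?_⟩
  simp only [Pi.sub_apply, sub_mul]
  rw [integral_sub (integrableOn_mul_test h.1 (hφ.partialDeriv j))
    (integrableOn_mul_test h'.1 (hφ.partialDeriv j)), integral_sub
    (integrableOn_mul_test h.2.1 hφ) (integrableOn_mul_test h'.2.1 hφ), h.2.2 φ hφ,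
    h'.2.2 φ hφ]
  ring

/-- Weak derivatives are unique up to null sets. -/
lemma IsWeakPartial.ae_eq (hU : IsOpen U) (h : IsWeakPartial U j w p)
    (h' : IsWeakPartial U j w' p') (hw : w =ᵐ[volume.restrict U] w') :
    p =ᵐ[volume.restrict U] p' := by
  -- The difference of the two derivatives is a weak derivative of zero, so it integrates to zero
  -- against every test function.
  have hd : IsWeakPartial U j (w' - w') (p - p') :=
    (h.congr hU hw (ae_eq_refl p)).sub hU h'
  have := hU.ae_eq_zero_of_integral_contDiff_smul_eq_zero hd.2.1 fun g h1 h2 h3 => by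
    have h4 := hd.2.2 g ⟨h1, h2, h3⟩
    simp only [sub_self, Pi.zero_apply, zero_mul, integral_zero] at h4
    rw [zero_eq_neg] at h4
    rw [← setIntegral_test_eq (Set.subset_univ U) ⟨h1, h2, h3⟩ _ .univ,
      setIntegral_univ] at h4
    simpa only [smul_eq_mul, mul_comm] using h4
  rw [EventuallyEq, ae_restrict_iff' hU.measurableSet]
  filter_upwards [this] with x hx hxU
  exact sub_eq_zero.1 (hx hxU)

lemma IsWeakPartial.weakPartial (h : IsWeakPartial U j w p) :
    IsWeakPartial U j w (weakPartial U j w) := by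
  have hex : ∃ p, IsWeakPartial U j w p := ⟨p, h⟩
  rw [InterfaceFEM.weakPartial, dif_pos hex]
  exact hex.choose_spec

lemma IsWeakPartial.weakPartial_ae_eq (hU : IsOpen U) (h : IsWeakPartial U j w p) :
    InterfaceFEM.weakPartial U j w =ᵐ[volume.restrict U] p :=
  h.weakPartial.ae_eq hU h (ae_eq_refl w)

/-- Compact support of the test function allows integration by parts on the whole space, so no
regularity of `U` is involved. -/
lemma isWeakPartial_of_contDiff (hw : ContDiff ℝ ∞ w) (j : Fin d) :
    IsWeakPartial U j w (partialDeriv j w) := by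
  have hc := (contDiff_partialDeriv hw j).continuous
  refine ⟨hw.continuous.locallyIntegrable.locallyIntegrableOn U,
    hc.locallyIntegrable.locallyIntegrableOn U, fun φ hφ => ?_⟩
  have hφ' := hφ.mono (Set.subset_univ U)
  rw [← setIntegral_test_eq (Set.subset_univ U) hφ _ .univ,
    ← setIntegral_test_eq (Set.subset_univ U) (hφ.partialDeriv j) _ .univ]
  have h1 := integrableOn_mul_test
    (hw.continuous.locallyIntegrable.locallyIntegrableOn _) (hφ'.partialDeriv j)
  have h2 := integrableOn_mul_test
    (hc.locallyIntegrable.locallyIntegrableOn _) hφ'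
  have h3 := integrableOn_mul_test
    (hw.continuous.locallyIntegrable.locallyIntegrableOn _) hφ'
  rw [integrableOn_univ] at h1 h2 h3
  rw [setIntegral_univ, setIntegral_univ]
  exact integral_mul_fderiv_eq_neg_fderiv_mul_of_integrable h2 h1 h3
    (fun x _ => hw.differentiable (by simp) x) (fun x _ => hφ.1.differentiable (by simp) x)

/-! ### Sobolev spaces -/

lemma MemSobolev.memLp : ∀ {m : ℕ}, MemSobolev m U w → MemLp w 2 (volume.restrict U)
  | 0, h => h
  | _ + 1, h => h.1

lemma MemSobolev.of_succ : ∀ {m : ℕ} {w : E d → ℝ}, MemSobolev (m + 1) U w → MemSobolev m U w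
  | 0, _, h => h.1
  | _ + 1, _, h => ⟨h.1, fun j => let ⟨p, hp, h'⟩ := h.2 j; ⟨p, hp, h'.of_succ⟩⟩

lemma MemSobolev.congr (hU : IsOpen U) : ∀ {m : ℕ} {w w' : E d → ℝ}, MemSobolev m U w →
    w =ᵐ[volume.restrict U] w' → MemSobolev m U w'
  | 0, _, _, h, hw => MemLp.ae_eq hw h
  | _ + 1, _, _, h, hw => ⟨MemLp.ae_eq hw h.1, fun j =>
      let ⟨p, hp, h'⟩ := h.2 j; ⟨p, hp.congr hU hw (ae_eq_refl p), h'⟩⟩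

lemma MemSobolev.mono (hVU : V ⊆ U) (hU : MeasurableSet U) : ∀ {m : ℕ} {w : E d → ℝ},
    MemSobolev m U w → MemSobolev m V w
  | 0, _, h => MemLp.mono_measure (Measure.restrict_mono hVU le_rfl) h
  | _ + 1, _, h => ⟨MemLp.mono_measure (Measure.restrict_mono hVU le_rfl) h.1, fun j =>
      let ⟨p, hp, h'⟩ := h.2 j; ⟨p, hp.mono hVU hU, h'.mono hVU hU⟩⟩

lemma MemSobolev.sub (hU : IsOpen U) : ∀ {m : ℕ} {w w' : E d → ℝ}, MemSobolev m U w →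
    MemSobolev m U w' → MemSobolev m U (w - w')
  | 0, _, _, h, h' => MemLp.sub h h'
  | _ + 1, _, _, h, h' => ⟨MemLp.sub h.1 h'.1, fun j =>
      let ⟨p, hp, h1⟩ := h.2 j
      let ⟨p', hp', h2⟩ := h'.2 j
      ⟨p - p', hp.sub hU hp', h1.sub hU h2⟩⟩

lemma MemSobolev.isWeakPartial {m : ℕ} (h : MemSobolev (m + 1) U w) (j : Fin d) :
    IsWeakPartial U j w (weakPartial U j w) :=
  let ⟨_, hp, _⟩ := h.2 j
  hp.weakPartial

lemma MemSobolev.memSobolev_weakPartial (hU : IsOpen U) {m : ℕ} (h : MemSobolev (m + 1) U w)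
    (j : Fin d) : MemSobolev m U (weakPartial U j w) :=
  let ⟨_, hp, h'⟩ := h.2 j
  h'.congr hU (hp.weakPartial_ae_eq hU).symm

lemma MemSobolev.weakPartial_sub (hU : IsOpen U) {m : ℕ} (h : MemSobolev (m + 1) U w)
    (h' : MemSobolev (m + 1) U w') (j : Fin d) :
    weakPartial U j (w - w') =ᵐ[volume.restrict U] weakPartial U j w - weakPartial U j w' :=
  ((h.isWeakPartial j).sub hU (h'.isWeakPartial j)).weakPartial_ae_eq hU

lemma MemSobolev.weakPartial_mono (hU : IsOpen U) (hV : IsOpen V) (hVU : V ⊆ U) {m : ℕ}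
    (h : MemSobolev (m + 1) U w) (j : Fin d) :
    weakPartial V j w =ᵐ[volume.restrict V] weakPartial U j w :=
  ((h.isWeakPartial j).mono hVU hU.measurableSet).weakPartial_ae_eq hV

lemma MemSobolev.weakPartial_congr (hU : IsOpen U) {m : ℕ} (h : MemSobolev (m + 1) U w)
    (hw : w =ᵐ[volume.restrict U] w') (j : Fin d) :
    weakPartial U j w =ᵐ[volume.restrict U] weakPartial U j w' :=
  (h.isWeakPartial j).ae_eq hU ((h.congr hU hw).isWeakPartial j) hw

lemma memSobolev_of_contDiff [NeZero d] (K : Affine.Simplex ℝ (E d) d) :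
    ∀ (m : ℕ) {w : E d → ℝ}, ContDiff ℝ ∞ w → MemSobolev m (interior (hull K)) w
  | 0, _, hw => memLp_hull K hw.continuous.continuousOn
  | m + 1, _, hw => ⟨memLp_hull K hw.continuous.continuousOn, fun j =>
      ⟨_, isWeakPartial_of_contDiff hw j,
        memSobolev_of_contDiff K m (contDiff_partialDeriv hw j)⟩⟩

end WeakDerivatives

/-! ### Regularisation -/

section Regularisation

variable {d : ℕ}

/-- The average of the values of `w` at the points `t x + (1 - t) y` with weight `η y`.  If `η` is
supported in the interior of a simplex and `x` lies in the simplex, then so do these points. -/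
def regularize (η : E d → ℝ) (t : ℝ) (w : E d → ℝ) (x : E d) : ℝ :=
  ∫ y, η y * w (t • x + (1 - t) • y)

/-- The convolution kernel of `regularize η t`. -/
def regKernel (η : E d → ℝ) (t : ℝ) (v : E d) : ℝ :=
  |((1 - t) ^ d)⁻¹| * η ((-(1 - t)⁻¹) • v)

variable {η w : E d → ℝ} {t : ℝ}

/-- The substitution z = t x + (1 - t) y, whose Jacobian is the factor in `regKernel`, exhibits the
average as a convolution evaluated at t x. Smoothness and differentiation under the integral sign
follow from this form. -/
lemma regularize_eq_integral (ht : t < 1) (x : E d) :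
    regularize η t w x = ∫ z, w z * regKernel η t (t • x - z) := by
  have ht' : 1 - t ≠ 0 := by linarith
  rw [← integral_add_left_eq_self _ (t • x)]
  have h := Measure.integral_comp_smul (volume : Measure (E d))
    (fun z => η ((1 - t)⁻¹ • z) * w (t • x + z)) (1 - t)
  simp only [smul_smul, inv_mul_cancel₀ ht', one_smul, finrank_euclideanSpace_fin,
    smul_eq_mul] at h
  rw [regularize, h, ← integral_const_mul]
  refine integral_congr_ae (ae_of_all _ fun z => ?_)
  simp only [regKernel, sub_add_cancel_left, smul_neg, neg_smul, neg_neg]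
  ring

lemma regularize_eq_convolution (ht : t < 1) :
    regularize η t w = fun x =>
      (convolution w (regKernel η t) (ContinuousLinearMap.mul ℝ ℝ) volume) (t • x) := by
  ext x
  rw [regularize_eq_integral ht]
  rfl

lemma contDiff_regKernel (hη : ContDiff ℝ ∞ η) (t : ℝ) : ContDiff ℝ ∞ (regKernel η t) :=
  contDiff_const.mul (hη.comp (contDiff_const_smul _))

lemma hasCompactSupport_regKernel (hη : HasCompactSupport η) (ht : t < 1) :
    HasCompactSupport (regKernel η t) :=
  (hη.comp_smul (c := -(1 - t)⁻¹) (by simp; linarith)).mul_left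

lemma contDiff_regularize (hη : ContDiff ℝ ∞ η) (hηc : HasCompactSupport η) (ht : t < 1)
    (hw : LocallyIntegrable w) : ContDiff ℝ ∞ (regularize η t w) := by
  rw [regularize_eq_convolution ht]
  exact ((hasCompactSupport_regKernel hηc ht).contDiff_convolution_right _ hw
    (contDiff_regKernel hη t)).comp (contDiff_const_smul t)

lemma regularize_sub (hη : ContDiff ℝ ∞ η) (hηc : HasCompactSupport η) (ht : t < 1)
    {w' : E d → ℝ} (hw : LocallyIntegrable w) (hw' : LocallyIntegrable w') :
    regularize η t (w - w') = regularize η t w - regularize η t w' := by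
  have hk := hasCompactSupport_regKernel hηc ht
  have hkc := (contDiff_regKernel hη t).continuous
  ext x
  simp only [Pi.sub_apply, regularize_eq_integral ht, sub_mul]
  exact integral_sub (hk.convolutionExists_right (ContinuousLinearMap.mul ℝ ℝ) hw hkc (t • x))
    (hk.convolutionExists_right (ContinuousLinearMap.mul ℝ ℝ) hw' hkc (t • x))

lemma regularize_congr_ae {w' : E d → ℝ} (ht : t < 1) (h : w =ᵐ[volume] w') :
    regularize η t w = regularize η t w' := by
  ext x
  rw [regularize_eq_integral ht, regularize_eq_integral ht]
  exact integral_congr_ae (h.mono fun z hz => by simp only [hz])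

/-- The derivative falls on the kernel; the dilation by `t` gives the factor, and passing to a
derivative in the integration variable gives the sign. In this form the definition of a weak
derivative of `w` can be applied. -/
lemma partialDeriv_regularize (hη : ContDiff ℝ ∞ η) (hηc : HasCompactSupport η) (ht : t < 1)
    (hw : LocallyIntegrable w) (j : Fin d) (x : E d) :
    partialDeriv j (regularize η t w) x =
      -(t * ∫ z, w z * partialDeriv j (fun z => regKernel η t (t • x - z)) z) := by
  have hk := hasCompactSupport_regKernel hηc ht
  have hks := contDiff_regKernel hη t
  have h1 := hk.hasFDerivAt_convolution_right (ContinuousLinearMap.mul ℝ ℝ) hw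
    (hks.of_le (by simp)) (t • x)
  have h2 : HasFDerivAt (fun x : E d => t • x) (t • ContinuousLinearMap.id ℝ (E d)) x :=
    (hasFDerivAt_id x).const_smul t
  have h3 := h1.comp x h2
  have h4 : ∀ z, partialDeriv j (fun z => regKernel η t (t • x - z)) z =
      -fderiv ℝ (regKernel η t) (t • x - z) (EuclideanSpace.single j 1) := by
    intro z
    have h5 : HasFDerivAt (fun z : E d => t • x - z) (-ContinuousLinearMap.id ℝ (E d)) z :=
      (hasFDerivAt_id z).const_sub (t • x)
    have h6 := ((hks.differentiable (by simp)) (t • x - z)).hasFDerivAt.comp z h5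
    rw [partialDeriv, show (fun z => regKernel η t (t • x - z)) =
      regKernel η t ∘ fun z => t • x - z from rfl, h6.fderiv]
    simp
  rw [partialDeriv, regularize_eq_convolution ht]
  erw [h3.fderiv]
  simp only [h4, mul_neg, integral_neg, neg_neg]
  simp only [ContinuousLinearMap.comp_apply, smul_apply,
    ContinuousLinearMap.id_apply, map_smul, smul_eq_mul]
  rw [convolution_precompR_apply _ hw (hk.fderiv ℝ) (hks.continuous_fderiv (by simp))]
  rfl

variable {K : Affine.Simplex ℝ (E d) d}

lemma combo_mem_interior_hull {x y : E d} (hx : x ∈ hull K) (hy : y ∈ interior (hull K))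
    (ht0 : 0 ≤ t) (ht : t < 1) : t • x + (1 - t) • y ∈ interior (hull K) :=
  (convex_hull K).combo_self_interior_mem_interior hx hy ht0 (by linarith) (by ring)

/-- By convexity, a point of the closed simplex averaged with a point in the support of `η` lies in
the interior. The kernel is thus an admissible test function even for `x` on the boundary, and
regularisation up to the boundary requires no extension of `w` outside the simplex. -/
lemma isTestFunction_regKernel (hη : IsTestFunction (interior (hull K)) η) (ht0 : 0 ≤ t)
    (ht : t < 1) {x : E d} (hx : x ∈ hull K) :
    IsTestFunction (interior (hull K)) fun z => regKernel η t (t • x - z) := by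
  have ht' : 1 - t ≠ 0 := by linarith
  have hsub : tsupport (fun z => regKernel η t (t • x - z)) ⊆ interior (hull K) := by
    have h1 : tsupport (fun z => regKernel η t (t • x - z)) ⊆
        (fun z => (-(1 - t)⁻¹) • (t • x - z)) ⁻¹' tsupport η := by
      refine closure_minimal (fun z hz => subset_tsupport η fun h0 => hz ?_)
        ((isClosed_tsupport η).preimage (by fun_prop))
      simp only [regKernel, h0, mul_zero]
    intro z hz
    have h2 := combo_mem_interior_hull hx (hη.2.2 (h1 hz)) ht0 ht
    convert h2 using 1
    rw [smul_smul, mul_neg, mul_inv_cancel₀ ht']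
    module
  exact ⟨(contDiff_regKernel hη.1 t).comp (contDiff_const.sub contDiff_id),
    (isCompact_hull K).of_isClosed_subset (isClosed_tsupport _) (hsub.trans interior_subset), hsub⟩

lemma integral_indicator_mul (w φ : E d → ℝ) :
    ∫ z, (interior (hull K)).indicator w z * φ z = ∫ z in interior (hull K), w z * φ z := by
  rw [← integral_indicator isOpen_interior.measurableSet]
  exact integral_congr_ae (ae_of_all _ fun z => (Set.indicator_mul_left _ _ _).symm)

/-- Regularisation commutes with weak derivatives, up to a factor. -/
lemma partialDeriv_regularize_of_isWeakPartial (hη : IsTestFunction (interior (hull K)) η)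
    (ht0 : 0 ≤ t) (ht : t < 1) {p : E d → ℝ} {j : Fin d}
    (hw : LocallyIntegrable ((interior (hull K)).indicator w))
    (hp : IsWeakPartial (interior (hull K)) j w p) {x : E d} (hx : x ∈ hull K) :
    partialDeriv j (regularize η t ((interior (hull K)).indicator w)) x =
      t * regularize η t ((interior (hull K)).indicator p) x := by
  rw [partialDeriv_regularize hη.1 hη.2.1 ht hw, regularize_eq_integral ht,
    integral_indicator_mul, integral_indicator_mul,
    hp.2.2 _ (isTestFunction_regKernel hη ht0 ht hx)]
  ring

lemma integrable_mul_combo (hη : IsTestFunction (interior (hull K)) η) (ht0 : 0 ≤ t)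
    (ht : t < 1) (hw : ContinuousOn w (hull K)) {x : E d} (hx : x ∈ hull K) :
    Integrable fun y => η y * w (t • x + (1 - t) • y) := by
  have h1 : IntegrableOn (fun y => η y * w (t • x + (1 - t) • y)) (tsupport η) := by
    refine ContinuousOn.integrableOn_compact hη.2.1 (hη.1.continuous.continuousOn.mul ?_)
    refine hw.comp (by fun_prop) fun y hy => ?_
    exact interior_subset (combo_mem_interior_hull hx (hη.2.2 hy) ht0 ht)
  rw [← integrableOn_iff_integrable_of_support_subset (s := tsupport η)]
  · exact h1
  · intro y hy
    exact subset_tsupport η fun h0 => hy (by simp [h0])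

/-- The points that enter the average differ from `x` by at most (1 - t) times the diameter, so
uniform continuity on the compact simplex gives a uniform error. -/
lemma eventually_regularize_sub_le (hη : IsTestFunction (interior (hull K)) η)
    (hη0 : ∀ y, 0 ≤ η y) (hη1 : ∫ y, η y = 1) (hw : ContinuousOn w (hull K)) {ε : ℝ}
    (hε : 0 < ε) :
    ∀ᶠ t in 𝓝[<] (1 : ℝ), ∀ x ∈ hull K, |regularize η t w x - w x| ≤ ε := by
  have huc := (isCompact_hull K).uniformContinuousOn_of_continuous hw
  obtain ⟨δ, hδ, h⟩ := Metric.uniformContinuousOn_iff.1 huc ε hε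
  obtain ⟨D, hD⟩ := Metric.isBounded_iff.1 (isCompact_hull K).isBounded
  have hlim : Tendsto (fun t : ℝ => (1 - t) * D) (𝓝[<] 1) (𝓝 0) := by
    have : Tendsto (fun t : ℝ => (1 - t) * D) (𝓝 1) (𝓝 ((1 - 1) * D)) :=
      (Continuous.tendsto (by fun_prop) 1)
    rw [sub_self, zero_mul] at this
    exact this.mono_left nhdsWithin_le_nhds
  filter_upwards [hlim.eventually (gt_mem_nhds hδ), Ioo_mem_nhdsLT (zero_lt_one' ℝ)]
    with t htδ ⟨ht0, ht⟩ x hx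
  have hηi : Integrable η := hη.1.continuous.integrable_of_hasCompactSupport hη.2.1
  have heq : regularize η t w x - w x = ∫ y, η y * (w (t • x + (1 - t) • y) - w x) := by
    simp only [mul_sub]
    rw [integral_sub (integrable_mul_combo hη ht0.le ht hw hx) (hηi.mul_const _),
      integral_mul_const, hη1, one_mul, regularize]
  rw [heq, ← Real.norm_eq_abs]
  calc ‖∫ y, η y * (w (t • x + (1 - t) • y) - w x)‖ ≤ ∫ y, η y * ε := by
        refine norm_integral_le_of_norm_le (hηi.mul_const _) (ae_of_all _ fun y => ?_)
        rw [norm_mul, Real.norm_of_nonneg (hη0 y)]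
        refine (eq_or_ne (η y) 0).elim (fun h0 => by simp [h0]) fun h0 => ?_
        refine mul_le_mul_of_nonneg_left ?_ (hη0 y)
        have hy : y ∈ interior (hull K) := hη.2.2 (subset_tsupport η h0)
        refine (h _ (interior_subset (combo_mem_interior_hull hx hy ht0.le ht)) x hx ?_).le
        rw [dist_eq_norm, show t • x + (1 - t) • y - x = (1 - t) • (y - x) by module, norm_smul,
          Real.norm_of_nonneg (by linarith), ← dist_eq_norm]
        exact (mul_le_mul_of_nonneg_left (hD (interior_subset hy) hx) (by linarith)).trans_lt htδ
    _ = ε := by rw [integral_mul_const, hη1, one_mul]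

lemma eLpNorm_two_sq {α F : Type*} [MeasurableSpace α] [NormedAddCommGroup F] (ν : Measure α)
    (f : α → F) : eLpNorm f 2 ν ^ 2 = ∫⁻ x, ‖f x‖ₑ ^ 2 ∂ν := by
  have := eLpNorm_nnreal_pow_eq_lintegral (f := f) (μ := ν) (p := 2) (by norm_num)
  simpa using this

lemma lintegral_combo (ht : 0 < t) {F : E d → ENNReal} (hF : Measurable F) (y : E d) :
    ∫⁻ x, F (t • x + y) = ENNReal.ofReal |(t ^ d)⁻¹| * ∫⁻ x, F x := by
  have h := Measure.map_addHaar_smul (volume : Measure (E d)) ht.ne'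
  rw [← lintegral_add_right_eq_self F y, ← lintegral_map (f := fun z => F (z + y)) (by fun_prop)
    (measurable_const_smul t), h, lintegral_smul_measure, finrank_euclideanSpace_fin, smul_eq_mul]

/-- Jensen's inequality for the probability measure η dy, followed by Tonelli. The substitution in
`x` costs the factor t⁻ᵈ, which is at most 2ᵈ for t > 1/2. The bound is uniform in `t`, as the
density argument in L² requires. -/
lemma eLpNorm_regularize_le (hη : Continuous η) (hηc : HasCompactSupport η)
    (hη0 : ∀ y, 0 ≤ η y) (hη1 : ∫ y, η y = 1)
    (ht0 : 1 / 2 < t) (ht : t < 1) (hw : AEStronglyMeasurable w) :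
    eLpNorm (regularize η t w) 2 volume ≤ 2 ^ d * eLpNorm w 2 volume := by
  wlog hwm : StronglyMeasurable w generalizing w
  · rw [regularize_congr_ae ht hw.ae_eq_mk, eLpNorm_congr_ae hw.ae_eq_mk]
    exact this hw.stronglyMeasurable_mk.aestronglyMeasurable hw.stronglyMeasurable_mk
  have hηi : Integrable η := hη.integrable_of_hasCompactSupport hηc
  let P : Measure (E d) := volume.withDensity fun y => ENNReal.ofReal (η y)
  have hP : IsProbabilityMeasure P := by
    refine ⟨?_⟩
    rw [withDensity_apply _ .univ, setLIntegral_univ,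
      ← ofReal_integral_eq_lintegral_ofReal hηi (ae_of_all _ hη0), hη1, ENNReal.ofReal_one]
  have hpt : ∀ x, ‖regularize η t w x‖ₑ ^ 2 ≤ ∫⁻ y, ‖w (t • x + (1 - t) • y)‖ₑ ^ 2 ∂P := by
    intro x
    have hm : AEStronglyMeasurable (fun y => w (t • x + (1 - t) • y)) P :=
      (hwm.comp_measurable (by fun_prop)).aestronglyMeasurable
    have h1 : regularize η t w x = ∫ y, w (t • x + (1 - t) • y) ∂P := by
      rw [integral_withDensity_eq_integral_toReal_smul (by fun_prop) (by simp)]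
      simp only [ENNReal.toReal_ofReal (hη0 _), smul_eq_mul, regularize]
    rw [h1, ← eLpNorm_two_sq]
    refine pow_le_pow_left' ((enorm_integral_le_lintegral_enorm _).trans ?_) 2
    rw [← eLpNorm_one_eq_lintegral_enorm]
    exact eLpNorm_le_eLpNorm_of_exponent_le (by norm_num) hm
  have hsq : eLpNorm (regularize η t w) 2 volume ^ 2 ≤ (2 ^ d * eLpNorm w 2 volume) ^ 2 := by
    have hmeas : Measurable fun x => ‖w x‖ₑ ^ 2 := by
      have := hwm.measurable
      fun_prop
    calc eLpNorm (regularize η t w) 2 volume ^ 2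
        ≤ ∫⁻ x, ∫⁻ y, ‖w (t • x + (1 - t) • y)‖ₑ ^ 2 ∂P := by
          rw [eLpNorm_two_sq]
          exact lintegral_mono hpt
      _ = ∫⁻ y, ∫⁻ x, ‖w (t • x + (1 - t) • y)‖ₑ ^ 2 ∂volume ∂P := by
          refine lintegral_lintegral_swap (Measurable.aemeasurable ?_)
          exact hmeas.comp (f := fun q : E d × E d => t • q.1 + (1 - t) • q.2) (by fun_prop)
      _ = ENNReal.ofReal |(t ^ d)⁻¹| * eLpNorm w 2 volume ^ 2 := by
          simp_rw [lintegral_combo (by linarith) hmeas]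
          rw [lintegral_const, measure_univ, mul_one, eLpNorm_two_sq]
      _ ≤ 2 ^ d * eLpNorm w 2 volume ^ 2 := by
          gcongr
          rw [show (2 : ENNReal) ^ d = ENNReal.ofReal (2 ^ d) by
            rw [ENNReal.ofReal_pow (by norm_num)]; norm_num]
          refine ENNReal.ofReal_le_ofReal ?_
          have h0 : 0 < t := by linarith
          rw [abs_of_pos (by positivity), ← inv_pow]
          refine pow_le_pow_left₀ (by positivity) ?_ d
          rw [inv_le_comm₀ h0 (by norm_num)]
          linarith
      -- Replacing the constant by its square avoids a square root.
      _ ≤ (2 ^ d * eLpNorm w 2 volume) ^ 2 := by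
          rw [mul_pow, ← pow_mul]
          exact mul_le_mul' (pow_le_pow_right₀ (by norm_num) (by omega)) le_rfl
  exact (ENNReal.pow_le_pow_left_iff (by norm_num)).1 hsq

lemma tendsto_eLpNorm_of_uniform {α β : Type*} [MeasurableSpace α] {ν : Measure α}
    [IsFiniteMeasure ν] {l : Filter β} {f : β → α → ℝ} {g : α → ℝ}
    (h : ∀ ε > 0, ∀ᶠ b in l, ∀ᵐ x ∂ν, |f b x - g x| ≤ ε) :
    Tendsto (fun b => eLpNorm (f b - g) 2 ν) l (𝓝 0) := by
  refine ENNReal.tendsto_nhds_zero.2 fun δ hδ => ?_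
  obtain ⟨C, hC, hC0⟩ : ∃ C : ℝ, ν Set.univ ^ (2 : ENNReal).toReal⁻¹ * ENNReal.ofReal C ≤ δ ∧
      0 < C := by
    have h1 : Tendsto (fun C : ℝ => ν Set.univ ^ (2 : ENNReal).toReal⁻¹ * ENNReal.ofReal C)
        (𝓝[>] 0) (𝓝 0) := by
      have h2 : Tendsto (fun C : ℝ => ENNReal.ofReal C) (𝓝[>] 0) (𝓝 0) := by
        simpa using (ENNReal.tendsto_ofReal tendsto_id).mono_left
          (nhdsWithin_le_nhds (a := (0 : ℝ)) (s := Set.Ioi 0))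
      simpa using ENNReal.Tendsto.const_mul h2 (Or.inr (by finiteness))
    exact ((h1.eventually (ge_mem_nhds hδ)).and self_mem_nhdsWithin).exists
  filter_upwards [h C hC0] with b hb
  exact (eLpNorm_le_of_ae_bound hb).trans hC

/-- Continuous functions of compact support are dense in L², for them the convergence is uniform on
the simplex, and the regularisation operators are uniformly bounded. -/
lemma tendsto_eLpNorm_regularize (hη : IsTestFunction (interior (hull K)) η)
    (hη0 : ∀ y, 0 ≤ η y) (hη1 : ∫ y, η y = 1) (hw : MemLp w 2 volume) :
    Tendsto (fun t => eLpNorm (regularize η t w - w) 2 (volume.restrict (interior (hull K))))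
      (𝓝[<] 1) (𝓝 0) := by
  refine ENNReal.tendsto_nhds_zero.2 fun ε hε => ?_
  rcases eq_or_ne ε ⊤ with rfl | hεt
  · exact Eventually.of_forall fun _ => le_top
  set ν := (volume : Measure (E d)).restrict (interior (hull K)) with hν
  have hνf : IsFiniteMeasure ν := ⟨by
    simpa [hν] using (measure_mono interior_subset).trans_lt (isCompact_hull K).measure_lt_top⟩
  have hc0 : (2 : ENNReal) ^ d + 2 ≠ 0 := by positivity
  have hct : (2 : ENNReal) ^ d + 2 ≠ ⊤ := by finiteness
  -- The regularisation of `w - g` contributes `2 ^ d * δ`; the regularisation error of `g` and the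
  -- error `w - g` itself contribute one `δ` each.
  set δ := ε / (2 ^ d + 2) with hδ
  have hδ0 : δ ≠ 0 := (ENNReal.div_pos hε.ne' hct).ne'
  obtain ⟨g, hgc, hg, hgcont, hgm⟩ := hw.exists_hasCompactSupport_eLpNorm_sub_le (by norm_num) hδ0
  have hgr : Tendsto (fun t => eLpNorm (regularize η t g - g) 2 ν) (𝓝[<] 1) (𝓝 0) :=
    tendsto_eLpNorm_of_uniform fun C hC =>
      (eventually_regularize_sub_le hη hη0 hη1 hgcont.continuousOn hC).mono fun t ht =>
        (ae_restrict_mem isOpen_interior.measurableSet).mono fun x hx =>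
          ht x (interior_subset hx)
  filter_upwards [hgr.eventually (ge_mem_nhds (pos_iff_ne_zero.2 hδ0)),
    Ioo_mem_nhdsLT (show (1 / 2 : ℝ) < 1 by norm_num)] with t h2 ⟨ht0, ht⟩
  have hwl := hw.locallyIntegrable (by norm_num)
  have hgl := hgm.locallyIntegrable (by norm_num)
  have hr : ∀ f : E d → ℝ, LocallyIntegrable f → AEStronglyMeasurable (regularize η t f) ν :=
    fun f hf => (contDiff_regularize hη.1 hη.2.1 ht hf).continuous.aestronglyMeasurable
  have hνle : ν ≤ volume := Measure.restrict_le_self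
  have hwm : AEStronglyMeasurable w ν := hw.1.mono_measure hνle
  have hgm' : AEStronglyMeasurable g ν := hgcont.aestronglyMeasurable
  have hsplit : regularize η t w - w =
      regularize η t (w - g) + ((regularize η t g - g) - (w - g)) := by
    rw [regularize_sub hη.1 hη.2.1 ht hwl hgl]
    abel
  have h1 : eLpNorm (regularize η t (w - g)) 2 ν ≤ 2 ^ d * δ :=
    (eLpNorm_mono_measure _ hνle).trans ((eLpNorm_regularize_le hη.1.continuous hη.2.1 hη0 hη1
      ht0 ht (hw.1.sub hgm.1)).trans (by gcongr))
  have h3 : eLpNorm (w - g) 2 ν ≤ δ := (eLpNorm_mono_measure _ hνle).trans hg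
  calc eLpNorm (regularize η t w - w) 2 ν ≤ 2 ^ d * δ + (δ + δ) := by
        rw [hsplit]
        refine (eLpNorm_add_le (hr _ (hwl.sub hgl)) (((hr _ hgl).sub hgm').sub
          (hwm.sub hgm')) (by norm_num)).trans (add_le_add h1 ?_)
        exact (eLpNorm_sub_le ((hr _ hgl).sub hgm') (hwm.sub hgm') (by norm_num)).trans
          (add_le_add h2 h3)
    _ = (2 ^ d + 2) * δ := by ring
    _ = ε := ENNReal.mul_div_cancel hc0 hct
    _ ≤ ε := le_rfl

/-- There is a smooth averaging weight supported in the interior of a simplex. -/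
lemma exists_weight (K : Affine.Simplex ℝ (E d) d) :
    ∃ η : E d → ℝ, IsTestFunction (interior (hull K)) η ∧ (∀ y, 0 ≤ η y) ∧ ∫ y, η y = 1 := by
  obtain ⟨c, hc⟩ := interior_hull_nonempty K
  obtain ⟨r, hr, hsub⟩ := Metric.nhds_basis_closedBall.mem_iff.1 (isOpen_interior.mem_nhds hc)
  let f : ContDiffBump c := ⟨r / 2, r, by positivity, by linarith⟩
  exact ⟨f.normed volume, ⟨f.contDiff_normed, f.hasCompactSupport_normed,
    by rw [f.tsupport_normed_eq]; exact hsub⟩, f.nonneg_normed, f.integral_normed⟩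

end Regularisation

/-! ### Convergence in `L²` -/

section LTwo

variable {α β : Type*} [MeasurableSpace α] {ν : Measure α} {l : Filter β}

lemma tendsto_zero_of_sq {f : β → ENNReal} (h : Tendsto (fun b => f b ^ 2) l (𝓝 0)) :
    Tendsto f l (𝓝 0) := by
  have h1 := (ENNReal.continuous_rpow_const (y := 1 / 2)).tendsto 0 |>.comp h
  simp only [Function.comp_def, one_div] at h1
  rw [ENNReal.zero_rpow_of_pos (by norm_num)] at h1
  refine h1.congr fun b => ?_
  rw [← ENNReal.rpow_natCast, ← ENNReal.rpow_mul]
  norm_num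

lemma tendsto_eLpNorm_sub {f g : β → α → ℝ} {w w' : α → ℝ}
    (hf : ∀ b, AEStronglyMeasurable (f b) ν) (hg : ∀ b, AEStronglyMeasurable (g b) ν)
    (hw : AEStronglyMeasurable w ν) (hww' : w =ᵐ[ν] w')
    (h1 : Tendsto (fun b => eLpNorm (f b - w) 2 ν) l (𝓝 0))
    (h2 : Tendsto (fun b => eLpNorm (g b - w') 2 ν) l (𝓝 0)) :
    Tendsto (fun b => eLpNorm (f b - g b) 2 ν) l (𝓝 0) := by
  have h3 := h1.add h2
  rw [add_zero] at h3
  refine tendsto_of_tendsto_of_tendsto_of_le_of_le tendsto_const_nhds h3 (fun _ => zero_le)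
    fun b => ?_
  have h4 : eLpNorm (f b - g b) 2 ν = eLpNorm ((f b - w) - (g b - w')) 2 ν := by
    refine eLpNorm_congr_ae (hww'.mono fun x hx => ?_)
    simp only [Pi.sub_apply, hx]
    ring
  simp only [h4]
  exact eLpNorm_sub_le ((hf b).sub hw) ((hg b).sub (hw.congr hww')) (by norm_num)

lemma tendsto_integral_mul {f : β → α → ℝ} {w g : α → ℝ} (hf : ∀ b, MemLp (f b) 2 ν)
    (hw : MemLp w 2 ν) (hg : MemLp g 2 ν)
    (h : Tendsto (fun b => eLpNorm (f b - w) 2 ν) l (𝓝 0)) :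
    Tendsto (fun b => ∫ x, f b x * g x ∂ν) l (𝓝 (∫ x, w x * g x ∂ν)) := by
  refine tendsto_integral_of_L1' _ (hw.integrable_mul hg).aestronglyMeasurable
    (Eventually.of_forall fun b => (hf b).integrable_mul hg) ?_
  have h1 : Tendsto (fun b => eLpNorm (f b - w) 2 ν * eLpNorm g 2 ν) l (𝓝 0) := by
    simpa using ENNReal.Tendsto.mul_const h (Or.inr hg.2.ne)
  refine tendsto_of_tendsto_of_tendsto_of_le_of_le tendsto_const_nhds h1 (fun _ => zero_le)
    fun b => ?_
  have h2 := eLpNorm_smul_le_mul_eLpNorm (p := 2) (q := 2) (r := 1) hg.1 ((hf b).1.sub hw.1)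
  refine le_trans (le_of_eq ?_) h2
  congr 1
  ext x
  simp [sub_mul]

lemma exists_tendsto_eLpNorm_of_cauchy {f : ℕ → α → ℝ} (hf : ∀ n, MemLp (f n) 2 ν)
    (h : Tendsto (fun q : ℕ × ℕ => eLpNorm (f q.1 - f q.2) 2 ν) atTop (𝓝 0)) :
    ∃ t, MemLp t 2 ν ∧ Tendsto (fun n => eLpNorm (f n - t) 2 ν) atTop (𝓝 0) := by
  have hc : CauchySeq fun n => (hf n).toLp (f n) := by
    rw [cauchySeq_iff_tendsto_dist_atTop_0]
    have h1 := (ENNReal.tendsto_toReal ENNReal.zero_ne_top).comp h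
    refine h1.congr fun q => ?_
    rw [dist_edist, Lp.edist_toLp_toLp]
    rfl
  obtain ⟨F, hF⟩ := cauchySeq_tendsto_of_complete hc
  refine ⟨F, Lp.memLp F, ?_⟩
  rw [tendsto_iff_edist_tendsto_0] at hF
  refine hF.congr fun n => ?_
  rw [Lp.edist_def]
  exact eLpNorm_congr_ae ((hf n).coeFn_toLp.sub (ae_eq_refl _))

lemma ae_eq_of_tendsto_eLpNorm [l.NeBot] {f g : β → α → ℝ} {w w' : α → ℝ}
    (hf : ∀ b, AEStronglyMeasurable (f b) ν) (hg : ∀ b, AEStronglyMeasurable (g b) ν)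
    (hw : AEStronglyMeasurable w ν) (hw' : AEStronglyMeasurable w' ν)
    (h1 : Tendsto (fun b => eLpNorm (f b - w) 2 ν) l (𝓝 0))
    (h2 : Tendsto (fun b => eLpNorm (g b - w') 2 ν) l (𝓝 0))
    (h3 : Tendsto (fun b => eLpNorm (f b - g b) 2 ν) l (𝓝 0)) : w =ᵐ[ν] w' := by
  have h4 : eLpNorm (w - w') 2 ν = 0 := by
    have h5 := (h1.add h2).add h3
    simp only [add_zero] at h5
    refine le_antisymm (ge_of_tendsto h5 (Eventually.of_forall fun b => ?_)) zero_le
    have h6 : w - w' = ((g b - w') - (f b - w)) + (f b - g b) := by abel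
    rw [h6, add_comm (eLpNorm (f b - w) 2 ν)]
    refine (eLpNorm_add_le (((hg b).sub hw').sub ((hf b).sub hw)) ((hf b).sub (hg b))
      (by norm_num)).trans (add_le_add_left ?_ _)
    exact eLpNorm_sub_le ((hg b).sub hw') ((hf b).sub hw) (by norm_num)
  rw [eLpNorm_eq_zero_iff (hw.sub hw') (by norm_num)] at h4
  exact h4.mono fun x hx => sub_eq_zero.1 hx

end LTwo

/-! ### Density of smooth functions -/

section Density

variable {d : ℕ} {K : Affine.Simplex ℝ (E d) d} {w : E d → ℝ}

instance isFiniteMeasure_interior_hull (K : Affine.Simplex ℝ (E d) d) :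
    IsFiniteMeasure ((volume : Measure (E d)).restrict (interior (hull K))) :=
  ⟨by simpa using (measure_mono interior_subset).trans_lt (isCompact_hull K).measure_lt_top⟩

/-- Smooth functions are dense in `H¹(K)`. -/
lemma exists_smooth_approx (hw : MemSobolev 1 (interior (hull K)) w) :
    ∃ φ : ℕ → E d → ℝ, (∀ n, ContDiff ℝ ∞ (φ n)) ∧
      Tendsto (fun n => eLpNorm (φ n - w) 2 (volume.restrict (interior (hull K)))) atTop (𝓝 0) ∧
      (∀ j, Tendsto (fun n => eLpNorm (partialDeriv j (φ n) - weakPartial (interior (hull K)) j w)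
        2 (volume.restrict (interior (hull K)))) atTop (𝓝 0)) := by
  obtain ⟨η, hη, hη0, hη1⟩ := exists_weight K
  obtain ⟨u, -, hu1, hu⟩ := exists_seq_strictMono_tendsto (1 : ℝ)
  have hu' : Tendsto u atTop (𝓝[<] 1) :=
    tendsto_nhdsWithin_iff.2 ⟨hu, Eventually.of_forall hu1⟩
  set U := interior (hull K) with hU
  have hUm : MeasurableSet U := isOpen_interior.measurableSet
  have hind : ∀ {f : E d → ℝ}, MemLp f 2 (volume.restrict U) → MemLp (U.indicator f) 2 volume :=
    fun hf => (memLp_indicator_iff_restrict hUm).2 hf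
  have hae : ∀ f : E d → ℝ, U.indicator f =ᵐ[volume.restrict U] f := fun f =>
    indicator_ae_eq_restrict hUm
  have hwl := (hind hw.memLp).locallyIntegrable (by norm_num)
  refine ⟨fun n => regularize η (u n) (U.indicator w),
    fun n => contDiff_regularize hη.1 hη.2.1 (hu1 n) hwl, ?_, fun j => ?_⟩
  · refine ((tendsto_eLpNorm_regularize hη hη0 hη1 (hind hw.memLp)).comp hu').congr fun n => ?_
    exact eLpNorm_congr_ae ((ae_eq_refl _).sub (hae w))
  · set p := weakPartial U j w
    have hp : MemLp p 2 (volume.restrict U) :=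
      (hw.memSobolev_weakPartial isOpen_interior j).memLp
    have hpl := (hind hp).locallyIntegrable (by norm_num)
    have h1 := (tendsto_eLpNorm_regularize hη hη0 hη1 (hind hp)).comp hu'
    have h2 : Tendsto (fun n => ‖u n - 1‖ₑ * eLpNorm p 2 (volume.restrict U)) atTop (𝓝 0) := by
      have h3 : Tendsto (fun n => ‖u n - 1‖ₑ) atTop (𝓝 0) := by
        simpa using (hu.sub_const 1).enorm
      simpa using ENNReal.Tendsto.mul_const h3 (Or.inr hp.2.ne)
    have h4 := h1.add h2
    rw [add_zero] at h4
    refine tendsto_of_tendsto_of_tendsto_of_le_of_le' tendsto_const_nhds h4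
      (Eventually.of_forall fun _ => zero_le) ?_
    filter_upwards [hu.eventually (lt_mem_nhds zero_lt_one)] with n hn
    set R := regularize η (u n) (U.indicator p)
    have hRm : AEStronglyMeasurable (R - U.indicator p) (volume.restrict U) :=
      (contDiff_regularize hη.1 hη.2.1 (hu1 n) hpl).continuous.aestronglyMeasurable.sub
        ((hind hp).1.mono_measure Measure.restrict_le_self)
    -- The derivative of the regularisation is `u n` times the regularised derivative, so the error
    -- consists of a regularisation error and a multiple of `p` that tends to zero.
    have h5 : partialDeriv j (regularize η (u n) (U.indicator w)) - p =ᵐ[volume.restrict U]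
        u n • (R - U.indicator p) + (u n - 1) • p := by
      filter_upwards [ae_restrict_mem hUm, hae p] with x hx hxp
      simp only [Pi.sub_apply, Pi.add_apply, Pi.smul_apply, smul_eq_mul, hxp]
      rw [partialDeriv_regularize_of_isWeakPartial hη hn.le (hu1 n) hwl (hw.isWeakPartial j)
        (interior_subset hx)]
      ring
    calc eLpNorm (partialDeriv j (regularize η (u n) (U.indicator w)) - p) 2 (volume.restrict U)
        ≤ ‖u n‖ₑ * eLpNorm (R - U.indicator p) 2 (volume.restrict U)
          + ‖u n - 1‖ₑ * eLpNorm p 2 (volume.restrict U) := by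
          rw [eLpNorm_congr_ae h5, ← eLpNorm_const_smul, ← eLpNorm_const_smul]
          exact eLpNorm_add_le (hRm.const_smul _) (hp.1.const_smul _) (by norm_num)
      _ ≤ _ := by
          refine add_le_add_left (mul_le_of_le_one_left zero_le ?_) _
          rw [Real.enorm_eq_ofReal hn.le]
          exact ENNReal.ofReal_le_one.2 (hu1 n).le

end Density

/-! ### The trace inequality -/

section TraceInequality

variable {d : ℕ} [NeZero d] (K : Affine.Simplex ℝ (E d) d)

/-- The vertex `i` lies on every facet except the opposite one, so the field x - p_i is tangential
to those facets. On the opposite facet its normal component is the altitude. -/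
lemma inner_normal_sub_vertex (i : Fin (d + 1)) :
    ∃ c : ℝ, 0 < c ∧ ∀ k, ∀ x ∈ facet K k,
      inner ℝ (normal K k) (x - K.points i) = if k = i then c else 0 := by
  obtain ⟨c, hc, h⟩ := exists_linear_bary K i
  refine ⟨c⁻¹, inv_pos.2 hc, fun k x hx => ?_⟩
  have hx0 := (mem_facet.1 hx).2
  split_ifs with hk
  · subst hk
    have h1 := h (x - K.points k)
    rw [affineMap_linear_sub, hx0, bary_self] at h1
    field_simp
    linarith
  · obtain ⟨c', hc', h'⟩ := exists_linear_bary K k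
    have h1 := h' (x - K.points i)
    rw [affineMap_linear_sub, hx0, bary_ne K hk] at h1
    simpa [hc'.ne'] using h1

omit [NeZero d] in
lemma partialDeriv_mul {f g : E d → ℝ} (hf : ContDiff ℝ ∞ f) (hg : ContDiff ℝ ∞ g) (j : Fin d)
    (x : E d) : partialDeriv j (fun x => f x * g x) x =
      partialDeriv j f x * g x + f x * partialDeriv j g x := by
  have h := (hf.differentiable (by simp) x).hasFDerivAt.mul
    (hg.differentiable (by simp) x).hasFDerivAt
  rw [partialDeriv, show (fun x => f x * g x) = f * g from rfl, h.fderiv]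
  simp only [add_apply, smul_apply, smul_eq_mul, partialDeriv]
  ring

omit [NeZero d] in
lemma contDiff_coord (j : Fin d) : ContDiff ℝ ∞ fun x : E d => x j :=
  (EuclideanSpace.proj (𝕜 := ℝ) j).contDiff

omit [NeZero d] in
lemma partialDeriv_coord_sub (j : Fin d) (c : ℝ) (x : E d) :
    partialDeriv j (fun x : E d => x j - c) x = 1 := by
  have h : HasFDerivAt (fun x : E d => x j - c) (EuclideanSpace.proj (𝕜 := ℝ) j) x :=
    (EuclideanSpace.proj (𝕜 := ℝ) j).hasFDerivAt.sub_const c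
  rw [partialDeriv, h.fderiv]
  simp

/-- The field (x - p_i) φ² has flux only through the facet `i`, where its normal component is a
positive constant times φ². The divergence theorem thus bounds the facet integral by the integral of
d φ² + 2 φ (x - p_i)·∇φ. -/
lemma integral_facet_sq_le (i : Fin (d + 1)) : ∃ C : ℝ, 0 ≤ C ∧ ∀ φ : E d → ℝ, ContDiff ℝ ∞ φ →
    ∫ x, φ x ^ 2 ∂facetMeasure K i ≤
      C * ∫ x in interior (hull K), (φ x ^ 2 + ∑ j, partialDeriv j φ x ^ 2) := by
  obtain ⟨c, hc, hn⟩ := inner_normal_sub_vertex K i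
  obtain ⟨D, hD⟩ := Metric.isBounded_iff.1 (isCompact_hull K).isBounded
  have hp : K.points i ∈ hull K := subset_convexHull ℝ _ ⟨i, rfl⟩
  have hD0 : 0 ≤ D := dist_nonneg.trans (hD hp hp)
  -- With `D` bounding the diameter, the divergence is at most the sum over `j` of φ² + D (φ² + (∂_j
  -- φ)²); the three summands in the bracket majorise its coefficients.
  refine ⟨c⁻¹ * (d + d * D + D), by positivity, fun φ hφ => ?_⟩
  have hv : ∀ j, ContDiff ℝ ∞ fun x : E d => (x j - K.points i j) * (φ x * φ x) := fun j =>
    ((contDiff_coord j).sub contDiff_const).mul (hφ.mul hφ)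
  have hdv : ∀ j x, partialDeriv j (fun x : E d => (x j - K.points i j) * (φ x * φ x)) x =
      φ x ^ 2 + (x j - K.points i j) * (2 * φ x * partialDeriv j φ x) := fun j x => by
    rw [partialDeriv_mul ((contDiff_coord j).sub contDiff_const) (hφ.mul hφ),
      partialDeriv_mul hφ hφ, partialDeriv_coord_sub]
    ring
  have hφc := hφ.continuous
  have hdc := fun j => (contDiff_partialDeriv hφ j).continuous
  have hint : ∀ f : E d → ℝ, Continuous f → IntegrableOn f (interior (hull K)) := fun f hf =>
    memLp_one_iff_integrable.1 (memLp_hull K hf.continuousOn)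
  have hintF : ∀ k, ∀ f : E d → ℝ, Continuous f → Integrable f (facetMeasure K k) := fun k f hf =>
    memLp_one_iff_integrable.1 (memLp_facet K k hf.continuousOn)
  have hflux : ∑ j, ∫ x in interior (hull K),
      partialDeriv j (fun x : E d => (x j - K.points i j) * (φ x * φ x)) x
        = c * ∫ x, φ x ^ 2 ∂facetMeasure K i := by
    simp_rw [fun j => integral_partialDeriv K ((hv j).of_le (by simp)) j]
    rw [Finset.sum_comm, ← integral_const_mul]
    rw [Finset.sum_eq_single i]
    · rw [← integral_finsetSum _ fun j _ => hintF i _ (by have := (hv j).continuous; fun_prop)]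
      refine integral_congr_ae ((ae_mem_facet K i).mono fun x hx => ?_)
      have := hn i x hx
      rw [if_pos rfl, PiLp.inner_apply] at this
      simp only [RCLike.inner_apply, conj_trivial, PiLp.sub_apply] at this
      simp only [← this, Finset.sum_mul]
      exact Finset.sum_congr rfl fun j _ => by ring
    · intro k _ hk
      rw [← integral_finsetSum _ fun j _ => hintF k _ (by have := (hv j).continuous; fun_prop)]
      refine (integral_congr_ae ((ae_mem_facet K k).mono fun x hx => ?_)).trans
        (integral_zero _ _)
      have := hn k x hx
      rw [if_neg hk, PiLp.inner_apply] at this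
      simp only [RCLike.inner_apply, conj_trivial, PiLp.sub_apply] at this
      rw [← zero_mul (φ x * φ x), ← this, Finset.sum_mul]
      exact Finset.sum_congr rfl fun j _ => by ring
    · simp
  have hle : c * ∫ x, φ x ^ 2 ∂facetMeasure K i ≤ (d + d * D + D) *
      ∫ x in interior (hull K), (φ x ^ 2 + ∑ j, partialDeriv j φ x ^ 2) := by
    rw [← hflux, ← integral_finsetSum _ fun j _ => hint _ (contDiff_partialDeriv (hv j) j).continuous,
      ← integral_const_mul]
    refine setIntegral_mono_on (hint _ ?_) (hint _ ?_) isOpen_interior.measurableSet fun x hx => ?_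
    · exact continuous_finsetSum _ fun j _ => (contDiff_partialDeriv (hv j) j).continuous
    · fun_prop
    · simp only [hdv]
      have hj : ∀ j, φ x ^ 2 + (x j - K.points i j) * (2 * φ x * partialDeriv j φ x) ≤
          φ x ^ 2 + D * (φ x ^ 2 + partialDeriv j φ x ^ 2) := fun j => by
        have h1 : |x j - K.points i j| ≤ D := by
          have := PiLp.norm_apply_le (x - K.points i) j
          rw [← dist_eq_norm] at this
          exact this.trans (hD (interior_subset hx) hp)
        obtain ⟨h2, h3⟩ := abs_le.1 h1
        -- For |y| ≤ D, the bound 2 y φ ∂φ ≤ D (φ² + (∂φ)²) follows from the squares (φ ± ∂φ)² with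
        -- the nonnegative weights D - y and D + y.
        nlinarith [mul_nonneg (sub_nonneg.2 h3) (sq_nonneg (φ x + partialDeriv j φ x)),
          mul_nonneg (sub_nonneg.2 h2) (sq_nonneg (φ x - partialDeriv j φ x)),
          mul_nonneg (sub_nonneg.2 h3) (sq_nonneg (φ x - partialDeriv j φ x)),
          mul_nonneg (sub_nonneg.2 h2) (sq_nonneg (φ x + partialDeriv j φ x))]
      refine (Finset.sum_le_sum fun j _ => hj j).trans ?_
      rw [Finset.sum_add_distrib, ← Finset.mul_sum, Finset.sum_add_distrib]
      simp only [Finset.sum_const, Finset.card_univ, Fintype.card_fin, nsmul_eq_mul]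
      have hS : 0 ≤ ∑ j, partialDeriv j φ x ^ 2 := Finset.sum_nonneg fun j _ => sq_nonneg _
      have hd0 : (0 : ℝ) ≤ d := Nat.cast_nonneg d
      nlinarith [mul_nonneg hd0 hS, mul_nonneg hD0 (sq_nonneg (φ x)),
        mul_nonneg (mul_nonneg hd0 hD0) hS]
  rw [mul_assoc, ← div_eq_inv_mul, le_div_iff₀' hc]
  exact hle

lemma eLpNorm_two_sq_eq_ofReal {α : Type*} [MeasurableSpace α] {ν : Measure α} {f : α → ℝ}
    (hf : MemLp f 2 ν) : eLpNorm f 2 ν ^ 2 = ENNReal.ofReal (∫ x, f x ^ 2 ∂ν) := by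
  rw [eLpNorm_two_sq, ofReal_integral_eq_lintegral_ofReal hf.integrable_sq
    (ae_of_all _ fun x => sq_nonneg _)]
  refine lintegral_congr fun x => ?_
  rw [← enorm_pow, Real.enorm_eq_ofReal (sq_nonneg _)]

/-- The trace inequality for smooth functions. -/
lemma eLpNorm_bdry_sq_le : ∃ C : ENNReal, C ≠ ⊤ ∧ ∀ φ : E d → ℝ, ContDiff ℝ ∞ φ →
    eLpNorm φ 2 (bdryMeasure K) ^ 2 ≤
      C * (eLpNorm φ 2 (volume.restrict (interior (hull K))) ^ 2 +
        ∑ j, eLpNorm (partialDeriv j φ) 2 (volume.restrict (interior (hull K))) ^ 2) := by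
  choose C hC0 hC using integral_facet_sq_le K
  refine ⟨∑ i, ENNReal.ofReal (C i), by simp, fun φ hφ => ?_⟩
  have hφm : MemLp φ 2 (volume.restrict (interior (hull K))) :=
    memLp_hull K hφ.continuous.continuousOn
  have hdm : ∀ j, MemLp (partialDeriv j φ) 2 (volume.restrict (interior (hull K))) := fun j =>
    memLp_hull K (contDiff_partialDeriv hφ j).continuous.continuousOn
  calc eLpNorm φ 2 (bdryMeasure K) ^ 2 ≤ ∑ i, eLpNorm φ 2 (facetMeasure K i) ^ 2 := by
        simp_rw [eLpNorm_two_sq]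
        rw [← lintegral_finsetSum_measure]
        exact lintegral_mono' (bdryMeasure_le_sum K) le_rfl
    _ ≤ ∑ i, ENNReal.ofReal (C i) * (eLpNorm φ 2 (volume.restrict (interior (hull K))) ^ 2 +
        ∑ j, eLpNorm (partialDeriv j φ) 2 (volume.restrict (interior (hull K))) ^ 2) := by
        refine Finset.sum_le_sum fun i _ => ?_
        rw [eLpNorm_two_sq_eq_ofReal (memLp_facet K i hφ.continuous.continuousOn),
          eLpNorm_two_sq_eq_ofReal hφm]
        simp_rw [fun j => eLpNorm_two_sq_eq_ofReal (hdm j)]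
        rw [← ENNReal.ofReal_sum_of_nonneg fun j _ => integral_nonneg fun x => sq_nonneg _,
          ← ENNReal.ofReal_add (integral_nonneg fun x => sq_nonneg _)
            (Finset.sum_nonneg fun j _ => integral_nonneg fun x => sq_nonneg _),
          ← ENNReal.ofReal_mul (hC0 i), ← integral_finsetSum _ fun j _ => (hdm j).integrable_sq,
          ← integral_add hφm.integrable_sq
            (integrable_finsetSum _ fun j _ => (hdm j).integrable_sq)]
        exact ENNReal.ofReal_le_ofReal (hC i φ hφ)
    _ = _ := by rw [Finset.sum_mul]

/-- Applied to differences of smooth approximations, this gives both the existence of traces (the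
boundary values form a Cauchy sequence) and their uniqueness. -/
lemma tendsto_eLpNorm_bdry {β : Type*} {l : Filter β} {φ : β → E d → ℝ}
    (hφ : ∀ b, ContDiff ℝ ∞ (φ b))
    (h0 : Tendsto (fun b => eLpNorm (φ b) 2 (volume.restrict (interior (hull K)))) l (𝓝 0))
    (h1 : ∀ j, Tendsto (fun b => eLpNorm (partialDeriv j (φ b)) 2
      (volume.restrict (interior (hull K)))) l (𝓝 0)) :
    Tendsto (fun b => eLpNorm (φ b) 2 (bdryMeasure K)) l (𝓝 0) := by
  obtain ⟨C, hC, h⟩ := eLpNorm_bdry_sq_le K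
  have hsq : ∀ {f : β → ENNReal}, Tendsto f l (𝓝 0) → Tendsto (fun b => f b ^ 2) l (𝓝 0) :=
    fun hf => by simpa [Function.comp_def] using ((ENNReal.continuous_pow 2).tendsto 0).comp hf
  have h2 := (hsq h0).add (tendsto_finsetSum Finset.univ fun j _ => hsq (h1 j))
  have h3 := ENNReal.Tendsto.const_mul (a := C) h2 (Or.inr hC)
  simp only [Finset.sum_const_zero, add_zero, mul_zero] at h3
  exact tendsto_zero_of_sq (tendsto_of_tendsto_of_tendsto_of_le_of_le tendsto_const_nhds h3
    (fun _ => zero_le) fun b => h (φ b) (hφ b))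

end TraceInequality

/-! ### Traces -/

section Trace

variable {d : ℕ} [NeZero d] {K : Affine.Simplex ℝ (E d) d} {w w' t t' ψ : E d → ℝ}

omit [NeZero d] in
lemma partialDeriv_sub (hf : ContDiff ℝ ∞ w) (hg : ContDiff ℝ ∞ w') (j : Fin d) :
    partialDeriv j (w - w') = partialDeriv j w - partialDeriv j w' := by
  ext x
  have h := (hf.differentiable (by simp) x).hasFDerivAt.sub
    (hg.differentiable (by simp) x).hasFDerivAt
  rw [partialDeriv, h.fderiv]
  simp [partialDeriv]

lemma memLp_bdry (K : Affine.Simplex ℝ (E d) d) (hw : Continuous w) :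
    MemLp w 2 (bdryMeasure K) := by
  have hc : IsCompact (⋃ i, facet K i) := isCompact_iUnion fun i => isCompact_facet K i
  have : IsFiniteMeasure
      ((Measure.euclideanHausdorffMeasure (d - 1)).restrict (⋃ i, facet K i)) :=
    isFiniteMeasure_bdryMeasure K
  exact memLp_restrict_of_continuousOn hc hw.continuousOn

/-- A function in `H¹(K)` has a trace on `∂K`. -/
lemma exists_isTrace (hw : MemSobolev 1 (interior (hull K)) w) : ∃ t, IsTrace K w t := by
  obtain ⟨φ, hφ, h0, h1⟩ := exists_smooth_approx hw
  have hcauchy : Tendsto (fun q : ℕ × ℕ => eLpNorm (φ q.1 - φ q.2) 2 (bdryMeasure K)) atTop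
      (𝓝 0) := by
    rw [← prod_atTop_atTop_eq]
    refine tendsto_eLpNorm_bdry K (fun q => (hφ q.1).sub (hφ q.2)) ?_ fun j => ?_
    · exact tendsto_eLpNorm_sub (fun q => (hφ q.1).continuous.aestronglyMeasurable)
        (fun q => (hφ q.2).continuous.aestronglyMeasurable) hw.memLp.1 (ae_eq_refl w)
        (h0.comp tendsto_fst) (h0.comp tendsto_snd)
    · simp_rw [partialDeriv_sub (hφ _) (hφ _) j]
      exact tendsto_eLpNorm_sub
        (fun q => (contDiff_partialDeriv (hφ q.1) j).continuous.aestronglyMeasurable)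
        (fun q => (contDiff_partialDeriv (hφ q.2) j).continuous.aestronglyMeasurable)
        (hw.memSobolev_weakPartial isOpen_interior j).memLp.1 (ae_eq_refl _)
        ((h1 j).comp tendsto_fst) ((h1 j).comp tendsto_snd)
  obtain ⟨t, ht, hlim⟩ :=
    exists_tendsto_eLpNorm_of_cauchy (fun n => memLp_bdry K (hφ n).continuous) hcauchy
  exact ⟨t, hw, ht, φ, hφ, h0, h1, hlim⟩

lemma isTrace_trace (hw : MemSobolev 1 (interior (hull K)) w) : IsTrace K w (trace K w) := by
  have h := exists_isTrace hw
  rw [trace, dif_pos h]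
  exact h.choose_spec

/-- The trace depends only on the almost everywhere class of a function. -/
lemma IsTrace.ae_eq (h : IsTrace K w t) (h' : IsTrace K w' t')
    (hww' : w =ᵐ[volume.restrict (interior (hull K))] w') : t =ᵐ[bdryMeasure K] t' := by
  obtain ⟨hw, ht, φ, hφ, h0, h1, h2⟩ := h
  obtain ⟨hw', ht', φ', hφ', h0', h1', h2'⟩ := h'
  refine ae_eq_of_tendsto_eLpNorm (fun n => (hφ n).continuous.aestronglyMeasurable)
    (fun n => (hφ' n).continuous.aestronglyMeasurable) ht.1 ht'.1 h2 h2' ?_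
  refine tendsto_eLpNorm_bdry K (fun n => (hφ n).sub (hφ' n)) ?_ fun j => ?_
  · exact tendsto_eLpNorm_sub (fun n => (hφ n).continuous.aestronglyMeasurable)
      (fun n => (hφ' n).continuous.aestronglyMeasurable) hw.memLp.1 hww' h0 h0'
  · simp_rw [partialDeriv_sub (hφ _) (hφ' _) j]
    exact tendsto_eLpNorm_sub
      (fun n => (contDiff_partialDeriv (hφ n) j).continuous.aestronglyMeasurable)
      (fun n => (contDiff_partialDeriv (hφ' n) j).continuous.aestronglyMeasurable)
      (hw.memSobolev_weakPartial isOpen_interior j).memLp.1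
      (hw.weakPartial_congr isOpen_interior hww' j) (h1 j) (h1' j)

omit [NeZero d] in
lemma IsTrace.sub (h : IsTrace K w t) (h' : IsTrace K w' t') :
    IsTrace K (w - w') (t - t') := by
  obtain ⟨hw, ht, φ, hφ, h0, h1, h2⟩ := h
  obtain ⟨hw', ht', φ', hφ', h0', h1', h2'⟩ := h'
  have key : ∀ {ν : Measure (E d)} {f g : ℕ → E d → ℝ} {v v' : E d → ℝ},
      (∀ n, AEStronglyMeasurable (f n) ν) → (∀ n, AEStronglyMeasurable (g n) ν) →
      AEStronglyMeasurable v ν → AEStronglyMeasurable v' ν →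
      Tendsto (fun n => eLpNorm (f n - v) 2 ν) atTop (𝓝 0) →
      Tendsto (fun n => eLpNorm (g n - v') 2 ν) atTop (𝓝 0) →
      Tendsto (fun n => eLpNorm ((f n - g n) - (v - v')) 2 ν) atTop (𝓝 0) := by
    intro ν f g v v' hf hg hv hv' h1 h2
    have h3 := tendsto_eLpNorm_sub (f := fun n => f n - v) (g := fun n => g n - v') (w := 0)
      (w' := 0) (fun n => (hf n).sub hv) (fun n => (hg n).sub hv') aestronglyMeasurable_zero
      (ae_eq_refl _) (by simpa using h1) (by simpa using h2)
    refine h3.congr fun n => ?_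
    rw [sub_sub_sub_comm]
  refine ⟨hw.sub isOpen_interior hw', ht.sub ht', fun n => φ n - φ' n,
    fun n => (hφ n).sub (hφ' n), ?_, fun j => ?_, ?_⟩
  · exact key (fun n => (hφ n).continuous.aestronglyMeasurable)
      (fun n => (hφ' n).continuous.aestronglyMeasurable) hw.memLp.1 hw'.memLp.1 h0 h0'
  · refine (key (fun n => (contDiff_partialDeriv (hφ n) j).continuous.aestronglyMeasurable)
      (fun n => (contDiff_partialDeriv (hφ' n) j).continuous.aestronglyMeasurable)
      (hw.memSobolev_weakPartial isOpen_interior j).memLp.1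
      (hw'.memSobolev_weakPartial isOpen_interior j).memLp.1 (h1 j) (h1' j)).congr fun n => ?_
    rw [← partialDeriv_sub (hφ n) (hφ' n) j]
    exact eLpNorm_congr_ae ((ae_eq_refl _).sub (hw.weakPartial_sub isOpen_interior hw' j).symm)
  · exact key (fun n => (hφ n).continuous.aestronglyMeasurable)
      (fun n => (hφ' n).continuous.aestronglyMeasurable) ht.1 ht'.1 h2 h2'

omit [NeZero d] in
lemma weakPartial_of_contDiff (hψ : ContDiff ℝ ∞ ψ) (j : Fin d) :
    weakPartial (interior (hull K)) j ψ =ᵐ[volume.restrict (interior (hull K))]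
      partialDeriv j ψ :=
  (isWeakPartial_of_contDiff hψ j).weakPartial_ae_eq isOpen_interior

lemma isTrace_of_contDiff (hψ : ContDiff ℝ ∞ ψ) : IsTrace K ψ ψ := by
  refine ⟨memSobolev_of_contDiff K 1 hψ, memLp_bdry K hψ.continuous, fun _ => ψ, fun _ => hψ,
    by simp, fun j => ?_, by simp⟩
  have : eLpNorm (partialDeriv j ψ - weakPartial (interior (hull K)) j ψ) 2
      (volume.restrict (interior (hull K))) = 0 := by
    rw [eLpNorm_congr_ae (g := 0), eLpNorm_zero]
    filter_upwards [weakPartial_of_contDiff (K := K) hψ j] with x hx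
    simp [hx]
  simp [this]

lemma trace_sub (hw : MemSobolev 1 (interior (hull K)) w)
    (hw' : MemSobolev 1 (interior (hull K)) w') :
    trace K (w - w') =ᵐ[bdryMeasure K] trace K w - trace K w' :=
  (isTrace_trace (hw.sub isOpen_interior hw')).ae_eq ((isTrace_trace hw).sub (isTrace_trace hw'))
    (ae_eq_refl _)

lemma trace_congr (hw : MemSobolev 1 (interior (hull K)) w)
    (hww' : w =ᵐ[volume.restrict (interior (hull K))] w') :
    trace K w =ᵐ[bdryMeasure K] trace K w' :=
  (isTrace_trace hw).ae_eq (isTrace_trace (hw.congr isOpen_interior hww')) hww'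

lemma trace_of_contDiff (hψ : ContDiff ℝ ∞ ψ) : trace K ψ =ᵐ[bdryMeasure K] ψ :=
  (isTrace_trace (memSobolev_of_contDiff K 1 hψ)).ae_eq (isTrace_of_contDiff hψ) (ae_eq_refl _)

lemma memLp_trace (hw : MemSobolev 1 (interior (hull K)) w) : MemLp (trace K w) 2 (bdryMeasure K) :=
  (isTrace_trace hw).2.1

lemma memLp_trace_facet (hw : MemSobolev 1 (interior (hull K)) w) (i : Fin (d + 1)) :
    MemLp (trace K w) 2 (facetMeasure K i) :=
  (memLp_trace hw).mono_measure (facetMeasure_le_bdryMeasure K i)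

/-- Integration by parts on a simplex. -/
theorem integral_mul_partialDeriv (hw : MemSobolev 1 (interior (hull K)) w)
    (hψ : ContDiff ℝ ∞ ψ) (j : Fin d) :
    ∫ x in interior (hull K), w x * partialDeriv j ψ x =
      ∑ i, ∫ x, trace K w x * (ψ x * normal K i j) ∂facetMeasure K i
        - ∫ x in interior (hull K), weakPartial (interior (hull K)) j w x * ψ x := by
  obtain ⟨-, ht, φ, hφ, h0, h1, h2⟩ := isTrace_trace hw
  have hψc := hψ.continuous
  have hm : ∀ f : E d → ℝ, Continuous f → MemLp f 2 (volume.restrict (interior (hull K))) :=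
    fun f hf => memLp_hull K hf.continuousOn
  have hmF : ∀ i, ∀ f : E d → ℝ, Continuous f → MemLp f 2 (facetMeasure K i) :=
    fun i f hf => memLp_facet K i hf.continuousOn
  have l1 := tendsto_integral_mul (fun n => hm _ (hφ n).continuous) hw.memLp
    (hm _ (contDiff_partialDeriv hψ j).continuous) h0
  have l2 := tendsto_integral_mul (fun n => hm _ (contDiff_partialDeriv (hφ n) j).continuous)
    (hw.memSobolev_weakPartial isOpen_interior j).memLp (hm _ hψc) (h1 j)
  have l3 : ∀ i, Tendsto (fun n => ∫ x, φ n x * (ψ x * normal K i j) ∂facetMeasure K i) atTop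
      (𝓝 (∫ x, trace K w x * (ψ x * normal K i j) ∂facetMeasure K i)) := fun i => by
    refine tendsto_integral_mul (fun n => hmF i _ (hφ n).continuous) (memLp_trace_facet hw i)
      (hmF i _ (by fun_prop)) ?_
    exact tendsto_of_tendsto_of_tendsto_of_le_of_le tendsto_const_nhds h2 (fun _ => zero_le)
      fun n => eLpNorm_mono_measure _ (facetMeasure_le_bdryMeasure K i)
  refine tendsto_nhds_unique l1 (((tendsto_finsetSum Finset.univ fun i _ => l3 i).sub l2).congr
    fun n => ?_)
  -- For the smooth approximations the formula is the divergence theorem for the product with `ψ`.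
  -- Every term passes to the limit, those on the facets by the definition of the trace.
  have h := integral_partialDeriv K (((hφ n).mul hψ).of_le (by simp)) j
  simp_rw [partialDeriv_mul (hφ n) hψ] at h
  have hadd := integral_add
    ((hm _ (contDiff_partialDeriv (hφ n) j).continuous).integrable_mul (hm _ hψc))
    ((hm _ (hφ n).continuous).integrable_mul (hm _ (contDiff_partialDeriv hψ j).continuous))
  simp only [Pi.mul_apply] at hadd
  rw [hadd] at h
  simp_rw [mul_assoc] at h
  linarith

omit [NeZero d] in
lemma fderiv_eq_sum_partialDeriv (φ : E d → ℝ) (x v : E d) :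
    fderiv ℝ φ x v = ∑ j, v j * partialDeriv j φ x := by
  have hv : v = ∑ j, v j • EuclideanSpace.single j (1 : ℝ) := by
    simpa using ((EuclideanSpace.basisFun (Fin d) ℝ).sum_repr v).symm
  conv_lhs => rw [hv]
  simp [map_sum, partialDeriv]

omit [NeZero d] in
lemma continuousOn_coord {a : E d → E d} {S : Set (E d)} (ha : ContinuousOn a S) (j : Fin d) :
    ContinuousOn (fun x => a x j) S :=
  (EuclideanSpace.proj (𝕜 := ℝ) j).continuous.comp_continuousOn ha

omit [NeZero d] in
/-- The regularisation of a divergence-free vector field is divergence-free. -/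
lemma sum_partialDeriv_regularize_eq_zero {η : E d → ℝ} {s : ℝ} {a : E d → E d}
    (hη : IsTestFunction (interior (hull K)) η) (hs0 : 0 ≤ s) (hs : s < 1)
    (ha : ContinuousOn a (hull K)) (hdiv : IsDivFree (interior (hull K)) a) {x : E d}
    (hx : x ∈ hull K) :
    ∑ j, partialDeriv j (regularize η s ((interior (hull K)).indicator fun x => a x j)) x = 0 := by
  have hal : ∀ j, IntegrableOn (fun x => a x j) (interior (hull K)) := fun j =>
    memLp_one_iff_integrable.1 (memLp_hull K (continuousOn_coord ha j))
  -- As a function of the integration variable the kernel is a test function, and the divergence in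
  -- question is, up to a factor, the integral of `a` against its gradient.
  have htest := isTestFunction_regKernel hη hs0 hs hx
  have h0 := hdiv _ htest
  simp_rw [fderiv_eq_sum_partialDeriv] at h0
  rw [integral_finsetSum _ fun j _ => integrableOn_mul_test
    (hal j).locallyIntegrableOn (htest.partialDeriv j)] at h0
  simp_rw [fun j => partialDeriv_regularize (w := (interior (hull K)).indicator fun x => a x j)
    hη.1 hη.2.1 hs ((integrable_indicator_iff isOpen_interior.measurableSet).2
    (hal j)).locallyIntegrable j x, integral_indicator_mul]
  rw [Finset.sum_neg_distrib, ← Finset.mul_sum, h0, mul_zero, neg_zero]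

/-- Integration by parts on a simplex in the direction of a divergence-free vector field. -/
theorem integral_mul_advection {a : E d → E d} (hw : MemSobolev 1 (interior (hull K)) w)
    (hψ : ContDiff ℝ ∞ ψ) (ha : ContinuousOn a (hull K))
    (hdiv : IsDivFree (interior (hull K)) a) :
    ∑ j, ∫ x in interior (hull K), a x j * (w x * partialDeriv j ψ x) =
      ∑ i, ∑ j, ∫ x, a x j * (trace K w x * (ψ x * normal K i j)) ∂facetMeasure K i
        - ∑ j, ∫ x in interior (hull K), a x j *
          (weakPartial (interior (hull K)) j w x * ψ x) := by
  obtain ⟨η, hη, hη0, hη1⟩ := exists_weight K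
  obtain ⟨u, -, hu1, hu⟩ := exists_seq_strictMono_tendsto (1 : ℝ)
  have hu' : Tendsto u atTop (𝓝[<] 1) :=
    tendsto_nhdsWithin_iff.2 ⟨hu, Eventually.of_forall hu1⟩
  set U := interior (hull K) with hU
  have hUm : MeasurableSet U := isOpen_interior.measurableSet
  -- The product of `ψ` with a component of `a` need not be smooth, so Green's formula is applied
  -- with regularised components. These converge uniformly on the closed simplex and are exactly
  -- divergence-free there.
  let A : ℕ → Fin d → E d → ℝ := fun n j => regularize η (u n) (U.indicator fun x => a x j)
  have hA : ∀ n j, ContDiff ℝ ∞ (A n j) := fun n j =>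
    contDiff_regularize hη.1 hη.2.1 (hu1 n) ((integrable_indicator_iff hUm).2
      (memLp_one_iff_integrable.1 (memLp_hull K (continuousOn_coord ha j)))).locallyIntegrable
  have hψc := hψ.continuous
  have hunif : ∀ j, ∀ ε > 0, ∀ᶠ n in atTop, ∀ x ∈ hull K, |A n j x - a x j| ≤ ε := by
    intro j ε hε
    filter_upwards [hu'.eventually (eventually_regularize_sub_le hη hη0 hη1
      (continuousOn_coord ha j) hε), hu.eventually (lt_mem_nhds zero_lt_one)] with n hn hn0 x hx
    convert hn x hx using 3
    refine integral_congr_ae (ae_of_all _ fun y => ?_)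
    rcases eq_or_ne (η y) 0 with h0 | h0
    · simp [h0]
    · have hy : y ∈ U := hη.2.2 (subset_tsupport η h0)
      exact congrArg _ (Set.indicator_of_mem (combo_mem_interior_hull hx hy hn0.le (hu1 n)) _)
  have hmU : ∀ f : E d → ℝ, Continuous f → MemLp f ⊤ (volume.restrict U) :=
    fun f hf => memLp_hull K hf.continuousOn
  have limU : ∀ j, ∀ g : E d → ℝ, MemLp g 2 (volume.restrict U) →
      Tendsto (fun n => ∫ x in U, A n j x * g x) atTop (𝓝 (∫ x in U, a x j * g x)) := by
    intro j g hg
    refine tendsto_integral_mul (fun n => memLp_hull K (hA n j).continuous.continuousOn)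
      (memLp_hull K (continuousOn_coord ha j)) hg (tendsto_eLpNorm_of_uniform fun ε hε => ?_)
    filter_upwards [hunif j ε hε] with n hn
    filter_upwards [ae_restrict_mem hUm] with x hx using hn x (interior_subset hx)
  have limF : ∀ i j, ∀ g : E d → ℝ, MemLp g 2 (facetMeasure K i) →
      Tendsto (fun n => ∫ x, A n j x * g x ∂facetMeasure K i) atTop
        (𝓝 (∫ x, a x j * g x ∂facetMeasure K i)) := by
    intro i j g hg
    refine tendsto_integral_mul (fun n => memLp_facet K i (hA n j).continuous.continuousOn)
      (memLp_facet K i ((continuousOn_coord ha j).mono (facet_subset_hull K i))) hg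
      (tendsto_eLpNorm_of_uniform fun ε hε => ?_)
    filter_upwards [hunif j ε hε] with n hn
    filter_upwards [ae_mem_facet K i] with x hx using hn x (facet_subset_hull K i hx)
  have hwd : ∀ j, MemLp (fun x => w x * partialDeriv j ψ x) 2 (volume.restrict U) := fun j =>
    (hmU _ (contDiff_partialDeriv hψ j).continuous).mul hw.memLp
  have hpψ : ∀ j, MemLp (fun x => weakPartial U j w x * ψ x) 2 (volume.restrict U) := fun j =>
    (hmU _ hψc).mul (hw.memSobolev_weakPartial isOpen_interior j).memLp
  have htr : ∀ i j, MemLp (fun x => trace K w x * (ψ x * normal K i j)) 2 (facetMeasure K i) :=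
    fun i j => MemLp.mul (p := 2) (q := ⊤)
      (memLp_facet K i (hψc.mul continuous_const).continuousOn) (memLp_trace_facet hw i)
  have l1 := tendsto_finsetSum Finset.univ fun j _ => limU j _ (hwd j)
  have l2 := tendsto_finsetSum Finset.univ fun j _ => limU j _ (hpψ j)
  have l3 := tendsto_finsetSum Finset.univ fun i _ =>
    tendsto_finsetSum Finset.univ fun j _ => limF i j _ (htr i j)
  refine tendsto_nhds_unique_of_eventuallyEq l1 (l3.sub l2) ?_
  filter_upwards [hu.eventually (lt_mem_nhds zero_lt_one)] with n hn
  have hgreen := fun j => integral_mul_partialDeriv hw ((hA n j).mul hψ) j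
  have hwA : ∀ j, Integrable (fun x => w x * (partialDeriv j (A n j) x * ψ x))
      (volume.restrict U) := fun j =>
    MemLp.integrable_mul (q := 2) hw.memLp (memLp_hull K
      ((contDiff_partialDeriv (hA n j) j).continuous.mul hψc).continuousOn)
  have hAw : ∀ j, Integrable (fun x => A n j x * (w x * partialDeriv j ψ x))
      (volume.restrict U) := fun j =>
    MemLp.integrable_mul (p := 2) (memLp_hull K (hA n j).continuous.continuousOn) (hwd j)
  -- The terms in which the derivative hits the regularised field add up to its divergence. They
  -- vanish before the limit is taken, so convergence of derivatives of the field is not needed.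
  have hzero : ∑ j, ∫ x in U, w x * (partialDeriv j (A n j) x * ψ x) = 0 := by
    rw [← integral_finsetSum _ fun j _ => hwA j]
    refine (setIntegral_congr_fun hUm fun x hx => ?_).trans (integral_zero _ _)
    have := sum_partialDeriv_regularize_eq_zero hη hn.le (hu1 n) ha hdiv (interior_subset hx)
    simp only [← Finset.mul_sum, ← Finset.sum_mul]
    rw [this]
    ring
  have hsplit : ∀ j, ∫ x in U, w x * partialDeriv j (fun x => A n j x * ψ x) x =
      (∫ x in U, w x * (partialDeriv j (A n j) x * ψ x))
        + ∫ x in U, A n j x * (w x * partialDeriv j ψ x) := by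
    intro j
    rw [← integral_add (hwA j) (hAw j)]
    refine integral_congr_ae (ae_of_all _ fun x => ?_)
    simp only [partialDeriv_mul (hA n j) hψ]
    ring
  have hsum : ∑ j, ∫ x in U, w x * partialDeriv j (fun x => A n j x * ψ x) x =
      ∑ j, ∫ x in U, A n j x * (w x * partialDeriv j ψ x) := by
    simp_rw [hsplit, Finset.sum_add_distrib, hzero, zero_add]
  refine (hsum.symm.trans (Finset.sum_congr rfl fun j _ => hgreen j)).trans ?_
  rw [Finset.sum_sub_distrib, Finset.sum_comm]
  congr 1
  · refine Finset.sum_congr rfl fun i _ => Finset.sum_congr rfl fun j _ => ?_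
    refine integral_congr_ae (ae_of_all _ fun x => ?_)
    ring
  · refine Finset.sum_congr rfl fun j _ => ?_
    refine integral_congr_ae (ae_of_all _ fun x => ?_)
    ring

end Trace

/-! ### Simplices with a common facet -/

section CommonFacet

variable {d : ℕ} {K K' : Affine.Simplex ℝ (E d) d} {i i' : Fin (d + 1)}

lemma facet_congr (h : K.points '' {i}ᶜ = K'.points '' {i'}ᶜ) : facet K i = facet K' i' := by
  rw [facet, facet, h]

lemma facetMeasure_congr (h : K.points '' {i}ᶜ = K'.points '' {i'}ᶜ) :
    facetMeasure K i = facetMeasure K' i' := by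
  rw [facetMeasure, facetMeasure, facet_congr h]

/-- Both coordinates are affine and vanish on the common facet, hence are proportional; the value at
the vertex `i`, where `bary K i` is 1, is the factor. -/
lemma bary_eq_mul_bary (h : K.points '' {i}ᶜ = K'.points '' {i'}ᶜ) (x : E d) :
    bary K' i' x = bary K' i' (K.points i) * bary K i x := by
  rw [affineMap_eq_sum_bary K (bary K' i') x, Finset.sum_eq_single i, mul_comm]
  · intro k _ hk
    obtain ⟨k', hk', hkk'⟩ : K.points k ∈ K'.points '' {i'}ᶜ := h ▸ ⟨k, hk, rfl⟩
    rw [← hkk', bary_ne K' (fun h' => hk' h'.symm), mul_zero]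
  · simp

lemma bary_pos_of_common_facet (h : K.points '' {i}ᶜ = K'.points '' {i'}ᶜ) {x : E d}
    (h0 : bary K i x = 0) (hx : ∀ k ≠ i, 0 < bary K k x) {k' : Fin (d + 1)} (hk' : k' ≠ i') :
    0 < bary K' k' x := by
  obtain ⟨k, hk, hkk'⟩ : K'.points k' ∈ K.points '' {i}ᶜ := h ▸ ⟨k', hk', rfl⟩
  rw [affineMap_eq_sum_bary K (bary K' k') x]
  refine Finset.sum_pos' (fun l _ => ?_) ⟨k, Finset.mem_univ k, ?_⟩
  · rcases eq_or_ne l i with rfl | hl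
    · rw [h0, zero_mul]
    · obtain ⟨l', -, hll'⟩ : K.points l ∈ K'.points '' {i'}ᶜ := h ▸ ⟨l, hl, rfl⟩
      rw [← hll', bary_vertex]
      have := (hx l hl).le
      split_ifs <;> simp [this]
  · rw [hkk', bary_self, mul_one]
    exact hx k hk

/-- The barycentre of the facet, with weight 1/d at each of its `d` vertices, is such a point. -/
lemma exists_relative_interior [NeZero d] (K : Affine.Simplex ℝ (E d) d) (i : Fin (d + 1)) :
    ∃ m, bary K i m = 0 ∧ ∀ k ≠ i, 0 < bary K k m := by
  have hd : (0 : ℝ) < d := Nat.cast_pos.2 (NeZero.pos d)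
  let w : Fin (d + 1) → ℝ := fun k => if k = i then 0 else (d : ℝ)⁻¹
  have hw : ∑ k, w k = 1 := by
    have h1 : ∀ k, w k = (d : ℝ)⁻¹ - if k = i then (d : ℝ)⁻¹ else 0 := fun k => by
      simp only [w]; split_ifs <;> simp
    simp_rw [h1, Finset.sum_sub_distrib]
    simp only [Finset.sum_const, Finset.card_univ, Fintype.card_fin, Finset.sum_ite_eq',
      Finset.mem_univ, if_true, nsmul_eq_mul, Nat.cast_add, Nat.cast_one]
    field_simp
    ring
  have hb : ∀ k, bary K k (∑ l, w l • K.points l) = w k := fun k => by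
    have h2 : ∀ x, bary K k x = bary K k 0 + (bary K k).linear x := fun x => by
      simpa using affineMap_add_smul (bary K k) 0 x 1
    have h3 : ∀ l, w l * bary K k (K.points l) = w l * bary K k 0 +
        w l * (bary K k).linear (K.points l) := fun l => by rw [h2 (K.points l)]; ring
    have h4 : ∑ l, w l * bary K k (K.points l) = w k := by simp [bary_vertex]
    rw [← h4, h2]
    simp_rw [h3, Finset.sum_add_distrib, ← Finset.sum_mul, hw]
    simp
  refine ⟨∑ l, w l • K.points l, by rw [hb]; simp [w], fun k hk => ?_⟩
  rw [hb]
  simpa [w, hk] using hd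

lemma mem_facet_of_bary {x : E d} (h0 : bary K i x = 0) (hx : ∀ k ≠ i, 0 < bary K k x) :
    x ∈ facet K i := by
  refine mem_facet.2 ⟨mem_hull.2 fun k => ?_, h0⟩
  rcases eq_or_ne k i with rfl | hk
  · exact h0.ge
  · exact (hx k hk).le

/-- Two non-overlapping simplices with a common facet lie on different sides of it. -/
lemma bary_vertex_neg [NeZero d] (h : K.points '' {i}ᶜ = K'.points '' {i'}ᶜ)
    (hdisj : Disjoint (interior (hull K)) (interior (hull K'))) :
    bary K' i' (K.points i) < 0 := by
  set s := bary K' i' (K.points i) with hs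
  have hb := bary_eq_mul_bary h
  rw [← hs] at hb
  by_contra! hs0
  rcases hs0.eq_or_lt with hs0 | hs0
  · have := hb (K'.points i')
    rw [bary_self, ← hs0, zero_mul] at this
    exact one_ne_zero this
  -- If both simplices were on the same side, a relatively interior point of the facet, moved
  -- slightly towards the vertex `i`, would lie in both interiors.
  · obtain ⟨m, hm0, hm⟩ := exists_relative_interior K i
    have hopen : IsOpen {x | ∀ k, k ≠ i' → 0 < bary K' k x} := by
      simp only [Set.ofPred_forall]
      exact isOpen_iInter_of_finite fun k => isOpen_iInter_of_finite fun _ =>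
        isOpen_lt continuous_const (continuous_bary K' k)
    have hlim : Tendsto (fun ε : ℝ => m + ε • (K.points i - m)) (𝓝[>] 0) (𝓝 m) := by
      have : Tendsto (fun ε : ℝ => m + ε • (K.points i - m)) (𝓝 0)
          (𝓝 (m + (0 : ℝ) • (K.points i - m))) := Continuous.tendsto (by fun_prop) 0
      rw [zero_smul, add_zero] at this
      exact this.mono_left nhdsWithin_le_nhds
    have hlim' : ∀ᶠ ε : ℝ in 𝓝[>] 0, ∀ k, k ≠ i' → 0 < bary K' k (m + ε • (K.points i - m)) :=
      hlim (hopen.mem_nhds fun k hk => bary_pos_of_common_facet h hm0 hm hk)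
    obtain ⟨ε, hε, hε0, hε1⟩ := (hlim'.and (Ioo_mem_nhdsGT (zero_lt_one' ℝ))).exists
    set x := m + ε • (K.points i - m) with hx
    have hbx : ∀ k, bary K k x = (1 - ε) * bary K k m + ε * bary K k (K.points i) := fun k => by
      rw [hx, affineMap_add_smul, affineMap_linear_sub]; ring
    have hbi : 0 < bary K i x := by
      rw [hbx, hm0, bary_self]; linarith
    have hx1 : x ∈ interior (hull K) := by
      refine mem_interior_hull.2 fun k => ?_
      rcases eq_or_ne k i with rfl | hk
      · exact hbi
      · rw [hbx, bary_ne K hk, mul_zero, add_zero]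
        exact mul_pos (by linarith) (hm k hk)
    have hx2 : x ∈ interior (hull K') := by
      refine mem_interior_hull.2 fun k => ?_
      rcases eq_or_ne k i' with rfl | hk
      · rw [hb]
        exact mul_pos hs0 hbi
      · exact hε k hk
    exact Set.disjoint_left.1 hdisj hx1 hx2

/-- The gradients of the two coordinates of the common facet differ by a negative factor, by
`bary_vertex_neg`; so do the normals, and since these have unit length the factor is -1. -/
lemma normal_eq_neg [NeZero d] (h : K.points '' {i}ᶜ = K'.points '' {i'}ᶜ)
    (hdisj : Disjoint (interior (hull K)) (interior (hull K'))) :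
    normal K' i' = -normal K i := by
  have hs := bary_vertex_neg h hdisj
  set s := bary K' i' (K.points i)
  obtain ⟨c, hc, hcl⟩ := exists_linear_bary K i
  obtain ⟨c', hc', hcl'⟩ := exists_linear_bary K' i'
  have hvec : normal K' i' = (s * c / c') • normal K i := by
    refine ext_inner_right ℝ fun v => ?_
    have h1 : (bary K' i').linear v = s * (bary K i).linear v := by
      have h2 := affineMap_linear_sub (bary K' i') v 0
      have h3 := affineMap_linear_sub (bary K i) v 0
      rw [sub_zero] at h2 h3
      rw [h2, h3, bary_eq_mul_bary h v, bary_eq_mul_bary h 0]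
      ring
    rw [hcl, hcl'] at h1
    rw [real_inner_smul_left]
    field_simp
    linarith
  have hneg : s * c / c' < 0 := div_neg_of_neg_of_pos (mul_neg_of_neg_of_pos hs hc) hc'
  have hnorm := congrArg norm hvec
  rw [norm_smul, normal_norm, normal_norm, mul_one, Real.norm_of_nonpos hneg.le] at hnorm
  rw [hvec, show s * c / c' = -1 by linarith, neg_one_smul]

/-- A neighbourhood of the relative interior of a common facet that is covered by the two
simplices. -/
def facetPatch (K K' : Affine.Simplex ℝ (E d) d) (i i' : Fin (d + 1)) : Set (E d) :=
  {x | (∀ k, k ≠ i → 0 < bary K k x) ∧ ∀ k, k ≠ i' → 0 < bary K' k x}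

lemma isOpen_facetPatch : IsOpen (facetPatch K K' i i') := by
  have : ∀ (L : Affine.Simplex ℝ (E d) d) (j : Fin (d + 1)),
      IsOpen {x | ∀ k, k ≠ j → 0 < bary L k x} := fun L j => by
    simp only [Set.ofPred_forall]
    exact isOpen_iInter_of_finite fun k => isOpen_iInter_of_finite fun _ =>
      isOpen_lt continuous_const (continuous_bary L k)
  exact (this K i).inter (this K' i')

/-- The two coordinates belonging to the common facet have opposite signs, so the sign of `bary K i
x` decides which of the simplices contains the point. -/
lemma facetPatch_subset [NeZero d] (h : K.points '' {i}ᶜ = K'.points '' {i'}ᶜ)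
    (hdisj : Disjoint (interior (hull K)) (interior (hull K'))) :
    facetPatch K K' i i' ⊆ hull K ∪ hull K' := by
  rintro x ⟨h1, h2⟩
  rcases le_or_gt 0 (bary K i x) with h0 | h0
  · refine Or.inl (mem_hull.2 fun k => ?_)
    rcases eq_or_ne k i with rfl | hk
    · exact h0
    · exact (h1 k hk).le
  · refine Or.inr (mem_hull.2 fun k => ?_)
    rcases eq_or_ne k i' with rfl | hk
    · rw [bary_eq_mul_bary h]
      exact (mul_pos_of_neg_of_neg (bary_vertex_neg h hdisj) h0).le
    · exact (h2 k hk).le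

/-- The points of a facet at which another coordinate vanishes form faces of codimension at least
two, which are null sets. -/
lemma ae_facet_bary_pos [NeZero d] (K : Affine.Simplex ℝ (E d) d) (i : Fin (d + 1)) :
    ∀ᵐ x ∂facetMeasure K i, bary K i x = 0 ∧ ∀ k ≠ i, 0 < bary K k x := by
  have h1 : ∀ᵐ x ∂facetMeasure K i, ∀ k, k ≠ i → bary K k x ≠ 0 := by
    rw [ae_all_iff]
    intro k
    by_cases hk : k = i
    · exact ae_of_all _ fun x h => absurd hk h
    · filter_upwards [measure_eq_zero_iff_ae_notMem.1 (facetMeasure_bary_eq_zero K (Ne.symm hk))]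
        with x hx _ using hx
  filter_upwards [h1, ae_mem_facet K i] with x hx hxF
  obtain ⟨h2, h3⟩ := mem_facet.1 hxF
  exact ⟨h3, fun k hk => lt_of_le_of_ne (mem_hull.1 h2 k) (hx k hk).symm⟩

lemma mem_facetPatch (h : K.points '' {i}ᶜ = K'.points '' {i'}ᶜ) {x : E d}
    (h0 : bary K i x = 0) (hx : ∀ k ≠ i, 0 < bary K k x) : x ∈ facetPatch K K' i i' :=
  ⟨hx, fun _ hk => bary_pos_of_common_facet h h0 hx hk⟩

/-- A simplex that has all vertices of a facet of another simplex among its vertices has this facet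
in common with it. -/
lemma exists_common_facet (h : ∀ k ≠ i, K.points k ∈ Set.range K'.points) :
    ∃ i', K.points '' {i}ᶜ = K'.points '' {i'}ᶜ := by
  set A := K.points '' {i}ᶜ with hA
  have hAsub : A ⊆ Set.range K'.points := by
    rintro _ ⟨k, hk, rfl⟩
    exact h k hk
  have hB : K'.points '' (K'.points ⁻¹' A) = A := Set.image_preimage_eq_of_subset hAsub
  -- A facet has `d` vertices, so exactly one of the `d + 1` vertices of the other simplex is left
  -- over; it is the one opposite to the facet.
  have hcard : (K'.points ⁻¹' A).ncard = d := by
    rw [← Set.ncard_image_of_injective _ K'.independent.injective, hB, hA,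
      Set.ncard_image_of_injective _ K.independent.injective, Set.ncard_compl]
    simp
  have hcompl : ((K'.points ⁻¹' A)ᶜ).ncard = 1 := by
    rw [Set.ncard_compl, hcard]
    simp
  obtain ⟨i', hi'⟩ := Set.ncard_eq_one.1 hcompl
  exact ⟨i', by rw [← hi', compl_compl, hB]⟩

end CommonFacet

/-! ### Facets of a triangulation -/

namespace Triangulation

section Facets

variable {d : ℕ} {Ω : Set (E d)} {ι : Type*} (T : Triangulation Ω ι)

/-- `p` and `q` are the same facet, seen from two different cells. -/
def Adj (p q : ι × Fin (d + 1)) : Prop :=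
  p.1 ≠ q.1 ∧ (T.cell p.1).points '' {p.2}ᶜ = (T.cell q.1).points '' {q.2}ᶜ

variable {T} {p q r : ι × Fin (d + 1)}

lemma Adj.symm (h : T.Adj p q) : T.Adj q p := ⟨h.1.symm, h.2.symm⟩

lemma Adj.facetMeasure_eq (h : T.Adj p q) :
    facetMeasure (T.cell p.1) p.2 = facetMeasure (T.cell q.1) q.2 :=
  facetMeasure_congr h.2

lemma Adj.normal_eq [NeZero d] (h : T.Adj p q) :
    normal (T.cell q.1) q.2 = -normal (T.cell p.1) p.2 :=
  normal_eq_neg h.2 (T.nonoverlapping _ _ h.1)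

/-- Three different cells at one facet would lie pairwise on opposite sides of it, yet the product
of two negative proportionality factors is positive. -/
lemma Adj.unique [NeZero d] (h : T.Adj p q) (h' : T.Adj p r) : q = r := by
  have hqr : (T.cell q.1).points '' {q.2}ᶜ = (T.cell r.1).points '' {r.2}ᶜ := h.2.symm.trans h'.2
  by_cases h1 : q.1 = r.1
  · refine Prod.ext h1 ?_
    rw [h1] at hqr
    have := (T.cell r.1).independent.injective.image_injective hqr
    simpa using this
  · exfalso
    have s1 := bary_vertex_neg h.2 (T.nonoverlapping _ _ h.1)
    have s2 := bary_vertex_neg h'.2 (T.nonoverlapping _ _ h'.1)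
    have s3 := bary_vertex_neg hqr (T.nonoverlapping _ _ h1)
    have h4 := bary_eq_mul_bary hqr ((T.cell p.1).points p.2)
    nlinarith [mul_pos_of_neg_of_neg s3 s1]

variable (T)

lemma isOpen_domain (T : Triangulation Ω ι) : IsOpen Ω := by
  have h := T.domain_eq
  rw [h]
  exact isOpen_interior

lemma cellInt_subset (K : ι) : T.cellInt K ⊆ Ω := by
  conv_rhs => rw [T.domain_eq]
  exact interior_mono (Set.subset_iUnion (fun K => hull (T.cell K)) K)

lemma hull_subset_closure (K : ι) : hull (T.cell K) ⊆ closure Ω := by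
  rw [← closure_interior_hull]
  exact closure_mono (T.cellInt_subset K)

lemma domain_subset : Ω ⊆ ⋃ K, hull (T.cell K) := by
  conv_lhs => rw [T.domain_eq]
  exact interior_subset

/-- The patch is open and covered by two cells, and Ω is the interior of the union of all cells. -/
lemma Adj.facetPatch_subset [NeZero d] {T : Triangulation Ω ι} (h : T.Adj p q) :
    facetPatch (T.cell p.1) (T.cell q.1) p.2 q.2 ⊆ Ω := by
  conv_rhs => rw [T.domain_eq]
  refine interior_maximal ?_ isOpen_facetPatch
  refine (InterfaceFEM.facetPatch_subset h.2 (T.nonoverlapping _ _ h.1)).trans ?_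
  exact Set.union_subset (Set.subset_iUnion (fun K => hull (T.cell K)) _)
    (Set.subset_iUnion (fun K => hull (T.cell K)) _)

lemma Adj.not_isBdryFacet [NeZero d] {T : Triangulation Ω ι} (h : T.Adj p q) :
    ¬ T.IsBdryFacet p.1 p.2 := by
  intro hb
  obtain ⟨m, hm0, hm⟩ := exists_relative_interior (T.cell p.1) p.2
  have h1 := hb (mem_facet_of_bary hm0 hm)
  rw [T.isOpen_domain.frontier_eq] at h1
  exact h1.2 (h.facetPatch_subset (mem_facetPatch h.2 hm0 hm))

/-- A cell that contains a point in the relative interior of a facet of another cell has this facet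
in common with it. -/
lemma exists_adj_of_mem {K K' : ι} (hK : K ≠ K') {i : Fin (d + 1)} {y : E d}
    (h0 : bary (T.cell K) i y = 0) (hy : ∀ k ≠ i, 0 < bary (T.cell K) k y)
    (hyK' : y ∈ hull (T.cell K')) : ∃ i', T.Adj (K, i) (K', i') := by
  have hmem : y ∈ hull (T.cell K) ∩ hull (T.cell K') :=
    ⟨(mem_facet.1 (mem_facet_of_bary h0 hy)).1, hyK'⟩
  rw [T.conforming K K' hK] at hmem
  have hset : Set.range (T.cell K).points ∩ Set.range (T.cell K').points =
      (T.cell K).points '' {k | (T.cell K).points k ∈ Set.range (T.cell K').points} := by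
    ext x
    constructor
    · rintro ⟨⟨k, rfl⟩, hx⟩
      exact ⟨k, hx, rfl⟩
    · rintro ⟨k, hk, rfl⟩
      exact ⟨⟨k, rfl⟩, hk⟩
  -- By conformity the point lies in the hull of the shared vertices, where the coordinates of all
  -- other vertices vanish. Its coordinates except the `i`-th are positive, so all vertices of the
  -- facet are shared.
  rw [hset, mem_convexHull_image] at hmem
  obtain ⟨i', hi'⟩ := exists_common_facet (K := T.cell K) (K' := T.cell K') (i := i) fun k hk => by
    by_contra hk'
    exact (hy k hk).ne' (hmem.2 k hk')
  exact ⟨i', hK, hi'⟩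

/-- A facet not contained in Γ has a point in Ω, and by openness even a relatively interior one. If
no other cell contained this point, a neighbourhood of it would be covered by `K` alone, and the
point would be interior to `K`, although one of its coordinates is zero. -/
lemma exists_adj [NeZero d] [Finite ι] {K : ι} {i : Fin (d + 1)} (h : ¬ T.IsBdryFacet K i) :
    ∃ q, T.Adj (K, i) q := by
  obtain ⟨x, hx, hxΩ⟩ := Set.not_subset.1 h
  rw [T.isOpen_domain.frontier_eq] at hxΩ
  have hxΩ' : x ∈ Ω := by
    by_contra h'
    exact hxΩ ⟨T.hull_subset_closure K (facet_subset_hull _ _ hx), h'⟩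
  obtain ⟨m, hm0, hm⟩ := exists_relative_interior (T.cell K) i
  have hlim : Tendsto (fun ε : ℝ => x + ε • (m - x)) (𝓝[>] 0) (𝓝 x) := by
    have : Tendsto (fun ε : ℝ => x + ε • (m - x)) (𝓝 0) (𝓝 (x + (0 : ℝ) • (m - x))) :=
      Continuous.tendsto (by fun_prop) 0
    rw [zero_smul, add_zero] at this
    exact this.mono_left nhdsWithin_le_nhds
  obtain ⟨ε, hε, hε0, hε1⟩ := ((hlim.eventually (T.isOpen_domain.mem_nhds hxΩ')).and
    (Ioo_mem_nhdsGT (zero_lt_one' ℝ))).exists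
  set y := x + ε • (m - x) with hy
  obtain ⟨hx1, hx2⟩ := mem_facet.1 hx
  have hby : ∀ k, bary (T.cell K) k y =
      (1 - ε) * bary (T.cell K) k x + ε * bary (T.cell K) k m := fun k => by
    rw [hy, affineMap_add_smul, affineMap_linear_sub]; ring
  have hy0 : bary (T.cell K) i y = 0 := by rw [hby, hx2, hm0]; ring
  have hypos : ∀ k ≠ i, 0 < bary (T.cell K) k y := fun k hk => by
    rw [hby]
    exact add_pos_of_nonneg_of_pos (mul_nonneg (by linarith) (mem_hull.1 hx1 k))
      (mul_pos hε0 (hm k hk))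
  by_contra! hno
  have hopen : IsOpen (Ω ∩ ⋂ K', ⋂ _ : K ≠ K', (hull (T.cell K'))ᶜ) :=
    T.isOpen_domain.inter (isOpen_iInter_of_finite fun K' => isOpen_iInter_of_finite fun _ =>
      (isCompact_hull _).isClosed.isOpen_compl)
  have hsub : Ω ∩ ⋂ K', ⋂ _ : K ≠ K', (hull (T.cell K'))ᶜ ⊆ hull (T.cell K) := by
    rintro z ⟨hz, hz'⟩
    obtain ⟨K', hK'⟩ := Set.mem_iUnion.1 (T.domain_subset hz)
    by_cases hKK' : K = K'
    · exact hKK' ▸ hK'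
    · exact absurd hK' (Set.mem_iInter₂.1 hz' K' hKK')
  have hyint : y ∈ interior (hull (T.cell K)) := by
    refine interior_maximal hsub hopen ⟨hε, Set.mem_iInter₂.2 fun K' hKK' hyK' => ?_⟩
    obtain ⟨i', hi'⟩ := T.exists_adj_of_mem hKK' hy0 hypos hyK'
    exact hno _ hi'
  exact (mem_interior_hull.1 hyint i).ne' hy0

/-- An open set that meets a closed cell meets its interior, but the patch is covered by two other
cells and the cells do not overlap. -/
lemma disjoint_facetPatch_hull [NeZero d] {T : Triangulation Ω ι} (h : T.Adj p q) {K : ι}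
    (h1 : K ≠ p.1) (h2 : K ≠ q.1) :
    Disjoint (facetPatch (T.cell p.1) (T.cell q.1) p.2 q.2) (hull (T.cell K)) := by
  rw [← closure_interior_hull (T.cell K)]
  refine Disjoint.closure_right ?_ isOpen_facetPatch
  refine Set.disjoint_of_subset_left
    (InterfaceFEM.facetPatch_subset h.2 (T.nonoverlapping _ _ h.1)) ?_
  rw [Set.disjoint_union_left]
  have : ∀ L, K ≠ L → Disjoint (hull (T.cell L)) (interior (hull (T.cell K))) := fun L hL => by
    rw [← closure_interior_hull (T.cell L)]
    exact ((T.nonoverlapping L K hL.symm)).closure_left isOpen_interior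
  exact ⟨this _ h1, this _ h2⟩

/-- An integral over the domain is the sum of the integrals over the cells. -/
lemma setIntegral_domain [Fintype ι] {f : E d → ℝ}
    (hf : ∀ K, IntegrableOn f (T.cellInt K)) :
    ∫ x in Ω, f x = ∑ K, ∫ x in T.cellInt K, f x := by
  have hae : Ω =ᵐ[volume] (⋃ K, T.cellInt K : Set (E d)) := by
    refine LE.le.eventuallyLE (T.domain_subset) |>.trans ?_ |>.antisymm
      (LE.le.eventuallyLE (Set.iUnion_subset T.cellInt_subset))
    exact (Filter.EventuallyEq.countable_iUnion fun K => (interior_ae_eq_of_null_frontier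
      ((convex_hull (T.cell K)).addHaar_frontier volume)).symm).le
  rw [setIntegral_congr_set hae]
  exact integral_iUnion_fintype (fun K => isOpen_interior.measurableSet)
    (fun K K' h => T.nonoverlapping K K' h) hf

end Facets

end Triangulation

/-! ### Traces on the mesh -/

namespace Triangulation

section Traces

variable {d : ℕ} [NeZero d] {Ω : Set (E d)} {ι : Type*} {T : Triangulation Ω ι}
  {p q : ι × Fin (d + 1)} {u : E d → ℝ}

omit [NeZero d] in
lemma memSobolev_cell {m : ℕ} (T : Triangulation Ω ι) (hu : MemSobolev m Ω u) (K : ι) :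
    MemSobolev m (interior (hull (T.cell K))) u :=
  hu.mono (T.cellInt_subset K) T.isOpen_domain.measurableSet

omit [NeZero d] in
lemma weakPartial_cell {m : ℕ} (T : Triangulation Ω ι) (hu : MemSobolev (m + 1) Ω u) (K : ι)
    (j : Fin d) :
    weakPartial (interior (hull (T.cell K))) j u
      =ᵐ[volume.restrict (interior (hull (T.cell K)))] weakPartial Ω j u :=
  hu.weakPartial_mono T.isOpen_domain isOpen_interior (T.cellInt_subset K) j

variable [Fintype ι]

/-- The jumps of the traces of a function in `H¹(Ω)` over the facets in `Ω` cancel. -/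
lemma sum_integral_trace_mul_normal (hu : MemSobolev 1 Ω u) {φ : E d → ℝ}
    (hφ : IsTestFunction Ω φ) (j : Fin d) :
    ∑ K, ∑ i, ∫ x, trace (T.cell K) u x * (φ x * normal (T.cell K) i j)
      ∂facetMeasure (T.cell K) i = 0 := by
  -- The weak derivative on Ω gives an integration by parts without boundary terms. Comparing it
  -- with the sum of Green's formulas on the cells leaves exactly the facet integrals.
  have hw := hu.isWeakPartial j
  have h1 := hw.2.2 φ hφ
  rw [T.setIntegral_domain fun K => (integrableOn_mul_test hw.1
      (hφ.partialDeriv j)).mono_set (T.cellInt_subset K),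
    T.setIntegral_domain fun K => (integrableOn_mul_test hw.2.1 hφ).mono_set
      (T.cellInt_subset K)] at h1
  have h2 : ∀ K, ∑ i, ∫ x, trace (T.cell K) u x * (φ x * normal (T.cell K) i j)
      ∂facetMeasure (T.cell K) i = (∫ x in T.cellInt K, u x * partialDeriv j φ x)
        + ∫ x in T.cellInt K, weakPartial Ω j u x * φ x := fun K => by
    have h3 := integral_mul_partialDeriv (T.memSobolev_cell hu K) hφ.1 j
    have h4 : ∫ x in T.cellInt K, weakPartial Ω j u x * φ x =
        ∫ x in interior (hull (T.cell K)),
          weakPartial (interior (hull (T.cell K))) j u x * φ x :=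
      integral_congr_ae ((T.weakPartial_cell hu K j).mono fun x hx => by simp only [hx])
    rw [h4]
    have h5 : ∫ x in T.cellInt K, u x * partialDeriv j φ x =
      ∫ x in interior (hull (T.cell K)), u x * partialDeriv j φ x := rfl
    linarith
  simp_rw [h2, Finset.sum_add_distrib]
  linarith

/-- A test function supported in the patch vanishes on all facets except the common one. Two terms
of the cancelling sum remain, with opposite normals; a nonzero component of the normal can be
divided out. -/
lemma Adj.integral_trace_eq (h : T.Adj p q) (hu : MemSobolev 1 Ω u) {φ : E d → ℝ}
    (hφ : IsTestFunction (facetPatch (T.cell p.1) (T.cell q.1) p.2 q.2) φ) :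
    ∫ x, trace (T.cell p.1) u x * φ x ∂facetMeasure (T.cell p.1) p.2 =
      ∫ x, trace (T.cell q.1) u x * φ x ∂facetMeasure (T.cell p.1) p.2 := by
  obtain ⟨j, hj⟩ : ∃ j, normal (T.cell p.1) p.2 j ≠ 0 := by
    by_contra! hn
    have : normal (T.cell p.1) p.2 = 0 := by ext j; exact hn j
    have h1 := normal_norm (T.cell p.1) p.2
    rw [this, norm_zero] at h1
    exact zero_ne_one h1
  have hsum := sum_integral_trace_mul_normal (T := T) hu (hφ.mono h.facetPatch_subset) j
  rw [← Fintype.sum_prod_type' (f := fun K i => ∫ x, trace (T.cell K) u x *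
    (φ x * normal (T.cell K) i j) ∂facetMeasure (T.cell K) i),
    Fintype.sum_eq_add p q (fun hpq => h.1 (congrArg Prod.fst hpq))] at hsum
  · simp only [← h.facetMeasure_eq, h.normal_eq, ← mul_assoc, integral_mul_const,
      PiLp.neg_apply, mul_neg, integral_neg, ← sub_eq_add_neg, ← sub_mul] at hsum
    exact sub_eq_zero.1 ((mul_eq_zero.1 hsum).resolve_right hj)
  · rintro ⟨K, i⟩ ⟨h1, h2⟩
    refine (integral_congr_ae ?_).trans (integral_zero _ _)
    filter_upwards [ae_mem_facet (T.cell K) i] with x hx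
    have : φ x = 0 := hφ.eq_zero fun hxP => by
      by_cases hKp : K = p.1
      · subst hKp
        have hi : i ≠ p.2 := fun hi => h1 (Prod.ext rfl hi)
        exact (hxP.1 i hi).ne' (mem_facet.1 hx).2
      by_cases hKq : K = q.1
      · subst hKq
        have hi : i ≠ q.2 := fun hi => h2 (Prod.ext rfl hi)
        exact (hxP.2 i hi).ne' (mem_facet.1 hx).2
      exact Set.disjoint_left.1 (disjoint_facetPatch_hull h hKp hKq) hxP
        (facet_subset_hull _ _ hx)
    simp [this]

/-- The traces of a function in `H¹(Ω)` from both sides of a facet agree. -/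
lemma Adj.trace_ae_eq (h : T.Adj p q) (hu : MemSobolev 1 Ω u) :
    trace (T.cell p.1) u =ᵐ[facetMeasure (T.cell p.1) p.2] trace (T.cell q.1) u := by
  have hp := memLp_trace_facet (T.memSobolev_cell hu p.1) p.2
  have hq := memLp_trace_facet (T.memSobolev_cell hu q.1) q.2
  rw [← h.facetMeasure_eq] at hq
  have hint := (hp.sub hq).integrable (by norm_num)
  -- The fundamental lemma of the calculus of variations, for the surface measure on the facet.
  have h0 := isOpen_facetPatch.ae_eq_zero_of_integral_contDiff_smul_eq_zero
    (μ := facetMeasure (T.cell p.1) p.2) (U := facetPatch (T.cell p.1) (T.cell q.1) p.2 q.2)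
    (hint.locallyIntegrable.locallyIntegrableOn _) fun φ h1 h2 h3 => by
      have hφ : IsTestFunction (facetPatch (T.cell p.1) (T.cell q.1) p.2 q.2) φ := ⟨h1, h2, h3⟩
      have hm : MemLp φ 2 (facetMeasure (T.cell p.1) p.2) :=
        memLp_facet _ _ h1.continuous.continuousOn
      have h4 := integral_sub (hp.integrable_mul hm) (hq.integrable_mul hm)
      simp only [Pi.mul_apply] at h4
      rw [h.integral_trace_eq hu hφ, sub_self] at h4
      rw [← h4]
      refine integral_congr_ae (ae_of_all _ fun x => ?_)
      simp only [Pi.sub_apply, smul_eq_mul]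
      ring
  filter_upwards [h0, ae_facet_bary_pos (T.cell p.1) p.2] with x hx hx'
  exact sub_eq_zero.1 (hx (mem_facetPatch h.2 hx'.1 hx'.2))

/-- Almost every point of a facet is relatively interior to it, so any other cell containing the
point has the facet in common and hence the same trace there. -/
lemma ae_trace_eq (T : Triangulation Ω ι) (hu : MemSobolev 1 Ω u) (K : ι) :
    ∀ᵐ x ∂bdryMeasure (T.cell K), ∀ K', x ∈ hull (T.cell K') →
      trace (T.cell K') u x = trace (T.cell K) u x := by
  rw [ae_bdryMeasure_iff]
  intro i
  rw [ae_all_iff]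
  intro K'
  by_cases hK : K = K'
  · subst hK
    exact ae_of_all _ fun _ _ => rfl
  by_cases hex : ∃ i', T.Adj (K, i) (K', i')
  · obtain ⟨i', hi'⟩ := hex
    filter_upwards [hi'.trace_ae_eq hu] with x hx _ using hx.symm
  · filter_upwards [ae_facet_bary_pos (T.cell K) i] with x hx hxK'
    exact absurd (T.exists_adj_of_mem hK hx.1 hx.2 hxK') hex

/-- The trace of a function in `H¹(Ω)` on the skeleton of the mesh is single-valued. -/
lemma skeletonTrace_ae_eq (T : Triangulation Ω ι) (hu : MemSobolev 1 Ω u) (K : ι) :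
    T.skeletonTrace u =ᵐ[bdryMeasure (T.cell K)] trace (T.cell K) u := by
  classical
  have hex : ∃ t : E d → ℝ, ∀ K, t =ᵐ[bdryMeasure (T.cell K)] trace (T.cell K) u := by
    -- At each point any cell containing it may be used, since by `ae_trace_eq` the choice matters
    -- only on null sets.
    refine ⟨fun x => if h : ∃ K, x ∈ hull (T.cell K) then trace (T.cell h.choose) u x else 0,
      fun K => ?_⟩
    have hmem : ∀ᵐ x ∂bdryMeasure (T.cell K), x ∈ hull (T.cell K) := by
      rw [ae_bdryMeasure_iff]
      exact fun i => (ae_mem_facet _ i).mono fun x hx => facet_subset_hull _ _ hx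
    filter_upwards [T.ae_trace_eq hu K, hmem] with x hx hxK
    have h : ∃ K, x ∈ hull (T.cell K) := ⟨K, hxK⟩
    simp only [dif_pos h]
    exact hx _ h.choose_spec
  rw [skeletonTrace, dif_pos hex]
  exact hex.choose_spec K

lemma skeletonTrace_ae_eq_facet (T : Triangulation Ω ι) (hu : MemSobolev 1 Ω u) (K : ι)
    (i : Fin (d + 1)) :
    T.skeletonTrace u =ᵐ[facetMeasure (T.cell K) i] trace (T.cell K) u :=
  (ae_bdryMeasure_iff _).1 (T.skeletonTrace_ae_eq hu K) i

omit [Fintype ι] in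
lemma trace_weakPartial_ae_eq (T : Triangulation Ω ι) (hu : MemSobolev 2 Ω u) (K : ι) (j : Fin d) :
    trace (T.cell K) (weakPartial (interior (hull (T.cell K))) j u)
      =ᵐ[bdryMeasure (T.cell K)] trace (T.cell K) (weakPartial Ω j u) :=
  trace_congr ((T.memSobolev_cell hu K).memSobolev_weakPartial isOpen_interior j)
    (T.weakPartial_cell hu K j)

/-- The traces of the gradient of a function in `H²(Ω)` from both sides of a facet agree. -/
lemma Adj.traceGrad_ae_eq (h : T.Adj p q) (hu : MemSobolev 2 Ω u) :
    traceGrad (T.cell p.1) u =ᵐ[facetMeasure (T.cell p.1) p.2] traceGrad (T.cell q.1) u := by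
  have hj : ∀ j, trace (T.cell p.1) (weakPartial (interior (hull (T.cell p.1))) j u)
      =ᵐ[facetMeasure (T.cell p.1) p.2]
      trace (T.cell q.1) (weakPartial (interior (hull (T.cell q.1))) j u) := fun j => by
    have h1 := (ae_bdryMeasure_iff _).1 (T.trace_weakPartial_ae_eq hu p.1 j) p.2
    have h2 := (ae_bdryMeasure_iff _).1 (T.trace_weakPartial_ae_eq hu q.1 j) q.2
    rw [← h.facetMeasure_eq] at h2
    have h3 := h.trace_ae_eq (hu.memSobolev_weakPartial T.isOpen_domain j)
    filter_upwards [h1, h2, h3] with x h1 h2 h3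
    rw [h1, h2, h3]
  filter_upwards [ae_all_iff.2 hj] with x hx
  simp only [traceGrad, hx]

end Traces

end Triangulation

/-! ### Fluxes on a cell -/

section Cell

variable {d : ℕ} {K : Affine.Simplex ℝ (E d) d} {κ : ℝ} {a : E d → E d} {w w' ψ : E d → ℝ}

lemma inner_eq_sum_mul (x y : E d) : inner ℝ x y = ∑ j, x j * y j := by
  simp [PiLp.inner_apply, mul_comm]

/-- The discontinuous indicator disappears in favour of a continuous function of the normal
velocity, and the outflow term becomes the complementary `max`. -/
lemma zeta_mul_inner (a : E d → E d) (n x : E d) :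
    zeta a n x * inner ℝ (a x) n = min (inner ℝ (a x) n) 0 := by
  rw [zeta]
  split_ifs with h
  · rw [one_mul, min_eq_left h.le]
  · rw [zero_mul, min_eq_right (not_lt.1 h)]

lemma integral_eq_sum_sub_sum {ν : Measure (E d)} {f : E d → ℝ} {g h : Fin d → E d → ℝ}
    (hg : ∀ j, Integrable (g j) ν) (hh : ∀ j, Integrable (h j) ν)
    (hf : ∀ᵐ x ∂ν, f x = ∑ j, (g j x - h j x)) :
    ∫ x, f x ∂ν = (∑ j, ∫ x, g j x ∂ν) - ∑ j, ∫ x, h j x ∂ν := by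
  rw [integral_congr_ae hf, ← Finset.sum_sub_distrib]
  refine (integral_finsetSum _ fun j _ => (hg j).sub (hh j)).trans ?_
  exact Finset.sum_congr rfl fun j _ => integral_sub (hg j) (hh j)

variable [NeZero d]

lemma continuousOn_inner_normal (ha : ContinuousOn a (hull K)) (i : Fin (d + 1)) :
    ContinuousOn (fun x => inner ℝ (a x) (normal K i)) (facet K i) :=
  (ha.mono (facet_subset_hull K i)).inner continuousOn_const

omit [NeZero d] in
lemma MemSobolev.one {U : Set (E d)} (hw : MemSobolev (if 0 < κ then 2 else 1) U w) :
    MemSobolev 1 U w := by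
  split_ifs at hw
  · exact hw.of_succ
  · exact hw

omit [NeZero d] in
lemma MemSobolev.two (hκ : 0 < κ)
    (hw : MemSobolev (if 0 < κ then 2 else 1) (interior (hull K)) w) :
    MemSobolev 2 (interior (hull K)) w := by
  rwa [if_pos hκ] at hw

omit [NeZero d] in
lemma inner_traceGrad (w : E d → ℝ) (n x : E d) :
    inner ℝ (traceGrad K w x) n =
      ∑ j, trace K (weakPartial (interior (hull K)) j w) x * n j :=
  inner_eq_sum_mul _ _

lemma memLp_traceGrad (hw : MemSobolev 2 (interior (hull K)) w) (n : E d) (i : Fin (d + 1)) :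
    MemLp (fun x => inner ℝ (traceGrad K w x) n) 2 (facetMeasure K i) := by
  simp_rw [inner_traceGrad]
  exact memLp_finsetSum _ fun j _ =>
    (memLp_trace_facet (hw.memSobolev_weakPartial isOpen_interior j) i).mul_const _

/-- The factor `κ` is kept inside because for κ = 0 the function is only in H¹ and its gradient need
not have a trace; the product is then zero. -/
lemma memLp_mul_traceGrad (hκ : 0 ≤ κ)
    (hw : MemSobolev (if 0 < κ then 2 else 1) (interior (hull K)) w) (n : E d) (i : Fin (d + 1)) :
    MemLp (fun x => κ * inner ℝ (traceGrad K w x) n) 2 (facetMeasure K i) := by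
  rcases hκ.eq_or_lt with rfl | hκ
  · simp
  · exact (memLp_traceGrad (hw.two hκ) n i).const_mul κ

lemma mul_traceGrad_sub (hκ : 0 ≤ κ)
    (hw : MemSobolev (if 0 < κ then 2 else 1) (interior (hull K)) w)
    (hw' : MemSobolev (if 0 < κ then 2 else 1) (interior (hull K)) w') (n : E d)
    (i : Fin (d + 1)) :
    ∀ᵐ x ∂facetMeasure K i, κ * inner ℝ (traceGrad K (w - w') x) n =
      κ * inner ℝ (traceGrad K w x) n - κ * inner ℝ (traceGrad K w' x) n := by
  rcases hκ.eq_or_lt with rfl | hκ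
  · simp
  replace hw := hw.two hκ
  replace hw' := hw'.two hκ
  have h1 : ∀ j, trace K (weakPartial (interior (hull K)) j (w - w')) =ᵐ[bdryMeasure K]
      trace K (weakPartial (interior (hull K)) j w)
        - trace K (weakPartial (interior (hull K)) j w') := fun j =>
    (trace_congr ((hw.sub isOpen_interior hw').memSobolev_weakPartial isOpen_interior j)
      (hw.weakPartial_sub isOpen_interior hw' j)).trans
      (trace_sub (hw.memSobolev_weakPartial isOpen_interior j)
        (hw'.memSobolev_weakPartial isOpen_interior j))
  filter_upwards [ae_all_iff.2 fun j => (ae_bdryMeasure_iff K).1 (h1 j) i] with x hx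
  simp_rw [inner_traceGrad, hx, ← mul_sub, ← Finset.sum_sub_distrib, Pi.sub_apply, sub_mul]

/-- Integration by parts of the total flux on a cell. -/
lemma integral_flux (hκ : 0 ≤ κ)
    (hw : MemSobolev (if 0 < κ then 2 else 1) (interior (hull K)) w)
    (hψ : ContDiff ℝ ∞ ψ) (ha : ContinuousOn a (hull K))
    (hdiv : IsDivFree (interior (hull K)) a) :
    ∫ x in interior (hull K), inner ℝ (-(w x • a x) + κ • weakGrad (interior (hull K)) w x)
        (weakGrad (interior (hull K)) ψ x) =
      ∑ i, ∫ x, (κ * inner ℝ (traceGrad K w x) (normal K i)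
          - inner ℝ (a x) (normal K i) * trace K w x) * ψ x ∂facetMeasure K i
        + ∫ x in interior (hull K), (inner ℝ (a x) (weakGrad (interior (hull K)) w x)
          - κ * weakLaplacian (interior (hull K)) w x) * ψ x := by
  set U := interior (hull K) with hU
  have hw1 := hw.one
  have ham : ∀ j, MemLp (fun x => a x j) ⊤ (volume.restrict U) := fun j =>
    memLp_hull K (continuousOn_coord ha j)
  have hamF : ∀ i j, MemLp (fun x => a x j) ⊤ (facetMeasure K i) := fun i j =>
    memLp_facet K i ((continuousOn_coord ha j).mono (facet_subset_hull K i))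
  have hp' : ∀ j, MemLp (partialDeriv j ψ) ⊤ (volume.restrict U) := fun j =>
    memLp_hull K (contDiff_partialDeriv hψ j).continuous.continuousOn
  have hm : MemLp ψ ⊤ (volume.restrict U) := memLp_hull K hψ.continuous.continuousOn
  have hone : ∀ {g : E d → ℝ}, MemLp g 2 (volume.restrict U) → Integrable g (volume.restrict U) :=
    fun hg => hg.integrable (by norm_num)
  have honeF : ∀ {i : Fin (d + 1)} {g : E d → ℝ}, MemLp g 2 (facetMeasure K i) →
      Integrable g (facetMeasure K i) := fun hg => hg.integrable (by norm_num)
  have hmn : ∀ i j, MemLp (fun x => ψ x * normal K i j) ⊤ (facetMeasure K i) := fun i j =>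
    memLp_facet K i (hψ.continuous.mul continuous_const).continuousOn
  have hwp := fun j => (hw1.memSobolev_weakPartial isOpen_interior j).memLp
  have hawp : ∀ j, Integrable (fun x => a x j * (w x * partialDeriv j ψ x)) (volume.restrict U) :=
    fun j => hone (MemLp.mul (p := ⊤) (q := 2) ((hp' j).mul hw1.memLp) (ham j))
  have hkap : ∀ j, Integrable (fun x => κ * (weakPartial U j w x * partialDeriv j ψ x))
      (volume.restrict U) := fun j => hone (((hp' j).mul (hwp j)).const_mul κ)
  have hadv : ∀ j, Integrable (fun x => a x j * (weakPartial U j w x * ψ x))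
      (volume.restrict U) := fun j =>
    hone (MemLp.mul (p := ⊤) (q := 2) (hm.mul (hwp j)) (ham j))
  have hlap : ∀ j, Integrable (fun x => κ * (weakPartial U j (weakPartial U j w) x * ψ x))
      (volume.restrict U) := fun j => by
    rcases hκ.eq_or_lt with rfl | hκ
    · simp
    · exact hone ((hm.mul (((hw.two hκ).memSobolev_weakPartial isOpen_interior
        j).memSobolev_weakPartial isOpen_interior j).memLp).const_mul κ)
  have hwF : ∀ i j, Integrable (fun x => a x j * (trace K w x * (ψ x * normal K i j)))
      (facetMeasure K i) := fun i j =>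
    honeF (MemLp.mul (p := ⊤) (q := 2)
      (MemLp.mul (p := 2) (q := ⊤) (hmn i j) (memLp_trace_facet hw1 i)) (hamF i j))
  have hkF : ∀ i j, Integrable (fun x => κ * (trace K (weakPartial U j w) x
      * (ψ x * normal K i j))) (facetMeasure K i) := fun i j => by
    rcases hκ.eq_or_lt with rfl | hκ
    · simp
    · exact (honeF (MemLp.mul (p := 2) (q := ⊤) (hmn i j) (memLp_trace_facet
        ((hw.two hκ).memSobolev_weakPartial isOpen_interior j) i))).const_mul κ
  -- The advective part needs the divergence-free field; the diffusive part is Green's formula for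
  -- each first derivative of `w`, which is in H¹ when κ > 0.
  have hgreen := integral_mul_advection hw1 hψ ha hdiv
  have hgreen' : ∀ j, ∫ x in U, κ * (weakPartial U j w x * partialDeriv j ψ x) =
      ∑ i, ∫ x, κ * (trace K (weakPartial U j w) x * (ψ x * normal K i j)) ∂facetMeasure K i
        - ∫ x in U, κ * (weakPartial U j (weakPartial U j w) x * ψ x) := fun j => by
    rcases hκ.eq_or_lt with rfl | hκ
    · simp
    · simp_rw [integral_const_mul]
      rw [integral_mul_partialDeriv ((hw.two hκ).memSobolev_weakPartial isOpen_interior j) hψ j,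
        mul_sub, Finset.mul_sum]
  have hleft : ∫ x in U, inner ℝ (-(w x • a x) + κ • weakGrad U w x) (weakGrad U ψ x) =
      (∑ j, ∫ x in U, κ * (weakPartial U j w x * partialDeriv j ψ x))
        - ∑ j, ∫ x in U, a x j * (w x * partialDeriv j ψ x) := by
    refine integral_eq_sum_sub_sum (hkap) (hawp) ?_
    filter_upwards [ae_all_iff.2 fun j => weakPartial_of_contDiff (K := K) hψ j] with x hx
    rw [inner_eq_sum_mul]
    refine Finset.sum_congr rfl fun j _ => ?_
    simp only [weakGrad, PiLp.add_apply, PiLp.neg_apply, PiLp.smul_apply, smul_eq_mul, ← hU ▸ hx j]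
    ring
  have hfacet : ∀ i, ∫ x, (κ * inner ℝ (traceGrad K w x) (normal K i)
        - inner ℝ (a x) (normal K i) * trace K w x) * ψ x ∂facetMeasure K i =
      (∑ j, ∫ x, κ * (trace K (weakPartial U j w) x * (ψ x * normal K i j)) ∂facetMeasure K i)
        - ∑ j, ∫ x, a x j * (trace K w x * (ψ x * normal K i j)) ∂facetMeasure K i := fun i => by
    refine integral_eq_sum_sub_sum (hkF i) (hwF i) (ae_of_all _ fun x => ?_)
    simp only [inner_eq_sum_mul, traceGrad, ← hU]
    rw [Finset.mul_sum, Finset.sum_mul, ← Finset.sum_sub_distrib, Finset.sum_mul]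
    refine Finset.sum_congr rfl fun j _ => ?_
    ring
  have hvol : ∫ x in U, (inner ℝ (a x) (weakGrad U w x) - κ * weakLaplacian U w x) * ψ x =
      (∑ j, ∫ x in U, a x j * (weakPartial U j w x * ψ x))
        - ∑ j, ∫ x in U, κ * (weakPartial U j (weakPartial U j w) x * ψ x) := by
    refine integral_eq_sum_sub_sum (hadv) (hlap) (ae_of_all _ fun x => ?_)
    simp only [weakLaplacian, weakGrad, inner_eq_sum_mul]
    rw [Finset.mul_sum, ← Finset.sum_sub_distrib, Finset.sum_mul]
    refine Finset.sum_congr rfl fun j _ => ?_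
    ring
  rw [hleft, hvol, Finset.sum_congr rfl fun i _ => hfacet i, hgreen,
    Finset.sum_congr rfl fun j _ => hgreen' j, Finset.sum_sub_distrib, Finset.sum_sub_distrib,
    Finset.sum_comm]
  ring

end Cell

/-! ### The bilinear form -/

section Form

variable {d : ℕ} {Ω : Set (E d)} {ι : Type*} {T : Triangulation Ω ι}
  {μ κ α l : ℝ} {k : ℕ} {a : E d → E d} {ΓN ΓD : Set (E d)}
  {f g u w w' wbar wbar' v vbar : E d → ℝ}

variable [NeZero d]

omit [NeZero d] in
lemma contDiff_eval (p : MvPolynomial (Fin d) ℝ) :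
    ContDiff ℝ ∞ fun x : E d => MvPolynomial.eval (fun j => x j) p := by
  induction p using MvPolynomial.induction_on with
  | C c => simpa using contDiff_const
  | add p q hp hq => simpa using hp.add hq
  | mul_X p j hp => simpa using hp.mul (contDiff_coord j)

omit [NeZero d] in
lemma exists_contDiff_of_mem_Wh (hv : v ∈ Wh T k) (K : ι) :
    ∃ ψ, ContDiff ℝ ∞ ψ ∧ v =ᵐ[volume.restrict (interior (hull (T.cell K)))] ψ :=
  let ⟨p, _, hp⟩ := hv.2 K
  ⟨_, contDiff_eval p, hp⟩

lemma memSobolev_of_mem_Wh (hv : v ∈ Wh T k) (m : ℕ) (K : ι) :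
    MemSobolev m (interior (hull (T.cell K))) v :=
  let ⟨_, hψ, h⟩ := exists_contDiff_of_mem_Wh hv K
  (memSobolev_of_contDiff (T.cell K) m hψ).congr isOpen_interior h.symm

lemma memLp_facet_of_mem_Whbar (hv : vbar ∈ Whbar T k l ΓD) (K : ι) (i : Fin (d + 1)) :
    MemLp vbar 2 (facetMeasure (T.cell K) i) :=
  hv.1.1.mono_measure (Measure.restrict_mono (Set.subset_iUnion_of_subset K
    (Set.subset_iUnion (fun i => facet (T.cell K) i) i)) le_rfl)

/-- This separates the physical normal flux from the upwind and penalty terms, which are multiples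
of the difference between `wbar` and the cell trace. -/
lemma inner_numFlux (T : Triangulation Ω ι) (κ α : ℝ) (a : E d → E d) (w wbar : E d → ℝ) (K : ι)
    (i : Fin (d + 1)) (x : E d) :
    inner ℝ (numFlux T κ α a w wbar K i x) (normal (T.cell K) i) =
      κ * inner ℝ (traceGrad (T.cell K) w x) (normal (T.cell K) i)
        - inner ℝ (a x) (normal (T.cell K) i) * trace (T.cell K) w x
        - min (inner ℝ (a x) (normal (T.cell K) i)) 0 * (wbar x - trace (T.cell K) w x)
        + α * κ / T.size K * (wbar x - trace (T.cell K) w x) := by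
  rw [← zeta_mul_inner]
  simp only [numFlux, inner_add_left, inner_sub_left, inner_neg_left, real_inner_smul_left,
    real_inner_self_eq_norm_sq, normal_norm]
  ring

lemma memLp_min_inner_normal {K : Affine.Simplex ℝ (E d) d} (ha : ContinuousOn a (hull K))
    (i : Fin (d + 1)) : MemLp (fun x => min (inner ℝ (a x) (normal K i)) 0) ⊤ (facetMeasure K i) :=
  memLp_facet K i (ContinuousOn.inf (continuousOn_inner_normal ha i) continuousOn_const)

lemma memLp_max_inner_normal {K : Affine.Simplex ℝ (E d) d} (ha : ContinuousOn a (hull K))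
    (i : Fin (d + 1)) : MemLp (fun x => max (inner ℝ (a x) (normal K i)) 0) ⊤ (facetMeasure K i) :=
  memLp_facet K i (ContinuousOn.sup (continuousOn_inner_normal ha i) continuousOn_const)

lemma memLp_inner_numFlux (hκ : 0 ≤ κ) (ha : ∀ K, ContinuousOn a (hull (T.cell K))) {K : ι}
    {i : Fin (d + 1)} (hw : MemSobolev (if 0 < κ then 2 else 1) (interior (hull (T.cell K))) w)
    (hwbar : MemLp wbar 2 (facetMeasure (T.cell K) i)) :
    MemLp (fun x => inner ℝ (numFlux T κ α a w wbar K i x) (normal (T.cell K) i)) 2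
      (facetMeasure (T.cell K) i) := by
  simp_rw [inner_numFlux]
  have h1 := memLp_trace_facet hw.one i
  have h2 := hwbar.sub h1
  refine (((memLp_mul_traceGrad hκ hw _ i).sub ?_).sub ?_).add (h2.const_mul _)
  · exact MemLp.mul (p := ⊤) (q := 2) h1 (memLp_facet _ i (continuousOn_inner_normal (ha K) i))
  · exact MemLp.mul (p := ⊤) (q := 2) h2 (memLp_min_inner_normal (ha K) i)

lemma setIntegral_outflow {K : Affine.Simplex ℝ (E d) d} (ha : ContinuousOn a (hull K))
    (i : Fin (d + 1)) (f : E d → ℝ) :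
    ∫ x in {x | 0 ≤ inner ℝ (a x) (normal K i)}, inner ℝ (a x) (normal K i) * f x
      ∂facetMeasure K i = ∫ x, max (inner ℝ (a x) (normal K i)) 0 * f x ∂facetMeasure K i := by
  have hm : AEStronglyMeasurable (fun x => inner ℝ (a x) (normal K i)) (facetMeasure K i) :=
    (memLp_facet (p := 2) K i (continuousOn_inner_normal ha i)).1
  have hS : NullMeasurableSet {x | 0 ≤ inner ℝ (a x) (normal K i)} (facetMeasure K i) :=
    nullMeasurableSet_le aemeasurable_const hm.aemeasurable
  rw [← integral_indicator₀ hS]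
  refine integral_congr_ae (ae_of_all _ fun x => ?_)
  by_cases hx : 0 ≤ inner ℝ (a x) (normal K i)
  · rw [Set.indicator_of_mem (show x ∈ {x | 0 ≤ inner ℝ (a x) (normal K i)} from hx)]
    simp only [max_eq_left hx]
  · rw [Set.indicator_of_notMem (show x ∉ {x | 0 ≤ inner ℝ (a x) (normal K i)} from hx)]
    simp only [max_eq_right (not_le.1 hx).le, zero_mul]

omit [NeZero d] in
lemma integrable_inner_flux {K : Affine.Simplex ℝ (E d) d} (ha : ContinuousOn a (hull K))
    (hw : MemSobolev 1 (interior (hull K)) w) (hv : MemSobolev 1 (interior (hull K)) v) :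
    Integrable (fun x => inner ℝ (-(w x • a x) + κ • weakGrad (interior (hull K)) w x)
      (weakGrad (interior (hull K)) v x)) (volume.restrict (interior (hull K))) := by
  simp_rw [inner_eq_sum_mul]
  refine integrable_finsetSum _ fun j _ => MemLp.integrable_mul (p := 2) (q := 2) ?_
    (hv.memSobolev_weakPartial isOpen_interior j).memLp
  have h1 : MemLp (fun x => w x * a x j) 2 (volume.restrict (interior (hull K))) :=
    MemLp.mul (p := 2) (q := ⊤) (memLp_hull K (continuousOn_coord ha j)) hw.memLp
  exact h1.neg.add ((hw.memSobolev_weakPartial isOpen_interior j).memLp.const_mul κ)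

variable [Fintype ι]

/-- The bilinear form is additive in its first argument. -/
lemma B_sub (hκ : 0 ≤ κ) (ha : ∀ K, ContinuousOn a (hull (T.cell K)))
    (hw0 : MemLp w 2 (volume.restrict Ω)) (hw0' : MemLp w' 2 (volume.restrict Ω))
    (hv0 : MemLp v 2 (volume.restrict Ω))
    (hw : ∀ K, MemSobolev (if 0 < κ then 2 else 1) (interior (hull (T.cell K))) w)
    (hw' : ∀ K, MemSobolev (if 0 < κ then 2 else 1) (interior (hull (T.cell K))) w')
    (hv : ∀ K, MemSobolev 2 (interior (hull (T.cell K))) v)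
    (hwbar : ∀ K i, MemLp wbar 2 (facetMeasure (T.cell K) i))
    (hwbar' : ∀ K i, MemLp wbar' 2 (facetMeasure (T.cell K) i))
    (hvbar : ∀ K i, MemLp vbar 2 (facetMeasure (T.cell K) i)) :
    B T μ κ α a (w - w') (wbar - wbar') v vbar =
      B T μ κ α a w wbar v vbar - B T μ κ α a w' wbar' v vbar := by
  -- Traces and weak derivatives are chosen representatives, so they are additive only almost
  -- everywhere; integrability is what permits splitting each integral.
  have htr : ∀ K i, ∀ᵐ x ∂facetMeasure (T.cell K) i,
      trace (T.cell K) (w - w') x = trace (T.cell K) w x - trace (T.cell K) w' x := fun K i =>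
    (ae_bdryMeasure_iff _).1 (trace_sub (hw K).one (hw' K).one) i
  have hvt := fun K i => (hvbar K i).sub (memLp_trace_facet (hv K).of_succ i)
  have h1 : ∫ x in Ω, μ * (w - w') x * v x =
      (∫ x in Ω, μ * w x * v x) - ∫ x in Ω, μ * w' x * v x := by
    refine (integral_congr_ae (ae_of_all _ fun x => ?_)).trans (integral_sub
      ((hw0.const_mul μ).integrable_mul hv0) ((hw0'.const_mul μ).integrable_mul hv0))
    simp only [Pi.sub_apply]
    ring
  have h2 : ∀ K, ∫ x in T.cellInt K, inner ℝ (-((w - w') x • a x)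
        + κ • weakGrad (T.cellInt K) (w - w') x) (weakGrad (T.cellInt K) v x) =
      (∫ x in T.cellInt K, inner ℝ (-(w x • a x)
        + κ • weakGrad (T.cellInt K) w x) (weakGrad (T.cellInt K) v x))
      - ∫ x in T.cellInt K, inner ℝ (-(w' x • a x)
        + κ • weakGrad (T.cellInt K) w' x) (weakGrad (T.cellInt K) v x) := fun K => by
    refine (integral_congr_ae ?_).trans (integral_sub
      (integrable_inner_flux (ha K) (hw K).one (hv K).of_succ)
      (integrable_inner_flux (ha K) (hw' K).one (hv K).of_succ))
    filter_upwards [ae_all_iff.2 fun j => (hw K).one.weakPartial_sub isOpen_interior (hw' K).one j]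
      with x hx
    rw [← inner_sub_left]
    congr 1
    ext j
    simp only [Triangulation.cellInt, weakGrad, PiLp.add_apply, PiLp.sub_apply, PiLp.neg_apply,
      PiLp.smul_apply, smul_eq_mul, Pi.sub_apply, hx]
    ring
  have h3 : ∀ K i, ∫ x, inner ℝ (numFlux T κ α a (w - w') (wbar - wbar') K i x)
        (normal (T.cell K) i) * (vbar x - trace (T.cell K) v x) ∂facetMeasure (T.cell K) i =
      (∫ x, inner ℝ (numFlux T κ α a w wbar K i x)
        (normal (T.cell K) i) * (vbar x - trace (T.cell K) v x) ∂facetMeasure (T.cell K) i)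
      - ∫ x, inner ℝ (numFlux T κ α a w' wbar' K i x)
        (normal (T.cell K) i) * (vbar x - trace (T.cell K) v x) ∂facetMeasure (T.cell K) i := by
    intro K i
    refine (integral_congr_ae ?_).trans (integral_sub
      ((memLp_inner_numFlux hκ ha (hw K) (hwbar K i)).integrable_mul (hvt K i))
      ((memLp_inner_numFlux hκ ha (hw' K) (hwbar' K i)).integrable_mul (hvt K i)))
    filter_upwards [htr K i, mul_traceGrad_sub hκ (hw K) (hw' K) (normal (T.cell K) i) i]
      with x hx hx'
    simp only [Pi.sub_apply, inner_numFlux, hx, hx']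
    ring
  have h4 : ∀ K i, ∫ x, κ * ((wbar - wbar') x - trace (T.cell K) (w - w') x)
        * inner ℝ (traceGrad (T.cell K) v x) (normal (T.cell K) i) ∂facetMeasure (T.cell K) i =
      (∫ x, κ * (wbar x - trace (T.cell K) w x)
        * inner ℝ (traceGrad (T.cell K) v x) (normal (T.cell K) i) ∂facetMeasure (T.cell K) i)
      - ∫ x, κ * (wbar' x - trace (T.cell K) w' x)
        * inner ℝ (traceGrad (T.cell K) v x) (normal (T.cell K) i) ∂facetMeasure (T.cell K) i := by
    intro K i
    refine (integral_congr_ae ?_).trans (integral_sub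
      ((((hwbar K i).sub (memLp_trace_facet (hw K).one i)).const_mul κ).integrable_mul
        (memLp_traceGrad (hv K) _ i))
      ((((hwbar' K i).sub (memLp_trace_facet (hw' K).one i)).const_mul κ).integrable_mul
        (memLp_traceGrad (hv K) _ i)))
    filter_upwards [htr K i] with x hx
    simp only [Pi.sub_apply, hx]
    ring
  have h5 : ∀ K i, ∫ x in {x | 0 ≤ inner ℝ (a x) (normal (T.cell K) i)},
        inner ℝ (a x) (normal (T.cell K) i) * vbar x * (wbar - wbar') x
          ∂facetMeasure (T.cell K) i =
      (∫ x in {x | 0 ≤ inner ℝ (a x) (normal (T.cell K) i)},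
        inner ℝ (a x) (normal (T.cell K) i) * vbar x * wbar x ∂facetMeasure (T.cell K) i)
      - ∫ x in {x | 0 ≤ inner ℝ (a x) (normal (T.cell K) i)},
        inner ℝ (a x) (normal (T.cell K) i) * vbar x * wbar' x ∂facetMeasure (T.cell K) i := by
    intro K i
    have hi : ∀ {z : E d → ℝ}, MemLp z 2 (facetMeasure (T.cell K) i) →
        Integrable (fun x => inner ℝ (a x) (normal (T.cell K) i) * vbar x * z x)
          (facetMeasure (T.cell K) i) := fun hz =>
      MemLp.integrable_mul (p := 2) (q := 2) (MemLp.mul (p := ⊤) (q := 2) (hvbar K i)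
        (memLp_facet _ i (continuousOn_inner_normal (ha K) i))) hz
    rw [← integral_sub (hi (hwbar K i)).integrableOn (hi (hwbar' K i)).integrableOn]
    refine integral_congr_ae (ae_of_all _ fun x => ?_)
    simp only [Pi.sub_apply]
    ring
  have h6 : ∀ (P : Prop) [Decidable P] (x y : ℝ),
      (if P then x - y else 0) = (if P then x else 0) - if P then y else 0 := by
    intro P _ x y
    split_ifs <;> simp
  simp only [B]
  rw [h1]
  simp_rw [h2, h3, h4, h5, h6, Finset.sum_sub_distrib]
  ring

end Form

/-! ### Consistency -/

section Consistency

variable {d : ℕ} [NeZero d] {Ω : Set (E d)} {ι : Type*} {T : Triangulation Ω ι}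
  {μ κ α l : ℝ} {k : ℕ} {a : E d → E d} {ΓN ΓD : Set (E d)} {f g u v ubar vbar : E d → ℝ}

lemma memLp_normal_flux {K : Affine.Simplex ℝ (E d) d} (hκ : 0 ≤ κ)
    (ha : ContinuousOn a (hull K))
    (hu : MemSobolev (if 0 < κ then 2 else 1) (interior (hull K)) u) (i : Fin (d + 1)) :
    MemLp (fun x => κ * inner ℝ (traceGrad K u x) (normal K i)
      - inner ℝ (a x) (normal K i) * trace K u x) 2 (facetMeasure K i) :=
  (memLp_mul_traceGrad hκ hu _ i).sub (MemLp.mul (p := ⊤) (q := 2) (memLp_trace_facet hu.one i)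
    (memLp_facet _ i (continuousOn_inner_normal ha i)))

omit [NeZero d] in
lemma memLp_advection_diffusion {K : Affine.Simplex ℝ (E d) d} (hκ : 0 ≤ κ)
    (ha : ContinuousOn a (hull K))
    (hu : MemSobolev (if 0 < κ then 2 else 1) (interior (hull K)) u) :
    MemLp (fun x => inner ℝ (a x) (weakGrad (interior (hull K)) u x)
      - κ * weakLaplacian (interior (hull K)) u x) 2 (volume.restrict (interior (hull K))) := by
  refine MemLp.sub ?_ ?_
  · simp_rw [inner_eq_sum_mul]
    exact memLp_finsetSum _ fun j _ => MemLp.mul (p := ⊤) (q := 2)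
      (hu.one.memSobolev_weakPartial isOpen_interior j).memLp (memLp_hull K (continuousOn_coord ha j))
  · rcases hκ.eq_or_lt with rfl | hκ
    · simp
    · exact (memLp_finsetSum _ fun j _ => ((((hu.two hκ).memSobolev_weakPartial isOpen_interior
        j).memSobolev_weakPartial isOpen_interior j).memLp)).const_mul κ

omit [NeZero d] in
lemma Triangulation.weakPartial_weakPartial_cell (T : Triangulation Ω ι) (hu : MemSobolev 2 Ω u)
    (K : ι) (j : Fin d) :
    weakPartial (interior (hull (T.cell K))) j (weakPartial (interior (hull (T.cell K))) j u)
      =ᵐ[volume.restrict (interior (hull (T.cell K)))] weakPartial Ω j (weakPartial Ω j u) :=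
  (((T.memSobolev_cell hu K).memSobolev_weakPartial isOpen_interior j).weakPartial_congr
    isOpen_interior (T.weakPartial_cell hu K j) j).trans
    (T.weakPartial_cell (hu.memSobolev_weakPartial T.isOpen_domain j) K j)

-- Weak derivatives on a cell are restrictions of those on Ω, so the equation holds with the
-- cell-wise derivatives that occur in `B`. The Laplacian is compared only when κ > 0.
omit [NeZero d] in
lemma SolvesPDE.cell (hκ : 0 ≤ κ) (hu : MemSobolev (if 0 < κ then 2 else 1) Ω u)
    (h : SolvesPDE Ω μ κ a f u) (T : Triangulation Ω ι) (K : ι) :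
    ∀ᵐ x ∂volume.restrict (interior (hull (T.cell K))),
      μ * u x + (inner ℝ (a x) (weakGrad (interior (hull (T.cell K))) u x)
        - κ * weakLaplacian (interior (hull (T.cell K))) u x) = f x := by
  have hu1 := hu.one
  have hlap : ∀ᵐ x ∂volume.restrict (interior (hull (T.cell K))),
      κ * weakLaplacian (interior (hull (T.cell K))) u x = κ * weakLaplacian Ω u x := by
    rcases hκ.eq_or_lt with rfl | hκ
    · simp
    · rw [if_pos hκ] at hu
      filter_upwards [ae_all_iff.2 fun j => T.weakPartial_weakPartial_cell hu K j] with x hx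
      simp only [weakLaplacian, hx]
  filter_upwards [ae_mono (Measure.restrict_mono (T.cellInt_subset K) le_rfl) h, hlap,
    ae_all_iff.2 fun j => T.weakPartial_cell hu1 K j] with x hx h1 h2
  rw [h1, ← hx]
  simp only [weakGrad, h2]
  ring

omit [NeZero d] in
lemma IsDivFree.mono {U V : Set (E d)} (h : IsDivFree U a) (hVU : V ⊆ U) (hU : MeasurableSet U) :
    IsDivFree V a := fun φ hφ => by
  rw [← h φ (hφ.mono hVU)]
  refine (setIntegral_eq_of_subset_of_forall_sdiff_eq_zero hU hVU fun x hx => ?_).symm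
  rw [fderiv_eq_sum_partialDeriv]
  exact Finset.sum_eq_zero fun j _ => by rw [(hφ.partialDeriv j).eq_zero hx.2, mul_zero]

/-- The weak form of the boundary value problem on a cell, with a discontinuous test function. -/
lemma SolvesPDE.integral_cell (hκ : 0 ≤ κ) (hu : MemSobolev (if 0 < κ then 2 else 1) Ω u)
    (h : SolvesPDE Ω μ κ a f u) (ha : ∀ K, ContinuousOn a (hull (T.cell K)))
    (hdiv : IsDivFree Ω a) (hv : v ∈ Wh T k) (K : ι) :
    (∫ x in T.cellInt K, μ * u x * v x) + ∫ x in T.cellInt K, inner ℝ (-(u x • a x)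
        + κ • weakGrad (T.cellInt K) u x) (weakGrad (T.cellInt K) v x) =
      ∑ i, ∫ x, (κ * inner ℝ (traceGrad (T.cell K) u x) (normal (T.cell K) i)
          - inner ℝ (a x) (normal (T.cell K) i) * trace (T.cell K) u x)
          * trace (T.cell K) v x ∂facetMeasure (T.cell K) i
        + ∫ x in T.cellInt K, f x * v x := by
  -- Green's formula requires a globally smooth test function; the polynomial that represents `v` on
  -- the cell has almost everywhere the same weak gradient and trace.
  obtain ⟨ψ, hψ, hvψ⟩ := exists_contDiff_of_mem_Wh hv K
  have hv1 := memSobolev_of_mem_Wh hv 1 K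
  have huK := T.memSobolev_cell hu K
  have h1 : ∫ x in T.cellInt K, inner ℝ (-(u x • a x)
        + κ • weakGrad (T.cellInt K) u x) (weakGrad (T.cellInt K) v x) =
      ∫ x in interior (hull (T.cell K)), inner ℝ (-(u x • a x)
        + κ • weakGrad (interior (hull (T.cell K))) u x)
          (weakGrad (interior (hull (T.cell K))) ψ x) := by
    refine integral_congr_ae ?_
    filter_upwards [ae_all_iff.2 fun j => hv1.weakPartial_congr isOpen_interior hvψ j] with x hx
    congr 1
    ext j
    exact hx j
  have h2 : ∀ i, ∫ x, (κ * inner ℝ (traceGrad (T.cell K) u x) (normal (T.cell K) i)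
          - inner ℝ (a x) (normal (T.cell K) i) * trace (T.cell K) u x)
          * trace (T.cell K) v x ∂facetMeasure (T.cell K) i =
      ∫ x, (κ * inner ℝ (traceGrad (T.cell K) u x) (normal (T.cell K) i)
          - inner ℝ (a x) (normal (T.cell K) i) * trace (T.cell K) u x)
          * ψ x ∂facetMeasure (T.cell K) i := fun i => by
    refine integral_congr_ae ?_
    filter_upwards [(ae_bdryMeasure_iff _).1
      ((trace_congr hv1 hvψ).trans (trace_of_contDiff hψ)) i] with x hx
    rw [hx]
  have hψ2 : MemLp ψ 2 (volume.restrict (interior (hull (T.cell K)))) :=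
    memLp_hull _ hψ.continuous.continuousOn
  have h3 : ∫ x in T.cellInt K, f x * v x = (∫ x in T.cellInt K, μ * u x * v x)
      + ∫ x in interior (hull (T.cell K)),
        (inner ℝ (a x) (weakGrad (interior (hull (T.cell K))) u x)
          - κ * weakLaplacian (interior (hull (T.cell K))) u x) * ψ x := by
    refine (integral_congr_ae ?_).trans (integral_add
      ((huK.memLp.const_mul μ).integrable_mul hv1.memLp)
      ((memLp_advection_diffusion hκ (ha K) huK).integrable_mul hψ2))
    filter_upwards [h.cell hκ hu T K, hvψ] with x hx hx'
    simp only [← hx, hx']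
    ring
  rw [h1, h3, integral_flux hκ huK hψ (ha K) (hdiv.mono (T.cellInt_subset K)
    T.isOpen_domain.measurableSet), Finset.sum_congr rfl fun i _ => h2 i]
  ring

variable [Fintype ι]

open Classical in
/-- The fluxes of a function in `H²(Ω)` over the facets in `Ω` cancel. -/
lemma sum_integral_normal_flux (hκ : 0 ≤ κ) (hu : MemSobolev (if 0 < κ then 2 else 1) Ω u) :
    ∑ K, ∑ i, ∫ x, (κ * inner ℝ (traceGrad (T.cell K) u x) (normal (T.cell K) i)
          - inner ℝ (a x) (normal (T.cell K) i) * trace (T.cell K) u x)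
          * vbar x ∂facetMeasure (T.cell K) i =
      ∑ K, ∑ i, if T.IsBdryFacet K i then
        ∫ x, (κ * inner ℝ (traceGrad (T.cell K) u x) (normal (T.cell K) i)
          - inner ℝ (a x) (normal (T.cell K) i) * trace (T.cell K) u x)
          * vbar x ∂facetMeasure (T.cell K) i else 0 := by
  have hu1 := hu.one
  set G : ι → Fin (d + 1) → ℝ := fun K i =>
    ∫ x, (κ * inner ℝ (traceGrad (T.cell K) u x) (normal (T.cell K) i)
      - inner ℝ (a x) (normal (T.cell K) i) * trace (T.cell K) u x)
      * vbar x ∂facetMeasure (T.cell K) i with hG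
  -- The two sides of a facet carry the same measure, traces and interface function, but opposite
  -- normals.
  have hadj : ∀ {p q : ι × Fin (d + 1)}, T.Adj p q → G p.1 p.2 + G q.1 q.2 = 0 := by
    intro p q h
    have hgrad : ∀ᵐ x ∂facetMeasure (T.cell p.1) p.2, ∀ n : E d,
        κ * inner ℝ (traceGrad (T.cell p.1) u x) n
          = κ * inner ℝ (traceGrad (T.cell q.1) u x) n := by
      rcases hκ.eq_or_lt with rfl | hκ
      · simp
      · rw [if_pos hκ] at hu
        filter_upwards [h.traceGrad_ae_eq hu] with x hx n
        rw [hx]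
    rw [← eq_neg_iff_add_eq_zero]
    simp only [hG]
    rw [← h.facetMeasure_eq, ← integral_neg]
    refine integral_congr_ae ?_
    filter_upwards [hgrad, h.trace_ae_eq hu1] with x h1 h2
    rw [h1, h2, h.normal_eq, inner_neg_right, inner_neg_right]
    ring
  change ∑ K, ∑ i, G K i = ∑ K, ∑ i, if T.IsBdryFacet K i then G K i else 0
  rw [← sub_eq_zero]
  simp_rw [← Finset.sum_sub_distrib]
  rw [← Fintype.sum_prod_type' (f := fun K i => G K i - if T.IsBdryFacet K i then G K i else 0)]
  have hsum : ∀ p : ι × Fin (d + 1), (G p.1 p.2 - if T.IsBdryFacet p.1 p.2 then G p.1 p.2 else 0)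
      = if ¬ T.IsBdryFacet p.1 p.2 then G p.1 p.2 else 0 := fun p => by
    split_ifs <;> simp
  simp_rw [hsum]
  rw [← Finset.sum_filter]
  have hex : ∀ p ∈ Finset.univ.filter fun p : ι × Fin (d + 1) => ¬ T.IsBdryFacet p.1 p.2,
      ∃ q, T.Adj p q := fun p hp => T.exists_adj (Finset.mem_filter.1 hp).2
  have hmem : ∀ p hp, (hex p hp).choose ∈
      Finset.univ.filter fun p : ι × Fin (d + 1) => ¬ T.IsBdryFacet p.1 p.2 := fun p hp =>
    Finset.mem_filter.2 ⟨Finset.mem_univ _, (hex p hp).choose_spec.symm.not_isBdryFacet⟩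
  -- Passing to the other side is an involution without fixed points on the facets not contained in
  -- Γ, and it pairs cancelling terms.
  refine Finset.sum_involution (fun p hp => (hex p hp).choose)
    (fun p hp => hadj (hex p hp).choose_spec) (fun p hp _ h => ?_) hmem fun p hp =>
      (hex _ (hmem p hp)).choose_spec.unique (hex p hp).choose_spec.symm
  have := (hex p hp).choose_spec
  rw [h] at this
  exact this.1 rfl

omit [Fintype ι] in
/-- The boundary conditions in weak form. -/
lemma SatisfiesBC.integral_facet (h : SatisfiesBC T κ a ΓN ΓD g u) (hκ : 0 ≤ κ)
    (hu : MemSobolev (if 0 < κ then 2 else 1) Ω u)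
    (ha : ∀ K, ContinuousOn a (hull (T.cell K))) (hΓ : IsBdryPartition T κ a ΓN ΓD)
    (hvbar : vbar ∈ Whbar T k l ΓD) {K : ι} {i : Fin (d + 1)} (hK : T.IsBdryFacet K i)
    (hubar : ubar =ᵐ[facetMeasure (T.cell K) i] trace (T.cell K) u) :
    (∫ x, (κ * inner ℝ (traceGrad (T.cell K) u x) (normal (T.cell K) i)
        - inner ℝ (a x) (normal (T.cell K) i) * trace (T.cell K) u x)
        * vbar x ∂facetMeasure (T.cell K) i)
      + ∫ x in {x | 0 ≤ inner ℝ (a x) (normal (T.cell K) i)},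
        inner ℝ (a x) (normal (T.cell K) i) * vbar x * ubar x ∂facetMeasure (T.cell K) i =
      ∫ x in ΓN, g x * vbar x ∂facetMeasure (T.cell K) i := by
  have huK := T.memSobolev_cell hu K
  have hv := memLp_facet_of_mem_Whbar hvbar K i
  have hu2 := (memLp_trace_facet huK.one i).ae_eq hubar.symm
  have hD : ∀ᵐ x ∂facetMeasure (T.cell K) i, x ∈ ΓD → vbar x = 0 :=
    ae_restrict_of_ae ((ae_restrict_iff' hΓ.measurable_D).1 hvbar.2.2)
  have hcover : 0 < κ → ∀ᵐ x ∂facetMeasure (T.cell K) i, x ∈ ΓN ∨ x ∈ ΓD := fun hκ => by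
    have h1 := ae_restrict_of_ae (s := facet (T.cell K) i)
      (measure_eq_zero_iff_ae_notMem.1 (hΓ.cover hκ))
    filter_upwards [h1, ae_mem_facet (T.cell K) i] with x hx hx'
    by_contra hno
    exact hx ⟨hK hx', hno⟩
  simp_rw [mul_assoc (inner ℝ (a _) (normal (T.cell K) i))]
  rw [setIntegral_outflow (ha K) i fun x => vbar x * ubar x, ← integral_indicator hΓ.measurable_N]
  have hint : Integrable (fun x => max (inner ℝ (a x) (normal (T.cell K) i)) 0
      * (vbar x * ubar x)) (facetMeasure (T.cell K) i) :=
    (MemLp.integrable_mul (p := 2) (q := 2) (MemLp.mul (p := ⊤) (q := 2) hv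
      (memLp_max_inner_normal (ha K) i)) hu2).congr (ae_of_all _ fun x => mul_assoc _ _ _)
  refine (integral_add ((memLp_normal_flux hκ (ha K) huK i).integrable_mul hv) hint).symm.trans
    (integral_congr_ae ?_)
  have hN : κ = 0 → ∀ᵐ x ∂facetMeasure (T.cell K) i,
      x ∈ ΓN ↔ inner ℝ (a x) (normal (T.cell K) i) < 0 := fun hκ => hΓ.neumann_inflow hκ K i hK
  -- The two boundary conditions in common form. Off Γ_N the reason differs: for κ > 0 almost every
  -- point lies in Γ_D, where the test function vanishes; for κ = 0 there is no inflow, so the `min`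
  -- is zero.
  have hflux : ∀ᵐ x ∂facetMeasure (T.cell K) i,
      (x ∈ ΓN → κ * inner ℝ (traceGrad (T.cell K) u x) (normal (T.cell K) i)
        - min (inner ℝ (a x) (normal (T.cell K) i)) 0 * trace (T.cell K) u x = g x) ∧
      (x ∉ ΓN → (κ * inner ℝ (traceGrad (T.cell K) u x) (normal (T.cell K) i)
        - min (inner ℝ (a x) (normal (T.cell K) i)) 0 * trace (T.cell K) u x) * vbar x = 0) := by
    rcases hκ.eq_or_lt with rfl | hκ
    · filter_upwards [h K i hK, hN rfl] with x hx hx'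
      refine ⟨fun hxN => ?_, fun hxN => ?_⟩
      · rw [← hx.2 rfl hxN, min_eq_left (hx'.1 hxN).le]
        ring
      · rw [min_eq_right (not_lt.1 fun hlt => hxN (hx'.2 hlt))]
        ring
    · filter_upwards [h K i hK, hcover hκ, hD] with x hx hx' hx''
      refine ⟨fun hxN => ?_, fun hxN => ?_⟩
      · rw [← (hx.1 hκ).1 hxN, ← zeta_mul_inner, inner_add_left, real_inner_smul_left,
          real_inner_smul_left]
        ring
      · rw [hx'' (hx'.resolve_left hxN), mul_zero]
  filter_upwards [hflux, hubar] with x hx hx'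
  -- The outflow term cancels the positive part of the advective flux, leaving the `min`, which is
  -- the inflow part in the boundary condition.
  have hsplit : (κ * inner ℝ (traceGrad (T.cell K) u x) (normal (T.cell K) i)
      - inner ℝ (a x) (normal (T.cell K) i) * trace (T.cell K) u x) * vbar x
      + max (inner ℝ (a x) (normal (T.cell K) i)) 0 * (vbar x * ubar x) =
      (κ * inner ℝ (traceGrad (T.cell K) u x) (normal (T.cell K) i)
        - min (inner ℝ (a x) (normal (T.cell K) i)) 0 * trace (T.cell K) u x) * vbar x := by
    have h1 := min_add_max (inner ℝ (a x) (normal (T.cell K) i)) 0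
    rw [hx']
    linear_combination (trace (T.cell K) u x * vbar x) * h1
  refine hsplit.trans ?_
  by_cases hxN : x ∈ ΓN
  · rw [Set.indicator_of_mem hxN, hx.1 hxN]
  · rw [Set.indicator_of_notMem hxN, hx.2 hxN]

/-- The solution of the boundary value problem and its trace satisfy the discrete equations. -/
theorem B_skeletonTrace_eq_L (hκ : 0 ≤ κ) (ha : ∀ K, ContinuousOn a (hull (T.cell K)))
    (hdiv : IsDivFree Ω a) (hΓ : IsBdryPartition T κ a ΓN ΓD)
    (hu : MemSobolev (if 0 < κ then 2 else 1) Ω u) (hu_pde : SolvesPDE Ω μ κ a f u)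
    (hu_bc : SatisfiesBC T κ a ΓN ΓD g u) (hv : v ∈ Wh T k) (hvbar : vbar ∈ Whbar T k l ΓD) :
    B T μ κ α a u (T.skeletonTrace u) v vbar = L T ΓN f g v vbar := by
  classical
  have hu1 := hu.one
  have huK := fun K => T.memSobolev_cell hu K
  have hv1 := fun K => memSobolev_of_mem_Wh hv 1 K
  have hubar := fun K i => T.skeletonTrace_ae_eq_facet hu1 K i
  have h1 : ∫ x in Ω, μ * u x * v x = ∑ K, ∫ x in T.cellInt K, μ * u x * v x :=
    T.setIntegral_domain fun K => ((huK K).memLp.const_mul μ).integrable_mul (hv1 K).memLp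
  have hf : ∫ x in Ω, f x * v x = ∑ K, ∫ x in T.cellInt K, f x * v x := by
    refine T.setIntegral_domain fun K => ?_
    -- Square integrability of `f` on the cells comes from the equation itself.
    have hfK : MemLp f 2 (volume.restrict (interior (hull (T.cell K)))) :=
      (((huK K).memLp.const_mul μ).add (memLp_advection_diffusion hκ (ha K) (huK K))).ae_eq
        (hu_pde.cell hκ hu T K)
    exact hfK.integrable_mul (hv1 K).memLp
  have h2 := Finset.sum_congr rfl fun K (_ : K ∈ Finset.univ) =>
    hu_pde.integral_cell hκ hu ha hdiv hv K
  rw [Finset.sum_add_distrib, Finset.sum_add_distrib] at h2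
  -- The interface value equals the cell trace almost everywhere, so only the physical flux
  -- survives. The part with the trace of `v` is the one that cancels the boundary terms of
  -- `SolvesPDE.integral_cell`.
  have h3 : ∀ K i, ∫ x, inner ℝ (numFlux T κ α a u (T.skeletonTrace u) K i x)
        (normal (T.cell K) i) * (vbar x - trace (T.cell K) v x) ∂facetMeasure (T.cell K) i =
      (∫ x, (κ * inner ℝ (traceGrad (T.cell K) u x) (normal (T.cell K) i)
          - inner ℝ (a x) (normal (T.cell K) i) * trace (T.cell K) u x)
          * vbar x ∂facetMeasure (T.cell K) i)
        - ∫ x, (κ * inner ℝ (traceGrad (T.cell K) u x) (normal (T.cell K) i)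
          - inner ℝ (a x) (normal (T.cell K) i) * trace (T.cell K) u x)
          * trace (T.cell K) v x ∂facetMeasure (T.cell K) i := fun K i => by
    have hF := memLp_normal_flux hκ (ha K) (huK K) i
    refine (integral_congr_ae ?_).trans (integral_sub
      (hF.integrable_mul (memLp_facet_of_mem_Whbar hvbar K i))
      (hF.integrable_mul (memLp_trace_facet (hv1 K) i)))
    filter_upwards [hubar K i] with x hx
    simp only [inner_numFlux, hx]
    ring
  have h4 : ∀ K i, ∫ x, κ * (T.skeletonTrace u x - trace (T.cell K) u x)
      * inner ℝ (traceGrad (T.cell K) v x) (normal (T.cell K) i) ∂facetMeasure (T.cell K) i = 0 :=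
    fun K i => by
    refine (integral_congr_ae ?_).trans (integral_zero _ _)
    filter_upwards [hubar K i] with x hx
    rw [hx, sub_self, mul_zero, zero_mul]
  have h5 : ∀ K i, (if T.IsBdryFacet K i then
        ∫ x, (κ * inner ℝ (traceGrad (T.cell K) u x) (normal (T.cell K) i)
          - inner ℝ (a x) (normal (T.cell K) i) * trace (T.cell K) u x)
          * vbar x ∂facetMeasure (T.cell K) i else 0)
      + (if T.IsBdryFacet K i then
        ∫ x in {x | 0 ≤ inner ℝ (a x) (normal (T.cell K) i)},
          inner ℝ (a x) (normal (T.cell K) i) * vbar x * T.skeletonTrace u x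
            ∂facetMeasure (T.cell K) i else 0) =
      if T.IsBdryFacet K i then ∫ x in ΓN, g x * vbar x ∂facetMeasure (T.cell K) i else 0 :=
    fun K i => by
    split_ifs with hK
    · exact hu_bc.integral_facet hκ hu ha hΓ hvbar hK (hubar K i)
    · exact add_zero 0
  simp only [B, L]
  simp_rw [h3, h4, ← h5, Finset.sum_add_distrib, Finset.sum_sub_distrib]
  rw [h1, hf, ← sum_integral_normal_flux hκ hu, h2]
  simp only [Finset.sum_const_zero]
  ring

end Consistency

end InterfaceFEM

end

theorem mainTheorem8
    (d : ℕ) [NeZero d] (hd : d ≤ 3)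
    (Ω : Set (E d)) (hΩ : IsConnected Ω)
    {ι : Type*} [Fintype ι] (T : Triangulation Ω ι)
    (k : ℕ) (l : ℝ) (hl0 : 0 ≤ l) (hl1 : l ≤ 1)
    (μ κ α : ℝ) (hμ : 0 ≤ μ) (hκ : 0 ≤ κ) (hα : 0 ≤ α)
    (a : E d → E d)
    (ha_lip : ∃ C : NNReal, LipschitzOnWith C a (closure Ω))
    (ha_div : IsDivFree Ω a)
    (ha_bdd : eLpNorm a ⊤ (volume.restrict Ω) ≤ 1)
    (ΓN ΓD : Set (E d)) (hΓ : IsBdryPartition T κ a ΓN ΓD)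
    (f g u : E d → ℝ)
    (hu : MemSobolev (if 0 < κ then 2 else 1) Ω u)
    (hu_pde : SolvesPDE Ω μ κ a f u)
    (hu_bc : SatisfiesBC T κ a ΓN ΓD g u)
    (uh uhbar : E d → ℝ)
    (huh : SolvesFE T k l μ κ α a ΓN ΓD f g uh uhbar) :
    ∀ v ∈ Wh T k, ∀ vbar ∈ Whbar T k l ΓD,
      B T μ κ α a (u - uh) (T.skeletonTrace u - uhbar) v vbar = 0 := by
  intro v hv vbar hvbar
  obtain ⟨C, hC⟩ := ha_lip
  have ha : ∀ K, ContinuousOn a (hull (T.cell K)) := fun K =>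
    hC.continuousOn.mono (T.hull_subset_closure K)
  have hu1 := hu.one
  obtain ⟨huh1, huh2, huh3⟩ := huh
  rw [B_sub hκ ha hu1.memLp huh1.1 hv.1 (fun K => T.memSobolev_cell hu K)
    (fun K => memSobolev_of_mem_Wh huh1 _ K) (fun K => memSobolev_of_mem_Wh hv 2 K)
    (fun K i => (memLp_trace_facet (T.memSobolev_cell hu1 K) i).ae_eq
      (T.skeletonTrace_ae_eq_facet hu1 K i).symm)
    (fun K i => memLp_facet_of_mem_Whbar huh2 K i)
    (fun K i => memLp_facet_of_mem_Whbar hvbar K i), huh3 v hv vbar hvbar,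
    B_skeletonTrace_eq_L hκ ha ha_div hΓ hu hu_pde hu_bc hv hvbar, sub_self]
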